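/- **Setting.** Let $D\subset\mathbb R^2$ be a diagram of a framed oriented trivalent graph without sources and sinks (closed components without vertices are allowed; the framing is the blackboard framing changed by positive and negative half twist symbols on edges), with a balanced coloring $c$ of the edges by non-negative integers: at every vertex the sum of the colors of the entering edges equals that of the leaving edges. A double point with both strands directed upwards is positive if the strand from bottom left to top right passes over, and negative otherwise. Put a small circle around each vertex. $\mathrm{Cr}(D)$ consists of the double points and of the points where an edge enters one of these circles; $\mathrm{Re}(D)$ consists of the regions of the complement of $D$ and of the circle regions. At a double point with both strands directed upwards, the corners are north (between the outgoing ends), south, west and east. With $i$ the color of the strand from bottom left and $j$ the color of the strand from bottom right, their weights $MA$ are: $-t^{i}$ (north), $t^{i}$ (west), $1$ (south), $1$ (east) at a positive double point, and $-t^{-j}$ (north), $t^{-j}$ (east), $1$ (south), $1$ (west) at a negative one. Where an edge of color $i$ enters a circle, the corners are north (inside the circle), west and east (to the left and right of the edge), with weights $t^{i/2}-t^{-i/2}$, $t^{i/2}$, $t^{-i/2}$. Let $\delta$ be an initial point on an edge of color $\neq0$. A state assigns to each element of $\mathrm{Cr}(D)$ one of its corners so that each element of $\mathrm{Re}(D)$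 not adjacent to $\delta$ contains exactly one assigned corner and the two regions adjacent to $\delta$ contain none. $\langle D|\delta\rangle$ is the sum over all states of the products of the weights of the assigned corners; it is $0$ by definition if $D$ is not a connected diagram. The index of the unbounded region is $0$, and the index of the region on the right of an edge of color $i$ exceeds that of the region on its left by $i$; $|\delta|=t^{n+i}-t^{n}$ if the regions adjacent to $\delta$ have indices $n$ and $n+i$. $\mathcal F(D)$ is the product over all edges $e$ of $t^{\frac{c(e)}{4}(p_e-n_e)}$, where $p_e$ ($n_e$) is the number of positive (negative) half twist symbols on $e$. Replace each edge of color $i$ by $i$ parallel strands and resolve all crossings in the oriented way; then $\mathcal C(D,c)=t^{\frac12(\#\text{clockwise curves}-\#\text{counterclockwise curves})}$ for the resulting closed curves. With $|V|$ the number of vertices, put $$\Delta_{(D,c)}(t)=\frac{\mathcal F(D)\,\mathcal C(D,c)}{|\delta|\,(t^{1/2}-t^{-1/2})^{|V|-1}}\,\langle D|\delta\rangle ,\qquad [k]=\frac{t^{k/2}-t^{-k/2}}{t^{1/2}-t^{-1/2}} .$$ **Theorem 4.1.** For every diagram with a non-negative balanced coloring that is not identically zero, $\Delta_{(D,c)}(t)$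 does not depend on $\delta$. Writing $(D)$ for $\Delta_{(D,c)}(t)$, the following relations hold. In each of (iii)–(x), the diagrams agree outside a disk, where the coloring is arbitrary non-negative, and inside the disk they are as described; $i,j,k,l$ are positive integers; strands run upwards unless stated otherwise, and ends, entering edges and leaving edges are listed from left to right. (i) A circle of color $i$, with either orientation, has value $1/[i]$. (ii) $(D)=0$ if the diagram $D$ is disconnected. (iii) A positive (negative) half twist symbol on a strand of color $i$, of either direction, can be deleted at the cost of the factor $t^{i/4}$ ($t^{-i/4}$). (iv) Let $X_+$ ($X_-$) be the positive (negative) crossing with bottom ends $i,j$ and top ends $j,i$. Let $W$ be: $i,j$ merge into an edge $i+j$, which splits into $j,i$. If $i\le j$, let $H$ be: the right strand $j$ splits into $j-i$ and $i$, and the edge $j-i$ merges with the left strand $i$ into $j$; then $$(X_\pm)=\frac{-t^{\pm\frac{i+j}2}}{[i][j]}(H)+\frac{t^{\pm\frac j2}}{[i][i+j]}(W).$$ If $j\le i$, let $H'$ be: the left strand $i$ splits into $j$ and $i-j$, and the edge $i-j$ merges with the right strand $j$ into $i$; then $$(X_\pm)=\frac{-t^{\pm\frac{i+j}2}}{[i][j]}(H')+\frac{t^{\pm\frac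 i2}}{[j][i+j]}(W).$$ (v) A strand $j$ that merges with an edge $i$ into an edge $i+j$, which splits into $j$ and the same edge $i$, where the edge $i$ runs back down on the right (or on the left) of the strand, equals $[j][i+j]$ times the plain strand $j$. (vi) For $j\le i$, a strand $i$ that splits into $i-j$ and $j$, which merge again into $i$, equals $[i]^2$ times the plain strand $i$. (vii) Let $j\le i$, and let the left ends be those of an upward strand $j$ and the right ends those of a downward strand $i$. Let $S$ be the square whose left side is an edge $i$ directed downwards, whose right side is an edge $j$ directed upwards, whose bottom side is an edge $i+j$ directed to the right and whose top side is an edge $i+j$ directed to the left, with the four ends at its corners. Let $T$ consist of a lower arc from the bottom left end to the bottom right end and an upper arc from the top right end to the top left end, joined by an edge $i-j$ directed down from the upper arc to the lower arc. Let $I$ be the two plain strands. Then $$(S)=\frac{[i+j]^3}{[i]}(T)+[j]^2[i+j]^2(I).$$ (viii) A strand $i+j+k$ that splits into $i+j$ and $k$, with $i+j$ splitting into $i$ and $j$, equals $\frac{[i+j]}{[j+k]}$ times the strand $i+j+k$ that splits into $i$ and $j+k$, with $j+k$ splitting into $j$ and $k$. Likewise, merging $i,j$ into $i+j$ and then $i+j,k$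 into $i+j+k$ equals $\frac{[i+j]}{[j+k]}$ times merging $j,k$ into $j+k$ and then $i,j+k$ into $i+j+k$. (ix) Let $j\ge k\ge l$, with bottom ends $i,j$ and top ends $i+k-l,\ j+l-k$. Let $L$ be: an edge $k$ runs from the right strand to the left strand, making the strands $i+k$ and $j-k$, and above it an edge $l$ runs from the left strand to the right strand. Let $W$ be: $i,j$ merge into $i+j$, which splits into $i+k-l,\ j+l-k$. Let $H$ be: a single edge $k-l$ runs from the right strand to the left strand. Then $$(L)=\frac{[j][l][i+k]}{[i+j]}(W)+[i+k][j-k](H).$$ (x) Two neighboring vertical strands of colors $i,j$, of any directions, joined by an edge of color $0$, of either direction, equal $[i][j]$ times the two plain strands. -/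

import Mathlib

/-!
# Diagrams of framed trivalent MOY graphs and their normalized Alexander polynomial

A plane diagram in general position with respect to the height function is cut by horizontal
lines into *layers*, each of which contains exactly one elementary piece: a local minimum, a local
maximum, a crossing, a trivalent vertex or a half twist symbol.  (As usual, after a planar isotopy
the strands at crossings and vertices run upwards.)  A diagram is recorded as the
list of its layers, from bottom to top.  All pictures live in the plane, and every diagram of a
framed trivalent graph without sources and sinks has such a presentation.
-/

namespace MOY

/-- A strand crossing a horizontal line: its color, and whether it is oriented upwards. -/
structure Strand where
  color : ℕ
  up : Bool

/-- An upward strand of color `i`. -/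
def up (i : ℕ) : Strand := ⟨i, true⟩

/-- A downward strand of color `i`. -/
def dn (i : ℕ) : Strand := ⟨i, false⟩

/-- The same strand with the opposite direction. -/
def Strand.rev (s : Strand) : Strand := ⟨s.color, !s.up⟩

/-- The color counted with the sign of the direction. -/
def Strand.flow (s : Strand) : ℤ := if s.up then (s.color : ℤ) else -(s.color : ℤ)

/-- The elementary pieces.
* `cup s`: a local minimum, whose left branch is `s` and whose right branch is `s.rev`.
* `cap s`: a local maximum, whose left branch is `s` and whose right branch is `s.rev`.
* `pos i j`: a positive crossing; the strand of color `i` goes from bottom left to top right and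
  passes over the strand of color `j`, which goes from bottom right to top left.
* `neg i j`: the negative crossing of the same two strands; now the strand of color `j` passes over.
* `merge i j`: a vertex with entering edges `i` (left), `j` (right) and leaving edge `i + j`.
* `split i j`: a vertex with entering edge `i + j` and leaving edges `i` (left), `j` (right).
* `twist s b`: a half twist symbol on the strand `s`, positive if `b` and negative otherwise.

The balance condition for the coloring is built into `merge` and `split`. -/
inductive Piece where
  | cup (s : Strand)
  | cap (s : Strand)
  | pos (i j : ℕ)
  | neg (i j : ℕ)
  | merge (i j : ℕ)
  | split (i j : ℕ)
  | twist (s : Strand) (b : Bool)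

/-- The strands at the bottom of a piece, from left to right. -/
def Piece.dom : Piece → List Strand
  | .cup _ => []
  | .cap s => [s, s.rev]
  | .pos i j => [up i, up j]
  | .neg i j => [up i, up j]
  | .merge i j => [up i, up j]
  | .split i j => [up (i + j)]
  | .twist s _ => [s]

/-- The strands at the top of a piece, from left to right. -/
def Piece.cod : Piece → List Strand
  | .cup s => [s, s.rev]
  | .cap _ => []
  | .pos i j => [up j, up i]
  | .neg i j => [up j, up i]
  | .merge i j => [up (i + j)]
  | .split i j => [up i, up j]
  | .twist s _ => [s]

/-- A layer: one elementary piece, with vertical strands to the left and to the right of it. -/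
structure Layer where
  left : List Strand
  piece : Piece
  right : List Strand

/-- The strands at the bottom of a layer. -/
def Layer.source (l : Layer) : List Strand := l.left ++ l.piece.dom ++ l.right

/-- The strands at the top of a layer. -/
def Layer.target (l : Layer) : List Strand := l.left ++ l.piece.cod ++ l.right

/-- The layers `w` fit together, from the strands `S` at the bottom to the strands `T` at the
top. -/
def IsTangle : List Strand → List Layer → List Strand → Prop
  | S, [], T => S = T
  | S, l :: w, T => l.source = S ∧ IsTangle l.target w T

theorem IsTangle.append {S T U : List Strand} {w w' : List Layer}
    (h : IsTangle S w T) (h' : IsTangle T w' U) : IsTangle S (w ++ w') U := by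
  induction w generalizing S with
  | nil => cases h; exact h'
  | cons l w ih => exact ⟨h.1, ih h.2⟩

/-- Add vertical strands `m` on the left and `n` on the right of all layers. -/
def whisker (m : List Strand) (w : List Layer) (n : List Strand) : List Layer :=
  w.map fun l => ⟨m ++ l.left, l.piece, l.right ++ n⟩

theorem IsTangle.whisker {S T : List Strand} {w : List Layer} (m n : List Strand)
    (h : IsTangle S w T) : IsTangle (m ++ S ++ n) (whisker m w n) (m ++ T ++ n) := by
  induction w generalizing S with
  | nil => cases h; rfl
  | cons l w ih =>
    refine ⟨?_, ?_⟩
    · rw [← h.1]; simp [Layer.source]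
    · have := ih h.2
      simpa [Layer.target, MOY.whisker] using this

/-- A tangle diagram with bottom strands `S` and top strands `T`. -/
structure Tangle (S T : List Strand) where
  layers : List Layer
  isTangle : IsTangle S layers T

/-- A diagram of a framed trivalent graph with a balanced coloring by natural numbers. -/
abbrev Diagram := Tangle [] []

/-- The part of a diagram outside a disk, where the disk meets the strands `S` from below and the
strands `T` from above. -/
structure Outside (S T : List Strand) where
  left : List Strand
  right : List Strand
  below : Tangle [] (left ++ S ++ right)
  above : Tangle (left ++ T ++ right) []

/-- The diagram that is `E` outside the disk and `X` inside. -/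
def Outside.fill {S T : List Strand} (E : Outside S T) (X : Tangle S T) : Diagram :=
  ⟨E.below.layers ++ whisker E.left X.layers E.right ++ E.above.layers,
    (E.below.isTangle.append (X.isTangle.whisker E.left E.right)).append E.above.isTangle⟩

/-! ### Regions and connectedness

The horizontal line number `ℓ` separates layer `ℓ - 1` from layer `ℓ`.  It meets the diagram in
the points `(ℓ, 0)`, `(ℓ, 1)`, …, and these cut it into gaps `(ℓ, 0)`, `(ℓ, 1)`, …, where the gap
`(ℓ, p)` lies just left of the point `(ℓ, p)`. -/

/-- The strands met by the horizontal line number `ℓ`. -/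
def strandsAt (w : List Layer) (ℓ : ℕ) : List Strand :=
  (([] : List Strand) :: w.map Layer.target).getD ℓ []

/-- `(ℓ, p)` is a point of the diagram. -/
def IsPoint (w : List Layer) (x : ℕ × ℕ) : Prop := x.2 < (strandsAt w x.1).length

/-- `(ℓ, g)` is a gap. -/
def IsGap (w : List Layer) (x : ℕ × ℕ) : Prop :=
  x.1 ≤ w.length ∧ x.2 ≤ (strandsAt w x.1).length

/-- Two gaps at the bottom and at the top of a layer belong to the same region if one can move
between them within the layer, to the left or to the right of the elementary piece. -/
inductive GapStep (w : List Layer) : ℕ × ℕ → ℕ × ℕ → Prop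
  | left (k : Fin w.length) (g : ℕ) (hg : g ≤ w[k].left.length) :
      GapStep w (k, g) (k + 1, g)
  | right (k : Fin w.length) (r : ℕ) (hr : r ≤ w[k].right.length) :
      GapStep w (k, w[k].left.length + w[k].piece.dom.length + r)
        (k + 1, w[k].left.length + w[k].piece.cod.length + r)

/-- The classes of gaps: the regions of the plane separated by the diagram. -/
abbrev Face (w : List Layer) := Quot (GapStep w)

/-- The region that contains the gap `x`. -/
def face (w : List Layer) (x : ℕ × ℕ) : Face w := Quot.mk _ x

/-- Two points of the diagram are joined within a layer. -/
inductive PointStep (w : List Layer) : ℕ × ℕ → ℕ × ℕ → Prop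
  | left (k : Fin w.length) (p : ℕ) (hp : p < w[k].left.length) :
      PointStep w (k, p) (k + 1, p)
  | right (k : Fin w.length) (r : ℕ) (hr : r < w[k].right.length) :
      PointStep w (k, w[k].left.length + w[k].piece.dom.length + r)
        (k + 1, w[k].left.length + w[k].piece.cod.length + r)
  | bottom (k : Fin w.length) (p q : ℕ) (hp : p < w[k].piece.dom.length)
      (hq : q < w[k].piece.dom.length) :
      PointStep w (k, w[k].left.length + p) (k, w[k].left.length + q)
  | top (k : Fin w.length) (p q : ℕ) (hp : p < w[k].piece.cod.length)
      (hq : q < w[k].piece.cod.length) :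
      PointStep w (k + 1, w[k].left.length + p) (k + 1, w[k].left.length + q)
  | through (k : Fin w.length) (p q : ℕ) (hp : p < w[k].piece.dom.length)
      (hq : q < w[k].piece.cod.length) :
      PointStep w (k, w[k].left.length + p) (k + 1, w[k].left.length + q)

/-- The diagram is connected, as a subset of the plane. -/
def IsConnected (w : List Layer) : Prop :=
  ∀ x y, IsPoint w x → IsPoint w y → Relation.EqvGen (PointStep w) x y

/-! ### Crossings, corners and states -/

/-- A piece that is a trivalent vertex. -/
def Piece.isVertex : Piece → Bool
  | .merge _ _ => true
  | .split _ _ => true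
  | _ => false

/-- The elements of `Re(D)`: the regions of the plane, and one circle region around every vertex
(the circle region around the vertex in layer `k` is `Sum.inr k`). -/
def regions (w : List Layer) : Set (Face w ⊕ ℕ) :=
  {R | (∃ x, IsGap w x ∧ R = Sum.inl (face w x)) ∨
    ∃ k : Fin w.length, w[k].piece.isVertex = true ∧ R = Sum.inr k.val}

/-- The number of elements of `Cr(D)` in a piece: a double point counts once, and every edge
entering a vertex counts once, where it meets the boundary of the circle region. -/
def Piece.numCrossings : Piece → ℕ
  | .pos _ _ => 1
  | .neg _ _ => 1
  | .merge _ _ => 2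
  | .split _ _ => 1
  | _ => 0

/-- The set `Cr(D)`.  At a `merge`, number `0` is the left entering edge, `1` is the right one. -/
abbrev Crossing (w : List Layer) := (k : Fin w.length) × Fin w[k].piece.numCrossings

inductive Corner where
  | north | south | west | east
  deriving DecidableEq

instance : Fintype Corner :=
  ⟨{.north, .south, .west, .east}, fun x => by cases x <;> decide⟩

/-- The region that contains a given corner at a given crossing.  At a double point the north corner
lies between the two outgoing strands.  At a crossing with a circle region, the north corner is the
one inside the circle, the west (east) corner is the one to the left (right) of the entering edge,
and there is no south corner. -/
def cornerRegion (w : List Layer) (c : Crossing w) : Corner → Option (Face w ⊕ ℕ) :=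
  let k : ℕ := c.1
  let a : ℕ := w[c.1].left.length
  if w[c.1].piece.isVertex then
    fun
    | .north => some (Sum.inr k)
    | .south => none
    | .west => some (Sum.inl (face w (k, a + c.2)))
    | .east => some (Sum.inl (face w (k, a + c.2 + 1)))
  else
    fun
    | .north => some (Sum.inl (face w (k + 1, a + 1)))
    | .south => some (Sum.inl (face w (k, a + 1)))
    | .west => some (Sum.inl (face w (k, a)))
    | .east => some (Sum.inl (face w (k, a + 2)))

/-- A Kauffman state of the diagram with an initial point next to the regions `u` and `v`: it
assigns to every crossing a corner around it, so that every region other than `u` and `v` contains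
exactly one of these corners, and `u` and `v` contain none. -/
def IsState (w : List Layer) (u v : Face w) (s : Crossing w → Corner) : Prop :=
  Set.BijOn (fun c => cornerRegion w c (s c)) Set.univ
    (some '' (regions w \ {Sum.inl u, Sum.inl v}))

noncomputable section

/-- `tq n` is `t ^ (n / 4)`; the generator of the field of rational functions is `t ^ (1 / 4)`. -/
def tq (n : ℤ) : RatFunc ℚ := RatFunc.X ^ n

/-- `t ^ (k / 2) - t ^ (-k / 2)`. -/
def brace (k : ℤ) : RatFunc ℚ := tq (2 * k) - tq (-(2 * k))

/-- The quantum integer `[k] = (t ^ (k / 2) - t ^ (-k / 2)) / (t ^ (1 / 2) - t ^ (-1 / 2))`. -/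
def qint (k : ℤ) : RatFunc ℚ := brace k / brace 1

/-- The sign `M` of a corner of a crossing. -/
def cornerSign : Piece → Corner → RatFunc ℚ
  | .pos _ _, .north => -1
  | .neg _ _, .north => -1
  | _, _ => 1

/-- The contribution `A` of a corner where an edge of color `i` enters a circle region. -/
def circleWeight (i : ℕ) : Corner → RatFunc ℚ
  | .north => brace i
  | .south => 0
  | .west => tq (2 * i)
  | .east => tq (-(2 * i))

/-- The contribution `A` of a corner of crossing number `c` in a piece. -/
def cornerWeight : Piece → ℕ → Corner → RatFunc ℚ
  | .pos i _, _, .north => tq (4 * i)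
  | .pos i _, _, .west => tq (4 * i)
  | .neg _ j, _, .north => tq (-(4 * j))
  | .neg _ j, _, .east => tq (-(4 * j))
  | .merge i _, 0, x => circleWeight i x
  | .merge _ j, _ + 1, x => circleWeight j x
  | .split i j, _, x => circleWeight (i + j) x
  | _, _, _ => 1

open scoped Classical in
/-- The state sum `⟨D | δ⟩ = ∑ M(s) A(s)` over all states `s`, where the initial point `δ` is the
point `x` of the diagram.  It is `0` if the diagram is not connected, or if `δ` is adjacent
to a single region. -/
def stateSum (w : List Layer) (x : ℕ × ℕ) : RatFunc ℚ :=
  let u := face w x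
  let v := face w (x.1, x.2 + 1)
  if IsConnected w ∧ u ≠ v then
    ∑ s : Crossing w → Corner, if IsState w u v s then
      ∏ c : Crossing w, cornerSign w[c.1].piece (s c) * cornerWeight w[c.1].piece c.2 (s c)
    else 0
  else 0

/-! ### The normalizing factors -/

/-- The index of the region that contains the gap `x`: the leftmost gap of every line lies in the
unbounded region, of index `0`, and the index increases by `i` from the left-hand side to the
right-hand side of an edge of color `i`. -/
def index (w : List Layer) (x : ℕ × ℕ) : ℤ :=
  (((strandsAt w x.1).take x.2).map Strand.flow).sum

/-- The factor `|δ| = t ^ (n + i) - t ^ n`, where `n` and `n + i` are the indices of the regions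
adjacent to the initial point `x`. -/
def basepointFactor (w : List Layer) (x : ℕ × ℕ) : RatFunc ℚ :=
  let a := index w x
  let b := index w (x.1, x.2 + 1)
  tq (4 * max a b) - tq (4 * min a b)

/-- The contribution of a piece to the framing factor `F(D)`. -/
def Piece.framing : Piece → RatFunc ℚ
  | .twist s true => tq s.color
  | .twist s false => tq (-s.color)
  | _ => 1

/-- `F(D)`, the product over all edges of
`t ^ (i / 4 * (positive half twists - negative half twists))`. -/
def framing (w : List Layer) : RatFunc ℚ := (w.map fun l => l.piece.framing).prod

/-- The number of parallel strands when every strand of color `i` is replaced by `i` strands. -/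
def width (S : List Strand) : ℕ := (S.map Strand.color).sum

/-- Replace every edge of color `i` by `i` parallel strands and resolve all crossings of the
resulting link diagram in the oriented way.  As all strands at crossings and vertices run upwards,
the resolved strands run through every piece other than a minimum or a maximum
in parallel, in the order from left to right, and they turn back in nested arcs at a minimum or
a maximum.  The point `(ℓ, q)` is the `q`-th resolved strand on the horizontal line number `ℓ`. -/
inductive CurveStep (w : List Layer) : ℕ × ℕ → ℕ × ℕ → Prop
  | left (k : Fin w.length) (q : ℕ) (hq : q < width w[k].left) :
      CurveStep w (k, q) (k + 1, q)
  | right (k : Fin w.length) (r : ℕ) (hr : r < width w[k].right) :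
      CurveStep w (k, width w[k].left + width w[k].piece.dom + r)
        (k + 1, width w[k].left + width w[k].piece.cod + r)
  | through (k : Fin w.length) (q : ℕ) (hq : q < width w[k].piece.dom)
      (hq' : q < width w[k].piece.cod) :
      CurveStep w (k, width w[k].left + q) (k + 1, width w[k].left + q)
  | cup (k : Fin w.length) (s : Strand) (hs : w[k].piece = .cup s) (q : ℕ)
      (hq : q < 2 * s.color) :
      CurveStep w (k + 1, width w[k].left + q) (k + 1, width w[k].left + (2 * s.color - 1 - q))
  | cap (k : Fin w.length) (s : Strand) (hs : w[k].piece = .cap s) (q : ℕ)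
      (hq : q < 2 * s.color) :
      CurveStep w (k, width w[k].left + q) (k, width w[k].left + (2 * s.color - 1 - q))

/-- The closed curves that are oriented at their highest point from left to right (if `b` is
`true`; these are the clockwise curves) or from right to left (if `b` is `false`; these are the
counterclockwise curves). -/
def orientedCurves (w : List Layer) (b : Bool) : Set (Quot (CurveStep w)) :=
  {γ | ∃ (k : Fin w.length) (s : Strand) (q : ℕ), w[k].piece = .cap s ∧ s.up = b ∧
    q < 2 * s.color ∧ γ = Quot.mk _ (k.val, width w[k].left + q) ∧
    ∀ ℓ q', q' < width (strandsAt w ℓ) → γ = Quot.mk _ (ℓ, q') → ℓ ≤ k}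

/-- The colored curliness `C(D, c) = t ^ (1 / 2 * (clockwise curves - counterclockwise curves))`. -/
def curliness (w : List Layer) : RatFunc ℚ :=
  tq (2 * (((orientedCurves w true).ncard : ℤ) - ((orientedCurves w false).ncard : ℤ)))

/-- The number of vertices. -/
def numVertices (w : List Layer) : ℕ := w.countP fun l => l.piece.isVertex

/-- A point on an edge of non-zero color, where an initial point may be placed. -/
def IsBasepoint (D : Diagram) (x : ℕ × ℕ) : Prop :=
  ∃ s, (strandsAt D.layers x.1)[x.2]? = some s ∧ 0 < s.color

/-- The normalized Alexander polynomial, computed with the initial point `x`. -/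
def alexanderAt (D : Diagram) (x : ℕ × ℕ) : RatFunc ℚ :=
  framing D.layers * curliness D.layers /
    (basepointFactor D.layers x * brace 1 ^ ((numVertices D.layers : ℤ) - 1)) *
    stateSum D.layers x

open scoped Classical in
/-- The normalized Alexander polynomial `Δ_{(D, c)}(t)` of a diagram whose coloring is not
identically zero, computed with some initial point on an edge of non-zero color. -/
def alexander (D : Diagram) : RatFunc ℚ :=
  if h : ∃ x, IsBasepoint D x then alexanderAt D h.choose else 0

end

/-! ### The local pictures -/

/-- Vertical strands. -/
def idTangle (S : List Strand) : Tangle S S := ⟨[], rfl⟩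

/-- A tangle that consists of a single piece. -/
def Piece.toTangle (P : Piece) : Tangle P.dom P.cod :=
  ⟨[⟨[], P, []⟩], by simp [IsTangle, Layer.source, Layer.target]⟩

/-- A round circle; its left half is `s` (so `up i` gives the clockwise circle of color `i`). -/
def circle (s : Strand) : Diagram :=
  ⟨[⟨[], .cup s, []⟩, ⟨[], .cap s, []⟩], by simp [IsTangle, Layer.source, Layer.target, Piece.dom,
    Piece.cod]⟩

/-- The strands `i`, `j` go up to `j`, `i`, and an edge of color `j - i` runs from right to left. -/
def bridgeLeft (i j : ℕ) (h : i ≤ j) : Tangle [up i, up j] [up j, up i] :=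
  ⟨[⟨[up i], .split (j - i) i, []⟩, ⟨[], .merge i (j - i), [up i]⟩], by
    simp [IsTangle, Layer.source, Layer.target, Piece.dom, Piece.cod, h]⟩

/-- The strands `i`, `j` go up to `j`, `i`, and an edge of color `i - j` runs from left to right. -/
def bridgeRight (i j : ℕ) (h : j ≤ i) : Tangle [up i, up j] [up j, up i] :=
  ⟨[⟨[], .split j (i - j), [up j]⟩, ⟨[up j], .merge (i - j) j, []⟩], by
    simp [IsTangle, Layer.source, Layer.target, Piece.dom, Piece.cod, h]⟩

/-- The strands `i`, `j` merge to `i + j`, which splits into `j`, `i`. -/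
def wideEdge (i j : ℕ) : Tangle [up i, up j] [up j, up i] :=
  ⟨[⟨[], .merge i j, []⟩, ⟨[], .split j i, []⟩], by
    simp [IsTangle, Layer.source, Layer.target, Piece.dom, Piece.cod, Nat.add_comm]⟩

/-- A strand `j` with an edge of color `i` that leaves it and comes back to it on the right. -/
def loopRight (i j : ℕ) : Tangle [up j] [up j] :=
  ⟨[⟨[up j], .cup (up i), []⟩, ⟨[], .merge j i, [dn i]⟩, ⟨[], .split j i, [dn i]⟩,
    ⟨[up j], .cap (up i), []⟩], by
    simp [IsTangle, Layer.source, Layer.target, Piece.dom, Piece.cod, up, dn, Strand.rev]⟩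

/-- A strand `j` with an edge of color `i` that leaves it and comes back to it on the left. -/
def loopLeft (i j : ℕ) : Tangle [up j] [up j] :=
  ⟨[⟨[], .cup (dn i), [up j]⟩, ⟨[dn i], .merge i j, []⟩, ⟨[dn i], .split i j, []⟩,
    ⟨[], .cap (dn i), [up j]⟩], by
    simp [IsTangle, Layer.source, Layer.target, Piece.dom, Piece.cod, up, dn, Strand.rev]⟩

/-- A strand `i` that splits into `i - j` (left) and `j` (right), which merge again. -/
def bigon (i j : ℕ) (h : j ≤ i) : Tangle [up i] [up i] :=
  ⟨[⟨[], .split (i - j) j, []⟩, ⟨[], .merge (i - j) j, []⟩], by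
    simp [IsTangle, Layer.source, Layer.target, Piece.dom, Piece.cod, h]⟩

/-- The square with four vertices between an upward strand `j` and a downward strand `i`: its sides
are the edges `i` (left, downwards), `j` (right, upwards), and `i + j` (bottom, from left to right,
and top, from right to left). -/
def antiSquare (i j : ℕ) : Tangle [up j, dn i] [up j, dn i] :=
  ⟨[⟨[], .cup (dn i), [up j, dn i]⟩, ⟨[dn i], .merge i j, [dn i]⟩,
    ⟨[dn i], .split j i, [dn i]⟩, ⟨[dn i, up j], .cap (up i), []⟩,
    ⟨[dn i, up j], .cup (up i), []⟩, ⟨[dn i], .merge j i, [dn i]⟩,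
    ⟨[dn i], .split i j, [dn i]⟩, ⟨[], .cap (dn i), [up j, dn i]⟩], by
    simp [IsTangle, Layer.source, Layer.target, Piece.dom, Piece.cod, up, dn, Strand.rev,
      Nat.add_comm]⟩

/-- The bottom ends `j`, `i` and the top ends `j`, `i` are turned back, and an edge of color `i - j`
runs down from the upper arc to the lower arc. -/
def antiEdge (i j : ℕ) (h : j ≤ i) : Tangle [up j, dn i] [up j, dn i] :=
  ⟨[⟨[], .cup (dn (i - j)), [up j, dn i]⟩, ⟨[dn (i - j)], .merge (i - j) j, [dn i]⟩,
    ⟨[dn (i - j)], .cap (up i), []⟩, ⟨[dn (i - j)], .cup (up i), []⟩,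
    ⟨[dn (i - j)], .split (i - j) j, [dn i]⟩, ⟨[], .cap (dn (i - j)), [up j, dn i]⟩], by
    simp [IsTangle, Layer.source, Layer.target, Piece.dom, Piece.cod, up, dn, Strand.rev, h]⟩

/-- A strand `i + j + k` splits into `i + j` and `k`, and then `i + j` splits into `i` and `j`. -/
def splitLeft (i j k : ℕ) : Tangle [up (i + j + k)] [up i, up j, up k] :=
  ⟨[⟨[], .split (i + j) k, []⟩, ⟨[], .split i j, [up k]⟩], by
    simp [IsTangle, Layer.source, Layer.target, Piece.dom, Piece.cod]⟩

/-- A strand `i + j + k` splits into `i` and `j + k`, and then `j + k` splits into `j` and `k`. -/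
def splitRight (i j k : ℕ) : Tangle [up (i + j + k)] [up i, up j, up k] :=
  ⟨[⟨[], .split i (j + k), []⟩, ⟨[up i], .split j k, []⟩], by
    simp [IsTangle, Layer.source, Layer.target, Piece.dom, Piece.cod, Nat.add_assoc]⟩

/-- The strands `i` and `j` merge to `i + j`, which merges with `k`. -/
def mergeLeft (i j k : ℕ) : Tangle [up i, up j, up k] [up (i + j + k)] :=
  ⟨[⟨[], .merge i j, [up k]⟩, ⟨[], .merge (i + j) k, []⟩], by
    simp [IsTangle, Layer.source, Layer.target, Piece.dom, Piece.cod]⟩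

/-- The strands `j` and `k` merge to `j + k`, which merges with `i`. -/
def mergeRight (i j k : ℕ) : Tangle [up i, up j, up k] [up (i + j + k)] :=
  ⟨[⟨[up i], .merge j k, []⟩, ⟨[], .merge i (j + k), []⟩], by
    simp [IsTangle, Layer.source, Layer.target, Piece.dom, Piece.cod, Nat.add_assoc]⟩

/-- The right strand `j` sends an edge `k` to the left strand `i`, and then the left strand sends
an edge `l` to the right strand. -/
def ladder (i j k l : ℕ) (hk : k ≤ j) (hl : l ≤ k) :
    Tangle [up i, up j] [up (i + k - l), up (j + l - k)] :=
  ⟨[⟨[up i], .split k (j - k), []⟩, ⟨[], .merge i k, [up (j - k)]⟩,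
    ⟨[], .split (i + k - l) l, [up (j - k)]⟩, ⟨[up (i + k - l)], .merge l (j - k), []⟩], by
    have h1 : k + (j - k) = j := by omega
    have h2 : i + k - l + l = i + k := by omega
    have h3 : l + (j - k) = j + l - k := by omega
    simp [IsTangle, Layer.source, Layer.target, Piece.dom, Piece.cod, h1, h2, h3]⟩

/-- The strands `i`, `j` merge to `i + j`, which splits into `i + k - l` and `j + l - k`. -/
def ladderWide (i j k l : ℕ) (hk : k ≤ j) (hl : l ≤ k) :
    Tangle [up i, up j] [up (i + k - l), up (j + l - k)] :=
  ⟨[⟨[], .merge i j, []⟩, ⟨[], .split (i + k - l) (j + l - k), []⟩], by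
    have h1 : i + k - l + (j + l - k) = i + j := by omega
    simp [IsTangle, Layer.source, Layer.target, Piece.dom, Piece.cod, h1]⟩

/-- The right strand `j` sends an edge `k - l` to the left strand `i`. -/
def ladderBridge (i j k l : ℕ) (hk : k ≤ j) (hl : l ≤ k) :
    Tangle [up i, up j] [up (i + k - l), up (j + l - k)] :=
  ⟨[⟨[up i], .split (k - l) (j + l - k), []⟩, ⟨[], .merge i (k - l), [up (j + l - k)]⟩], by
    have h1 : k - l + (j + l - k) = j := by omega
    have h2 : i + (k - l) = i + k - l := by omega
    simp [IsTangle, Layer.source, Layer.target, Piece.dom, Piece.cod, h1, h2]⟩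

/-- An edge of color `0` leaves the strand `s` on its right side in the picture (if `s` is downward,
it is turned up around the vertex). -/
def emitRight : (s : Strand) → Tangle [s] [s, up 0]
  | ⟨i, true⟩ => ⟨[⟨[], .split i 0, []⟩], by
      simp [IsTangle, Layer.source, Layer.target, Piece.dom, Piece.cod, up]⟩
  | ⟨i, false⟩ => ⟨[⟨[], .cup (dn i), [dn i]⟩, ⟨[dn i], .split 0 i, [dn i]⟩,
      ⟨[dn i, up 0], .cap (up i), []⟩], by
      simp [IsTangle, Layer.source, Layer.target, Piece.dom, Piece.cod, up, dn, Strand.rev]⟩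

/-- An edge of color `0` leaves the strand `s` on its left side in the picture. -/
def emitLeft : (s : Strand) → Tangle [s] [up 0, s]
  | ⟨i, true⟩ => ⟨[⟨[], .split 0 i, []⟩], by
      simp [IsTangle, Layer.source, Layer.target, Piece.dom, Piece.cod, up]⟩
  | ⟨i, false⟩ => ⟨[⟨[dn i], .cup (up i), []⟩, ⟨[dn i], .split i 0, [dn i]⟩,
      ⟨[], .cap (dn i), [up 0, dn i]⟩], by
      simp [IsTangle, Layer.source, Layer.target, Piece.dom, Piece.cod, up, dn, Strand.rev]⟩

/-- An edge of color `0` enters the strand `s` from its left side in the picture. -/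
def absorbLeft : (s : Strand) → Tangle [up 0, s] [s]
  | ⟨i, true⟩ => ⟨[⟨[], .merge 0 i, []⟩], by
      simp [IsTangle, Layer.source, Layer.target, Piece.dom, Piece.cod, up]⟩
  | ⟨i, false⟩ => ⟨[⟨[], .cup (dn i), [up 0, dn i]⟩, ⟨[dn i], .merge i 0, [dn i]⟩,
      ⟨[dn i], .cap (up i), []⟩], by
      simp [IsTangle, Layer.source, Layer.target, Piece.dom, Piece.cod, up, dn, Strand.rev]⟩

/-- An edge of color `0` enters the strand `s` from its right side in the picture. -/
def absorbRight : (s : Strand) → Tangle [s, up 0] [s]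
  | ⟨i, true⟩ => ⟨[⟨[], .merge i 0, []⟩], by
      simp [IsTangle, Layer.source, Layer.target, Piece.dom, Piece.cod, up]⟩
  | ⟨i, false⟩ => ⟨[⟨[dn i, up 0], .cup (up i), []⟩, ⟨[dn i], .merge 0 i, [dn i]⟩,
      ⟨[], .cap (dn i), [dn i]⟩], by
      simp [IsTangle, Layer.source, Layer.target, Piece.dom, Piece.cod, up, dn, Strand.rev]⟩

/-- Two vertical strands, of any directions, joined by an edge of color `0` from left to right. -/
def zeroEdgeRight (s s' : Strand) : Tangle [s, s'] [s, s'] :=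
  ⟨whisker [] (emitRight s).layers [s'] ++ whisker [s] (absorbLeft s').layers [],
    ((emitRight s).isTangle.whisker [] [s']).append ((absorbLeft s').isTangle.whisker [s] [])⟩

/-- Two vertical strands, of any directions, joined by an edge of color `0` from right to left. -/
def zeroEdgeLeft (s s' : Strand) : Tangle [s, s'] [s, s'] :=
  ⟨whisker [s] (emitLeft s').layers [] ++ whisker [] (absorbRight s).layers [s'],
    ((emitLeft s').isTangle.whisker [s] []).append ((absorbRight s).isTangle.whisker [] [s'])⟩

end MOY

open MOY

/-!
Why the invariant does not depend on the initial point, and why its relations are local.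

**Transfer operators.** A horizontal line meets the diagram in finitely many points, which cut it
into gaps. The state sum is evaluated from bottom to top, and each gap of the current line carries
one bit, which tells whether that gap has already been covered by a corner, or by one of
the two marks next to the initial point. Every piece acts on the bits of the gaps next to it
(`moves`, `act`, `step`), and the composition of all these operators, with two adjacent bits
switched on at the initial point (`mark`), is the amplitude `amp`.

A region meets many lines, hence it has many gaps, but a state covers it only once. This is
remedied by letting each vertical edge that joins two consecutive gaps of a region cover one of its
two ends. If the gaps of a region form a tree, there is exactly one way of doing this for which
all gaps are covered once, provided that just one gap is covered from elsewhere, and there is none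
otherwise (`coeff_forest`, with a state encoded as a square-free monomial, and the
edges as factors `X v + X u`). In a connected diagram the gaps of every region do form a tree:
a flow along the vertical edges has a stream function, which is constant on the components of
the diagram (`isForest_gapEdge`). So the amplitude is the state sum (`stateSum_eq_amp`).

**Independence of the initial point.** Assign numbers `x` to the gaps, and consider the operator
`contract` that uncovers one gap, weighted by `x` and by a sign which depends on the bits to the
left of the gap, as for the annihilation operator of a fermion. If `x` is harmonic, it commutes
with all pieces (`contract_step`), and it kills the final vector and the initial state.
Commuting it past the operators `ins`, which cover a single gap, shows that the amplitudes for two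
different initial points are proportional to the jumps of `x` across these points (`exchange`). The
function `t ^ index` is harmonic, and its jump is `|δ|` up to sign. So the quotient of the
amplitude by `|δ|` does not depend on the initial point (`amp_mul_basepointFactor`). In a
disconnected diagram there is a harmonic function that jumps only along one component: the
power of `t` whose exponent is the index with respect to that component, or, if all colors of
the component are `0`, an index that ignores the colors. Then all amplitudes vanish
(`amp_eq_zero_of_not_isConnected`), as the definition of the state sum demands.

**The other factors.** The colored curliness is the product of local contributions of the maxima and
the minima (`curliness_eq`). This is proved by following the resolved curves from bottom to top:
the open arcs form a non-crossing matching of the points of the current line, so a maximum closes an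
arc or joins two arcs in one of the few possible ways (`Matching.cap`), and one tracks the
number of clockwise closed curves minus that of counterclockwise ones minus the number of open arcs
whose left end is directed downwards.

**The relations.** By these facts the invariant is a product of local factors and of an amplitude
(`alexander_eq_amp`). With the initial point on the leftmost strand below the disk, the two leftmost
gaps below the disk are covered, and a relation holds as soon as it holds for the transfer operators
of the tangles inside the disk on such bits (`local_relation`). This is a short computation for
each relation.
-/

namespace MOY

noncomputable section

/-! ### The transfer operators -/

/-- Covectors on the bits of a horizontal line: a functional on the space that is spanned by the
lists of bits, one bit for each gap, where `true` means that the gap is covered from below. -/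
abbrev Cov := List Bool → RatFunc ℚ

/-- The moves of a crossing with the weights `n`, `s`, `w`, `e` of its corners. The three bits
belong to the gaps on its left, below or above it, and on its right. The gap below the crossing ends
there, so the south corner is chosen if and only if this gap is not covered yet. Otherwise one
chooses the north corner, which covers the new gap above the crossing, or one of the side corners,
which requires that the gap on that side is not covered. -/
def crossingMoves (n s w e : RatFunc ℚ) : Bool → Bool → Bool → List (RatFunc ℚ × List Bool)
  | x, false, z => [(s, [x, false, z])]
  | x, true, z => (n, [x, true, z]) ::
      ((if x then [] else [(w, [true, false, z])]) ++
        (if z then [] else [(e, [x, false, true])]))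

/-- The possible ways to continue a partial state across a piece: the weight and the new bits, for
given bits of the gaps next to the piece. At a minimum, the gap below is continued by two gaps of
the same region: if the gap below is covered already, the vertical edges cover both of them, and
otherwise one edge covers the gap below and the other one its upper end. At a maximum, the inner gap
ends and has to be covered, and the two outer gaps are joined, so that they cannot both be covered.
At a vertex, the circle region has to be covered by exactly one of the entering edges; the other
one, if any, takes a corner on its left or right. -/
def moves : Piece → List Bool → List (RatFunc ℚ × List Bool)
  | .cup _, [true] => [(1, [true, false, true])]
  | .cup _, [false] => [(1, [true, false, false]), (1, [false, false, true])]
  | .cap _, [x, true, z] => if x && z then [] else [(1, [x || z])]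
  | .twist _ _, [x, y] => [(1, [x, y])]
  | .pos i _, [x, y, z] => crossingMoves (-tq (4 * i)) 1 (tq (4 * i)) 1 x y z
  | .neg _ j, [x, y, z] => crossingMoves (-tq (-(4 * j))) 1 1 (tq (-(4 * j))) x y z
  | .split i j, [x, z] => [(brace (i + j), [x, false, z])]
  | .merge i j, [x, false, z] => [(brace (i + j), [x, z])]
  | .merge i j, [x, true, z] =>
      (if x then [] else [(tq (2 * i) * brace j, [true, z])]) ++
        (if z then [] else [(brace i * tq (-(2 * j)), [x, true])])
  | _, _ => []

/-- The transfer operator of a piece, acting on covectors on the bits of the gaps next to it. -/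
def act (P : Piece) (h : Cov) (m : List Bool) : RatFunc ℚ :=
  ((moves P m).map fun e => e.1 * h e.2).sum

/-- The transfer operator of a layer: its piece acts on the bits of the gaps next to it, and all
other bits are kept. -/
def step (l : Layer) (h : Cov) : Cov := fun I =>
  act l.piece (fun m => h (I.take l.left.length ++ m ++
      I.drop (l.left.length + l.piece.dom.length + 1)))
    ((I.drop l.left.length).take (l.piece.dom.length + 1))

theorem step_append (l : Layer) (h : Cov) {A m C : List Bool} (hA : A.length = l.left.length)
    (hm : m.length = l.piece.dom.length + 1) :
    step l h (A ++ m ++ C) = act l.piece (fun m' => h (A ++ m' ++ C)) m := by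
  unfold step
  have h1 : (A ++ m ++ C).take l.left.length = A := by simp [← hA]
  have h2 : (A ++ m ++ C).drop (l.left.length + l.piece.dom.length + 1) = C := by
    rw [← hA, Nat.add_assoc, ← hm]; simp
  have h3 : ((A ++ m ++ C).drop l.left.length).take (l.piece.dom.length + 1) = m := by
    rw [← hA, ← hm]; simp
  rw [h1, h2, h3]

/-- The covector on the line below the final maximum: all three gaps have to be covered from below.
(The maximum itself is left out: it would join the two outer gaps, which lie in the unbounded region
already, and create a cycle of gaps.) -/
def fin : Cov := fun I => if I = [true, true, true] then 1 else 0

/-- The transfer operator of a list of layers, given from bottom to top. As covectors are pulled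
back, the topmost layer acts first. -/
def sweep (w : List Layer) (h : Cov) : Cov := w.foldr step h

/-- The covector at the bottom of a part of a diagram that contains its final maximum. -/
def upper (w : List Layer) : Cov := sweep w.dropLast fin

theorem sweep_nil (h : Cov) : sweep [] h = h := rfl
theorem sweep_cons (l : Layer) (w : List Layer) (h : Cov) :
    sweep (l :: w) h = step l (sweep w h) := rfl
theorem sweep_append (w w' : List Layer) (h : Cov) :
    sweep (w ++ w') h = sweep w (sweep w' h) := by simp [sweep]

theorem upper_append (w w' : List Layer) (h : w' ≠ []) :
    upper (w ++ w') = sweep w (upper w') := by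
  rw [upper, List.dropLast_append_of_ne_nil h, sweep_append, upper]

/-- The operator that covers the two gaps next to the point number `p`. It vanishes on lists in
which one of these gaps is covered already. -/
def mark : ℕ → Cov → Cov
  | 0, h => fun
    | false :: false :: I => h (true :: true :: I)
    | _ => 0
  | p + 1, h => fun
    | b :: I => mark p (fun J => h (b :: J)) I
    | [] => 0

/-- The transfer amplitude of a diagram with the initial point `x`: on the bottom line, there is one
gap, which is not covered. -/
def amp (w : List Layer) (x : ℕ × ℕ) : RatFunc ℚ :=
  sweep (w.take x.1) (mark x.2 (upper (w.drop x.1))) [false]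

theorem act_congr (P : Piece) {h h' : Cov} {m : List Bool}
    (H : ∀ m', m'.length = P.cod.length + 1 → h m' = h' m') : act P h m = act P h' m := by
  unfold act
  congr 1
  apply List.map_congr_left
  intro e he
  rw [H]
  revert he
  unfold moves crossingMoves
  split <;> (try split) <;> simp [Piece.cod] <;> aesop

theorem act_add (P : Piece) (h h' : Cov) (m : List Bool) :
    act P (fun I => h I + h' I) m = act P h m + act P h' m := by
  simp [act, mul_add, List.sum_map_add]

theorem act_smul (P : Piece) (c : RatFunc ℚ) (h : Cov) (m : List Bool) :
    act P (fun I => c * h I) m = c * act P h m := by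
  rw [act, act, ← List.sum_map_mul_left]
  congr 2; ext e; ring

theorem Layer.length_source (l : Layer) :
    l.source.length = l.left.length + l.piece.dom.length + l.right.length := by
  simp [Layer.source]; omega

theorem Layer.length_target (l : Layer) :
    l.target.length = l.left.length + l.piece.cod.length + l.right.length := by
  simp [Layer.target]; omega

/-- Every list of bits on the bottom line of a layer splits. -/
theorem exists_split (l : Layer) {I : List Bool} (hI : I.length = l.source.length + 1) :
    ∃ A m C : List Bool, I = A ++ m ++ C ∧ A.length = l.left.length ∧
      m.length = l.piece.dom.length + 1 ∧ C.length = l.right.length := by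
  rw [l.length_source] at hI
  refine ⟨I.take l.left.length, (I.drop l.left.length).take (l.piece.dom.length + 1),
    I.drop (l.left.length + (l.piece.dom.length + 1)), ?_, ?_, ?_, ?_⟩
  · rw [← List.drop_drop, List.append_assoc, List.take_append_drop, List.take_append_drop]
  all_goals simp; omega

theorem step_congr (l : Layer) {h h' : Cov}
    (H : ∀ I : List Bool, I.length = l.target.length + 1 → h I = h' I)
    {I : List Bool} (hI : I.length = l.source.length + 1) : step l h I = step l h' I := by
  obtain ⟨A, m, C, rfl, hA, hm, hC⟩ := exists_split l hI
  rw [step_append l h hA hm, step_append l h' hA hm]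
  apply act_congr
  intro m' hm'
  apply H
  rw [l.length_target]; simp; omega

theorem sweep_congr {S T : List Strand} {w : List Layer} (hw : IsTangle S w T) {h h' : Cov}
    (H : ∀ I : List Bool, I.length = T.length + 1 → h I = h' I)
    {I : List Bool} (hI : I.length = S.length + 1) : sweep w h I = sweep w h' I := by
  induction w generalizing S I with
  | nil => cases hw; exact H I hI
  | cons l w ih =>
    obtain ⟨rfl, hw⟩ := hw
    exact step_congr l (fun J hJ => ih hw hJ) hI

end

noncomputable section

/-! ### Contractions -/

/-- The sign with which a fermionic operator passes a gap that carries the bit `b`. -/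
def sg (b : Bool) : RatFunc ℚ := if b then -1 else 1

/-- The fermionic contraction: the sum over all covered gaps of the operators that uncover this gap.
The list contains for every gap a weight and the sign of the strand on its right. The summand of a
gap is multiplied by its weight, and by the signs of all strands and covered gaps on its left. (The
sign in the last entry does not matter.) -/
def contract : List (RatFunc ℚ × RatFunc ℚ) → Cov → Cov
  | (x, j) :: L, h => fun
    | b :: I => (if b then x * h (false :: I) else 0) +
        sg b * j * contract L (fun J => h (b :: J)) I
    | [] => 0
  | [], _ => fun _ => 0

/-- The sign that is picked up on the way across a list of gaps. -/
def signs : List (RatFunc ℚ × RatFunc ℚ) → List Bool → RatFunc ℚ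
  | (_, j) :: L, b :: I => sg b * j * signs L I
  | _, _ => 1

theorem contract_append (L L' : List (RatFunc ℚ × RatFunc ℚ)) (h : Cov) (A M : List Bool)
    (hA : A.length = L.length) :
    contract (L ++ L') h (A ++ M) =
      contract L (fun A' => h (A' ++ M)) A +
        signs L A * contract L' (fun M' => h (A ++ M')) M := by
  induction L generalizing A h with
  | nil =>
    obtain rfl : A = [] := List.length_eq_zero_iff.1 (by simpa using hA)
    simp [contract, signs]
  | cons e L ih =>
    obtain ⟨x, j⟩ := e
    cases A with
    | nil => simp at hA
    | cons b A =>
      simp only [List.cons_append, contract, signs]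
      rw [ih _ A (by simpa using hA)]
      ring

theorem contract_congr (L : List (RatFunc ℚ × RatFunc ℚ)) {h h' : Cov}
    (H : ∀ I : List Bool, I.length = L.length → h I = h' I) {I : List Bool}
    (hI : I.length = L.length) : contract L h I = contract L h' I := by
  induction L generalizing I h h' with
  | nil => rfl
  | cons e L ih =>
    obtain ⟨x, j⟩ := e
    cases I with
    | nil => rfl
    | cons b I =>
      have hI' : I.length = L.length := by simpa using hI
      simp only [contract]
      rw [ih (fun J hJ => H (b :: J) (by simp [hJ])) hI', H (false :: I) (by simp [hI'])]

theorem contract_act (L : List (RatFunc ℚ × RatFunc ℚ)) (P : Piece)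
    (g : List Bool → List Bool → RatFunc ℚ) (m A : List Bool) :
    contract L (fun A' => act P (g A') m) A =
      act P (fun m' => contract L (fun A' => g A' m') A) m := by
  induction L generalizing A g with
  | nil => simp [contract, act]
  | cons e L ih =>
    obtain ⟨x, j⟩ := e
    cases A with
    | nil => simp [contract, act]
    | cons b A =>
      simp only [contract]
      rw [ih, act_add, act_smul]
      congr 1
      cases b
      · simp [act]
      · simp [act_smul]

theorem contract_smul (L : List (RatFunc ℚ × RatFunc ℚ)) (c : RatFunc ℚ) (h : Cov)
    (I : List Bool) :
    contract L (fun J => c * h J) I = c * contract L h I := by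
  induction L generalizing I h with
  | nil => simp [contract]
  | cons e L ih =>
    cases I with
    | nil => simp [contract]
    | cons b I =>
      simp only [contract]
      rw [ih]
      split <;> ring

theorem contract_zero (L : List (RatFunc ℚ × RatFunc ℚ)) (I : List Bool) :
    contract L (fun _ => 0) I = 0 := by
  simpa using contract_smul L 0 (fun _ => 0) I

/-- The contractions with the data `L` below and `L'` above the piece `P` are intertwined by the
transfer operator of the piece, and the moves preserve the total sign. The latter is what an
operator on the gaps further to the right picks up. -/
def Commutes (P : Piece) (L L' : List (RatFunc ℚ × RatFunc ℚ)) : Prop :=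
  ∀ m : List Bool, m.length = P.dom.length + 1 →
    (∀ h, contract L (act P h) m = act P (contract L' h) m) ∧
    ∀ e ∈ moves P m, signs L' e.2 = signs L m

/-- If the contraction commutes with a piece, it commutes with a layer that contains this piece: the
gaps on the left are independent of the piece, and the operators for the gaps on the right pick up
the same sign above and below the piece. -/
theorem contract_step (l : Layer) {LA L L' R : List (RatFunc ℚ × RatFunc ℚ)}
    (hA : LA.length = l.left.length) (hL : L.length = l.piece.dom.length + 1)
    (hL' : L'.length = l.piece.cod.length + 1) (hR : R.length = l.right.length)
    (H : Commutes l.piece L L') (h : Cov) {I : List Bool} (hI : I.length = l.source.length + 1) :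
    contract (LA ++ L ++ R) (step l h) I = step l (contract (LA ++ L' ++ R) h) I := by
  obtain ⟨A, m, C, rfl, hlA, hm, hC⟩ := exists_split l hI
  rw [step_append l _ hlA hm]
  have e1 : ∀ m' : List Bool, m'.length = l.piece.cod.length + 1 →
      contract (LA ++ L' ++ R) h (A ++ m' ++ C) =
        contract LA (fun A' => h (A' ++ m' ++ C)) A + signs LA A *
          (contract L' (fun M => h (A ++ M ++ C)) m' +
            signs L' m' * contract R (fun C' => h (A ++ m' ++ C')) C) := by
    intro m' hm'
    rw [List.append_assoc, List.append_assoc, contract_append _ _ _ _ _ (by omega),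
      contract_append _ _ _ _ _ (by omega)]
    simp only [List.append_assoc]
  rw [act_congr l.piece e1, List.append_assoc, List.append_assoc,
    contract_append _ _ _ _ _ (by omega), contract_append _ _ _ _ _ (by omega)]
  rw [act_add, act_smul, act_add]
  congr 1
  · rw [← contract_act]
    apply contract_congr _ _ (by omega)
    intro A' hA'
    rw [← List.append_assoc, step_append l h (by omega) hm]
  · congr 1
    congr 1
    · rw [← (H m hm).1]
      apply contract_congr _ _ (by omega)
      intro M hM
      rw [← List.append_assoc, step_append l h (by omega) (by omega)]
    · have e2 : act l.piece (fun m' => signs L' m' *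
          contract R (fun C' => h (A ++ m' ++ C')) C) m =
          act l.piece (fun m' => signs L m *
          contract R (fun C' => h (A ++ m' ++ C')) C) m := by
        unfold act
        congr 1
        apply List.map_congr_left
        intro e he
        simp only [(H m hm).2 e he]
      rw [e2, act_smul, ← contract_act]
      congr 1
      apply contract_congr _ _ (by omega)
      intro C' hC'
      rw [← List.append_assoc, step_append l h (by omega) (by omega)]

/-! ### Insertions -/

/-- The fermionic operator that covers the gap number `g`, with the same signs as in `contract`; the
weights in the list play no role. -/
def ins : List (RatFunc ℚ × RatFunc ℚ) → ℕ → Cov → Cov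
  | _ :: _, 0, h => fun
    | b :: I => if b then 0 else h (true :: I)
    | [] => 0
  | (_, j) :: L, g + 1, h => fun
    | b :: I => sg b * j * ins L g (fun J => h (b :: J)) I
    | [] => 0
  | [], _, _ => fun _ => 0

theorem ins_congr_data {L L' : List (RatFunc ℚ × RatFunc ℚ)}
    (hL : L.map Prod.snd = L'.map Prod.snd) (g : ℕ) (h : Cov) : ins L g h = ins L' g h := by
  induction L generalizing L' g h with
  | nil =>
    obtain rfl : L' = [] := by simpa using hL.symm
    rfl
  | cons e L ih =>
    cases L' with
    | nil => simp at hL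
    | cons e' L' =>
      simp only [List.map_cons, List.cons.injEq] at hL
      cases g with
      | zero => rfl
      | succ g =>
        funext I
        cases I with
        | nil => rfl
        | cons b I => simp only [ins, hL.1, ih hL.2]

theorem ins_add (L : List (RatFunc ℚ × RatFunc ℚ)) (g : ℕ) (h h' : Cov) (I : List Bool) :
    ins L g (fun J => h J + h' J) I = ins L g h I + ins L g h' I := by
  induction L generalizing g I h h' with
  | nil => simp [ins]
  | cons e L ih =>
    cases I with
    | nil => cases g <;> simp [ins]
    | cons b I =>
      cases g with
      | zero => simp only [ins]; split <;> simp
      | succ g => simp only [ins]; rw [ih]; ring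

theorem ins_smul (L : List (RatFunc ℚ × RatFunc ℚ)) (g : ℕ) (c : RatFunc ℚ) (h : Cov)
    (I : List Bool) : ins L g (fun J => c * h J) I = c * ins L g h I := by
  induction L generalizing g I h with
  | nil => simp [ins]
  | cons e L ih =>
    cases I with
    | nil => cases g <;> simp [ins]
    | cons b I =>
      cases g with
      | zero => simp only [ins]; split <;> simp
      | succ g => simp only [ins]; rw [ih]; ring

theorem ins_congr (L : List (RatFunc ℚ × RatFunc ℚ)) (g : ℕ) {h h' : Cov} {n : ℕ}
    (H : ∀ I : List Bool, I.length = n → h I = h' I) {I : List Bool}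
    (hI : I.length = n) : ins L g h I = ins L g h' I := by
  induction L generalizing g I h h' n with
  | nil => rfl
  | cons e L ih =>
    cases I with
    | nil => cases g <;> rfl
    | cons b I =>
      cases g with
      | zero =>
        simp only [ins]
        rw [H (true :: I) (by simpa using hI)]
      | succ g =>
        simp only [ins]
        rw [ih g (n := I.length) (fun J hJ => H (b :: J) (by simpa [hJ] using hI)) rfl]

/-- The canonical anticommutation relation: the anticommutator of the contraction and the operator
that covers the gap `g` is the weight of this gap. -/
theorem contract_ins (L : List (RatFunc ℚ × RatFunc ℚ)) (g : ℕ) (hg : g < L.length)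
    (hL : ∀ e ∈ L, e.2 = 1 ∨ e.2 = -1) (h : Cov)
    (I : List Bool) (hI : I.length = L.length) :
    contract L (ins L g h) I = L[g].1 * h I - ins L g (contract L h) I := by
  induction L generalizing g I h with
  | nil => simp at hg
  | cons e L ih =>
    obtain ⟨x, j⟩ := e
    cases I with
    | nil => simp at hI
    | cons b I =>
      cases g with
      | zero =>
        cases b
        · simp [contract, ins, sg]
        · simp [contract, ins, sg, contract_zero]
      | succ g =>
        simp only [contract, ins, List.getElem_cons_succ]
        rw [contract_smul, ih g (by simpa using hg) (fun e he => hL e (by simp [he])) _ _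
          (by simpa using hI), ins_add, ins_smul]
        have h0 := ins_smul L g 0 (fun _ => 0) I
        simp only [zero_mul] at h0
        rcases hL (x, j) (by simp) with h1 | h1 <;> simp only at h1 <;> subst h1 <;>
          cases b <;> simp [sg, ins_smul, h0] <;> ring

/-- Covering two adjacent gaps by fermionic operators is the same as marking them, up to sign,
because all signs to the left cancel. -/
theorem ins_ins (L : List (RatFunc ℚ × RatFunc ℚ)) (p : ℕ) (hp : p + 1 < L.length)
    (hL : ∀ e ∈ L, e.2 = 1 ∨ e.2 = -1) (h : Cov)
    (I : List Bool) : ins L p (ins L (p + 1) h) I = - L[p].2 * mark p h I := by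
  induction L generalizing p I h with
  | nil => simp at hp
  | cons e L ih =>
    obtain ⟨x, j⟩ := e
    cases I with
    | nil => cases p <;> simp [ins, mark]
    | cons b I =>
      cases p with
      | zero =>
        cases L with
        | nil => simp at hp
        | cons e' L =>
          cases I with
          | nil => cases b <;> simp [ins, mark]
          | cons b' I => cases b <;> cases b' <;> simp [ins, mark, sg]
      | succ p =>
        simp only [ins, mark, List.getElem_cons_succ]
        rw [ins_smul, ih p (by simpa using hp) (fun e he => hL e (by simp [he]))]
        rcases hL (x, j) (by simp) with h1 | h1 <;> simp only at h1 <;> subst h1 <;>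
          cases b <;> simp [sg]

end

noncomputable section

/-! ### Exchanging the initial point -/

theorem step_add (l : Layer) (h h' : Cov) (I : List Bool) :
    step l (fun J => h J + h' J) I = step l h I + step l h' I := act_add _ _ _ _

theorem step_smul (l : Layer) (c : RatFunc ℚ) (h : Cov) (I : List Bool) :
    step l (fun J => c * h J) I = c * step l h I := act_smul _ _ _ _

theorem sweep_add (w : List Layer) (h h' : Cov) (I : List Bool) :
    sweep w (fun J => h J + h' J) I = sweep w h I + sweep w h' I := by
  induction w generalizing I with
  | nil => rfl
  | cons l w ih =>
    rw [sweep_cons, sweep_cons, sweep_cons, ← step_add]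
    congr 1; funext J; exact ih J

theorem sweep_smul (w : List Layer) (c : RatFunc ℚ) (h : Cov) (I : List Bool) :
    sweep w (fun J => c * h J) I = c * sweep w h I := by
  induction w generalizing I with
  | nil => rfl
  | cons l w ih =>
    rw [sweep_cons, sweep_cons, ← step_smul]
    congr 1; funext J; exact ih J

/-- The data on the two boundary lines of a layer are compatible. -/
def LayerCompat (l : Layer) (X Y : List (RatFunc ℚ × RatFunc ℚ)) : Prop :=
  ∃ LA L L' R : List (RatFunc ℚ × RatFunc ℚ), X = LA ++ L ++ R ∧ Y = LA ++ L' ++ R ∧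
    LA.length = l.left.length ∧ L.length = l.piece.dom.length + 1 ∧
    L'.length = l.piece.cod.length + 1 ∧ R.length = l.right.length ∧ Commutes l.piece L L'

/-- The contractions with the data `X k` on the lines number `k` commute with all layers. -/
def Compat : List Layer → (ℕ → List (RatFunc ℚ × RatFunc ℚ)) → Prop
  | [], _ => True
  | l :: w, X => LayerCompat l (X 0) (X 1) ∧ Compat w (fun k => X (k + 1))

theorem Compat.append {w w' : List Layer} {X : ℕ → List (RatFunc ℚ × RatFunc ℚ)}
    (h : Compat (w ++ w') X) : Compat w X ∧ Compat w' (fun k => X (w.length + k)) := by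
  induction w generalizing X with
  | nil => simpa [Compat] using h
  | cons l w ih =>
    obtain ⟨h1, h2⟩ := h
    refine ⟨⟨h1, (ih h2).1⟩, ?_⟩
    have := (ih h2).2
    simpa [Nat.add_right_comm, Nat.add_assoc, Nat.add_comm 1] using this

theorem compat_of_forall {w : List Layer} {X : ℕ → List (RatFunc ℚ × RatFunc ℚ)}
    (h : ∀ (k : ℕ) (hk : k < w.length), LayerCompat w[k] (X k) (X (k + 1))) : Compat w X := by
  induction w generalizing X with
  | nil => trivial
  | cons l w ih =>
    refine ⟨h 0 (by simp), ih fun k hk => ?_⟩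
    exact h (k + 1) (by simpa using hk)

theorem Compat.length {S T : List Strand} {w : List Layer} (hw : IsTangle S w T)
    {X : ℕ → List (RatFunc ℚ × RatFunc ℚ)} (h : Compat w X) (h0 : (X 0).length = S.length + 1) :
    (X w.length).length = T.length + 1 := by
  induction w generalizing S X with
  | nil => cases hw; exact h0
  | cons l w ih =>
    obtain ⟨rfl, hw⟩ := hw
    obtain ⟨⟨LA, L, L', R, h1, h2, hA, hL, hL', hR, -⟩, h⟩ := h
    apply ih hw h
    rw [h2, l.length_target]
    simp; omega

/-- The contraction commutes with the transfer operator of a tangle. -/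
theorem contract_sweep {S T : List Strand} {w : List Layer} (hw : IsTangle S w T)
    {X : ℕ → List (RatFunc ℚ × RatFunc ℚ)} (h : Compat w X) (H : Cov) {I : List Bool}
    (hI : I.length = S.length + 1) :
    contract (X 0) (sweep w H) I = sweep w (contract (X w.length) H) I := by
  induction w generalizing S X I with
  | nil => rfl
  | cons l w ih =>
    obtain ⟨rfl, hw⟩ := hw
    obtain ⟨⟨LA, L, L', R, h1, h2, hA, hL, hL', hR, hc⟩, h⟩ := h
    rw [h1, sweep_cons, sweep_cons, contract_step l hA hL hL' hR hc _ hI, ← h2]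
    apply step_congr l _ hI
    intro J hJ
    exact ih hw h hJ

/-- The contraction kills the final covector, which does not vanish only if all gaps are covered,
but uncovering leaves at most two covered gaps. -/
theorem contract_fin (X : List (RatFunc ℚ × RatFunc ℚ)) {I : List Bool} (hX : X.length = 3)
    (hI : I.length = 3) : contract X fin I = 0 := by
  match X, I, hX, hI with
  | [(x1, j1), (x2, j2), (x3, j3)], [b1, b2, b3], _, _ => simp [contract, fin]

/-- The last layer of a closed diagram is a maximum. -/
theorem exists_last {S : List Strand} {w : List Layer} (hw : IsTangle S w []) (h0 : w ≠ []) :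
    ∃ u s, w = u ++ [⟨[], .cap s, []⟩] ∧ IsTangle S u [s, s.rev] := by
  induction w generalizing S with
  | nil => exact absurd rfl h0
  | cons l w ih =>
    obtain ⟨rfl, hw⟩ := hw
    by_cases hn : w = []
    · subst hn
      have ht : l.target = [] := hw
      obtain ⟨L, P, R⟩ := l
      simp only [Layer.target, List.append_eq_nil_iff] at ht
      obtain ⟨⟨rfl, hP⟩, rfl⟩ := ht
      cases P <;> simp [Piece.cod] at hP
      exact ⟨[], _, rfl, by simp [IsTangle, Layer.source, Piece.dom]⟩
    · obtain ⟨u, s, rfl, hu⟩ := ih hw hn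
      exact ⟨l :: u, s, rfl, rfl, hu⟩

theorem contract_upper {S : List Strand} {w : List Layer} (hw : IsTangle S w []) (h0 : w ≠ [])
    {X : ℕ → List (RatFunc ℚ × RatFunc ℚ)} (h : Compat w X) (hX : (X 0).length = S.length + 1)
    {I : List Bool} (hI : I.length = S.length + 1) : contract (X 0) (upper w) I = 0 := by
  obtain ⟨u, s, rfl, hu⟩ := exists_last hw h0
  have hd : (u ++ [(⟨[], .cap s, []⟩ : Layer)]).dropLast = u := by simp
  rw [upper, hd, contract_sweep hu h.append.1 _ hI]
  have hl := Compat.length hu h.append.1 hX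
  rw [sweep_congr hu (h' := fun J => 0 * fin J) _ hI, sweep_smul, zero_mul]
  intro J hJ
  rw [zero_mul]
  exact contract_fin _ hl hJ

/-- The contraction vanishes on the initial state, in which no gap is covered. -/
theorem contract_start {T : List Strand} {w : List Layer} (hw : IsTangle [] w T)
    {X : ℕ → List (RatFunc ℚ × RatFunc ℚ)} (h : Compat w X) (hX : (X 0).length = 1)
    (H : Cov) : sweep w (contract (X w.length) H) [false] = 0 := by
  rw [← contract_sweep hw h H (by simp)]
  match hX0 : X 0, hX with
  | [(x, j)], _ => simp [contract]

variable {S T : List Strand} {w₁ w₂ w₃ : List Layer}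

/-- Insert two covering operators on the lower line and one on the upper line, and commute the
contraction from the bottom to the top: it vanishes at both ends, and each covering operator
contributes its weight. -/
theorem three_term_upper (h₁ : IsTangle [] w₁ S) (h₂ : IsTangle S w₂ T) (h₃ : IsTangle T w₃ [])
    (h0 : w₃ ≠ []) {X : ℕ → List (RatFunc ℚ × RatFunc ℚ)} (hX : Compat (w₁ ++ w₂ ++ w₃) X)
    (hX0 : (X 0).length = 1) (hX1 : ∀ k, ∀ e ∈ X k, e.2 = 1 ∨ e.2 = -1)
    (Y Z : List (RatFunc ℚ × RatFunc ℚ)) (hY : Y = X w₁.length)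
    (hZ : Z = X (w₁.length + w₂.length)) {u v r : ℕ} (hu : u < Y.length)
    (hv : v < Y.length) (hr : r < Z.length) :
    Y[u].1 * sweep w₁ (ins Y v (sweep w₂ (ins Z r (upper w₃)))) [false]
      - Y[v].1 * sweep w₁ (ins Y u (sweep w₂ (ins Z r (upper w₃)))) [false]
      + Z[r].1 * sweep w₁ (ins Y u (ins Y v (sweep w₂ (upper w₃)))) [false] = 0 := by
  have c₁ := hX.append.1.append.1
  have c₂ := hX.append.1.append.2
  have c₃ := hX.append.2
  simp only [List.length_append] at c₃
  have lY : Y.length = S.length + 1 := hY ▸ Compat.length h₁ c₁ hX0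
  have lZ : Z.length = T.length + 1 := by
    have := Compat.length h₂ c₂ (by simpa [← hY] using lY)
    rw [hZ]; exact this
  have sY : ∀ e ∈ Y, e.2 = 1 ∨ e.2 = -1 := hY ▸ hX1 _
  have sZ : ∀ e ∈ Z, e.2 = 1 ∨ e.2 = -1 := hZ ▸ hX1 _
  have key := contract_start h₁ c₁ hX0 (ins Y u (ins Y v (sweep w₂ (ins Z r (upper w₃)))))
  rw [← hY] at key
  rw [← key]
  have d₃ : ∀ I : List Bool, I.length = T.length + 1 → contract Z (upper w₃) I = 0 := by
    intro I hI
    have := contract_upper h₃ h0 c₃ (by simpa [← hZ] using lZ) hI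
    simpa [← hZ] using this
  have d₂ : ∀ I : List Bool, I.length = S.length + 1 →
      contract Y (sweep w₂ (ins Z r (upper w₃))) I = Z[r].1 * sweep w₂ (upper w₃) I := by
    intro I hI
    have := contract_sweep h₂ c₂ (ins Z r (upper w₃)) hI
    simp only [Nat.add_zero, ← hY, ← hZ] at this
    rw [this, ← sweep_smul]
    apply sweep_congr h₂ _ hI
    intro J hJ
    rw [contract_ins Z r hr sZ _ _ (by omega),
      ins_congr Z r (h' := fun J => 0 * fin J) (fun K hK => by rw [d₃ K hK]; simp) hJ, ins_smul]
    ring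
  have d₁ : ∀ I : List Bool, I.length = S.length + 1 →
      contract Y (ins Y u (ins Y v (sweep w₂ (ins Z r (upper w₃))))) I =
        (Y[u].1 * ins Y v (sweep w₂ (ins Z r (upper w₃))) I +
        (-Y[v].1) * ins Y u (sweep w₂ (ins Z r (upper w₃))) I) +
        Z[r].1 * ins Y u (ins Y v (sweep w₂ (upper w₃))) I := by
    intro I hI
    rw [contract_ins Y u hu sY _ _ (by omega)]
    rw [ins_congr Y u (h' := fun J => Y[v].1 * sweep w₂ (ins Z r (upper w₃)) J +
      (-Z[r].1) * ins Y v (sweep w₂ (upper w₃)) J) _ hI, ins_add, ins_smul, ins_smul]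
    · ring
    intro J hJ
    rw [contract_ins Y v hv sY _ _ (by omega),
      ins_congr Y v (h' := fun J => Z[r].1 * sweep w₂ (upper w₃) J) d₂ hJ, ins_smul]
    ring
  rw [sweep_congr h₁ d₁ (by simp), sweep_add, sweep_add, sweep_smul, sweep_smul, sweep_smul]
  ring

/-- The analogue of `three_term_upper` for one covering operator on the lower line and two covering
operators on the upper line. -/
theorem three_term_lower (h₁ : IsTangle [] w₁ S) (h₂ : IsTangle S w₂ T) (h₃ : IsTangle T w₃ [])
    (h0 : w₃ ≠ []) {X : ℕ → List (RatFunc ℚ × RatFunc ℚ)} (hX : Compat (w₁ ++ w₂ ++ w₃) X)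
    (hX0 : (X 0).length = 1) (hX1 : ∀ k, ∀ e ∈ X k, e.2 = 1 ∨ e.2 = -1)
    (Y Z : List (RatFunc ℚ × RatFunc ℚ)) (hY : Y = X w₁.length)
    (hZ : Z = X (w₁.length + w₂.length)) {u r r' : ℕ} (hu : u < Y.length)
    (hr : r < Z.length) (hr' : r' < Z.length) :
    Y[u].1 * sweep w₁ (sweep w₂ (ins Z r (ins Z r' (upper w₃)))) [false]
      - Z[r].1 * sweep w₁ (ins Y u (sweep w₂ (ins Z r' (upper w₃)))) [false]
      + Z[r'].1 * sweep w₁ (ins Y u (sweep w₂ (ins Z r (upper w₃)))) [false] = 0 := by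
  have c₁ := hX.append.1.append.1
  have c₂ := hX.append.1.append.2
  have c₃ := hX.append.2
  simp only [List.length_append] at c₃
  have lY : Y.length = S.length + 1 := hY ▸ Compat.length h₁ c₁ hX0
  have lZ : Z.length = T.length + 1 := by
    have := Compat.length h₂ c₂ (by simpa [← hY] using lY)
    rw [hZ]; exact this
  have sY : ∀ e ∈ Y, e.2 = 1 ∨ e.2 = -1 := hY ▸ hX1 _
  have sZ : ∀ e ∈ Z, e.2 = 1 ∨ e.2 = -1 := hZ ▸ hX1 _
  have key := contract_start h₁ c₁ hX0 (ins Y u (sweep w₂ (ins Z r (ins Z r' (upper w₃)))))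
  rw [← hY] at key
  rw [← key]
  have d₃ : ∀ I : List Bool, I.length = T.length + 1 → contract Z (upper w₃) I = 0 := by
    intro I hI
    have := contract_upper h₃ h0 c₃ (by simpa [← hZ] using lZ) hI
    simpa [← hZ] using this
  have d₂ : ∀ I : List Bool, I.length = S.length + 1 →
      contract Y (sweep w₂ (ins Z r (ins Z r' (upper w₃)))) I =
        Z[r].1 * sweep w₂ (ins Z r' (upper w₃)) I +
        (-Z[r'].1) * sweep w₂ (ins Z r (upper w₃)) I := by
    intro I hI
    have := contract_sweep h₂ c₂ (ins Z r (ins Z r' (upper w₃))) hI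
    simp only [Nat.add_zero, ← hY, ← hZ] at this
    rw [this, ← sweep_smul, ← sweep_smul, ← sweep_add]
    apply sweep_congr h₂ _ hI
    intro J hJ
    rw [contract_ins Z r hr sZ _ _ (by omega),
      ins_congr Z r (h' := fun J => Z[r'].1 * upper w₃ J) _ hJ, ins_smul]
    · ring
    intro K hK
    rw [contract_ins Z r' hr' sZ _ _ (by omega),
      ins_congr Z r' (h' := fun J => 0 * fin J) (fun K hK => by rw [d₃ K hK]; simp) hK, ins_smul]
    ring
  have d₁ : ∀ I : List Bool, I.length = S.length + 1 →
      contract Y (ins Y u (sweep w₂ (ins Z r (ins Z r' (upper w₃))))) I =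
        (Y[u].1 * sweep w₂ (ins Z r (ins Z r' (upper w₃))) I +
        (-Z[r].1) * ins Y u (sweep w₂ (ins Z r' (upper w₃))) I) +
        Z[r'].1 * ins Y u (sweep w₂ (ins Z r (upper w₃))) I := by
    intro I hI
    rw [contract_ins Y u hu sY _ _ (by omega), ins_congr Y u d₂ hI, ins_add, ins_smul, ins_smul]
    ring
  rw [sweep_congr h₁ d₁ (by simp), sweep_add, sweep_add, sweep_smul, sweep_smul, sweep_smul]
  ring

/-- Cover two gaps on the upper line, or two gaps on the lower line: the resulting amplitudes are
proportional to the differences of the values of every harmonic function. The constant function `1`,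
with the data `O`, reduces the three-term relations to this statement. -/
theorem exchange (h₁ : IsTangle [] w₁ S) (h₂ : IsTangle S w₂ T) (h₃ : IsTangle T w₃ [])
    (h0 : w₃ ≠ []) {X O : ℕ → List (RatFunc ℚ × RatFunc ℚ)} (hX : Compat (w₁ ++ w₂ ++ w₃) X)
    (hX0 : (X 0).length = 1) (hX1 : ∀ k, ∀ e ∈ X k, e.2 = 1 ∨ e.2 = -1)
    (hO : Compat (w₁ ++ w₂ ++ w₃) O)
    (hO1 : ∀ k, ∀ e ∈ O k, e.1 = 1) (hOX : ∀ k, (O k).map Prod.snd = (X k).map Prod.snd)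
    (Y Z : List (RatFunc ℚ × RatFunc ℚ)) (hY : Y = X w₁.length)
    (hZ : Z = X (w₁.length + w₂.length)) {u v r r' : ℕ} (hu : u < Y.length) (hv : v < Y.length)
    (hr : r < Z.length) (hr' : r' < Z.length) :
    (Y[u].1 - Y[v].1) * sweep w₁ (sweep w₂ (ins Z r (ins Z r' (upper w₃)))) [false] =
      (Z[r].1 - Z[r'].1) * sweep w₁ (ins Y u (ins Y v (sweep w₂ (upper w₃)))) [false] := by
  have hlen : ∀ k, (O k).length = (X k).length := fun k => by
    simpa using congrArg List.length (hOX k)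
  have hO2 : ∀ k, ∀ e ∈ O k, e.2 = 1 ∨ e.2 = -1 := by
    intro k e he
    have : e.2 ∈ (X k).map Prod.snd := by
      rw [← hOX]; exact List.mem_map_of_mem he
    obtain ⟨e', he', h⟩ := List.mem_map.1 this
    rw [← h]; exact hX1 k e' he'
  have eY : ∀ g h, ins (O w₁.length) g h = ins Y g h := fun g h =>
    ins_congr_data (by rw [hY]; exact hOX _) g h
  have eZ : ∀ g h, ins (O (w₁.length + w₂.length)) g h = ins Z g h := fun g h =>
    ins_congr_data (by rw [hZ]; exact hOX _) g h
  have lY : (O w₁.length).length = Y.length := by rw [hY, hlen]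
  have lZ : (O (w₁.length + w₂.length)).length = Z.length := by rw [hZ, hlen]
  have gO : ∀ k g (h : g < (O k).length), (O k)[g].1 = 1 := fun k g h =>
    hO1 k _ (List.getElem_mem h)
  have a1 := three_term_upper h₁ h₂ h₃ h0 hX hX0 hX1 Y Z hY hZ hu hv hr
  have a2 := three_term_upper h₁ h₂ h₃ h0 hX hX0 hX1 Y Z hY hZ hu hv hr'
  have b1 := three_term_upper h₁ h₂ h₃ h0 hO (by rw [hlen, hX0]) hO2 _ _ rfl rfl
    (u := u) (v := v) (r := r) (by omega) (by omega) (by omega)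
  have b2 := three_term_upper h₁ h₂ h₃ h0 hO (by rw [hlen, hX0]) hO2 _ _ rfl rfl
    (u := u) (v := v) (r := r') (by omega) (by omega) (by omega)
  have b3 := three_term_lower h₁ h₂ h₃ h0 hO (by rw [hlen, hX0]) hO2 _ _ rfl rfl
    (u := u) (r := r) (r' := r') (by omega) (by omega) (by omega)
  simp only [gO, eY, eZ, one_mul] at b1 b2 b3
  -- the relations for the constant function eliminate the mixed amplitudes, with one covering
  -- operator on each of the two lines
  linear_combination a2 - a1 + Y[u].1 * b1 - Y[u].1 * b2 + (Y[u].1 - Y[v].1) * b3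

end

noncomputable section

/-! ### Harmonic functions on the gaps -/

/-- At a crossing, harmonicity is one linear equation for the values at the four corners. -/
theorem commutes_crossing {P : Piece} (hd : P.dom.length = 2) {n s w e xW xS xN xE j : RatFunc ℚ}
    (hP : ∀ x y z, moves P [x, y, z] = crossingMoves n s w e x y z)
    (h : n * xN + w * xW + e * xE - s * xS = 0) :
    Commutes P [(xW, 1), (xS, 1), (xE, j)] [(xW, 1), (xN, 1), (xE, j)] := by
  intro m hm
  rw [hd] at hm
  match m, hm with
  | [x, y, z], _ =>
    refine ⟨fun g => ?_, fun f hf => ?_⟩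
    · cases x <;> cases y <;> cases z <;>
        simp [act, contract, hP, crossingMoves, sg] <;>
        first
        | ring1
        | linear_combination g [false, false, false] * h
        | linear_combination -g [false, false, false] * h
        | linear_combination g [true, false, false] * h
        | linear_combination -g [true, false, false] * h
        | linear_combination g [false, false, true] * h
        | linear_combination -g [false, false, true] * h
        | linear_combination g [true, false, true] * h
    · rw [hP] at hf
      revert hf
      cases x <;> cases y <;> cases z <;> simp [crossingMoves] <;> rintro (rfl | rfl | rfl) <;>
        simp [signs, sg]

/-- At a vertex with two entering edges, harmonicity is one linear equation for the three gaps
below. -/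
theorem commutes_merge {i k : ℕ} {xW xS xE j : RatFunc ℚ}
    (h : tq (2 * i) * brace k * xW + brace i * tq (-(2 * k)) * xE - brace (i + k) * xS = 0) :
    Commutes (.merge i k) [(xW, 1), (xS, 1), (xE, j)] [(xW, 1), (xE, j)] := by
  intro m hm
  match m, hm with
  | [x, y, z], _ =>
    refine ⟨fun g => ?_, fun f hf => ?_⟩
    · cases x <;> cases y <;> cases z <;>
        simp [act, contract, moves, sg] <;>
        first
        | ring1
        | linear_combination g [false, false] * h
        | linear_combination -g [false, false] * h
        | linear_combination g [true, false] * h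
        | linear_combination -g [true, false] * h
        | linear_combination g [false, true] * h
        | linear_combination -g [false, true] * h
        | linear_combination g [true, true] * h
    · revert hf
      cases x <;> cases y <;> cases z <;> simp [moves]  <;>
        first
        | (rintro rfl; simp [signs, sg])
        | (rintro (rfl | rfl) <;> simp [signs, sg])

/-- A vertex with one entering edge imposes no condition: the edge has to cover the circle region,
so there is no choice, and the new gap between the leaving edges is not covered. -/
theorem commutes_split {i k : ℕ} {xW xN xE j : RatFunc ℚ} :
    Commutes (.split i k) [(xW, 1), (xE, j)] [(xW, 1), (xN, 1), (xE, j)] := by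
  intro m hm
  match m, hm with
  | [x, z], _ =>
    refine ⟨fun g => ?_, fun f hf => ?_⟩
    · cases x <;> cases z <;>
        simp [act, contract, moves, sg] <;> ring
    · revert hf
      cases x <;> cases z <;> simp [moves]  <;> rintro rfl <;> simp [signs, sg]

theorem commutes_twist {s : Strand} {b : Bool} {e f : RatFunc ℚ × RatFunc ℚ} :
    Commutes (.twist s b) [e, f] [e, f] := by
  intro m hm
  match m, hm with
  | [x, z], _ =>
    refine ⟨fun g => ?_, fun f hf => ?_⟩
    · cases x <;> cases z <;> simp [act, contract, moves, sg]
    · revert hf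
      simp only [moves, List.mem_singleton]
      rintro rfl; rfl

/-- At a minimum, the two outer gaps have the same value. The value in the inner gap is arbitrary,
and the two ends of the strand have opposite signs. -/
theorem commutes_cup {s : Strand} {x y j k : RatFunc ℚ} (hk : k = 1 ∨ k = -1) :
    Commutes (.cup s) [(x, j)] [(x, k), (y, -k), (x, j)] := by
  have hk2 : k * k = 1 := by rcases hk with rfl | rfl <;> ring
  intro m hm
  match m, hm with
  | [z], _ =>
    refine ⟨fun g => ?_, fun f hf => ?_⟩
    · cases z <;> simp [act, contract, moves, sg]
      · linear_combination g [false, false, false] * x * hk2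
      · linear_combination -g [true, false, false] * x * hk2
    · revert hf
      cases z <;> simp [moves]
      · rintro (rfl | rfl) <;> simp [signs, sg] <;> linear_combination j * hk2
      · rintro rfl; simp [signs, sg]; linear_combination j * hk2

/-- At a maximum, the two outer gaps have the same value. The value in the inner gap is arbitrary,
and the two ends of the strand have opposite signs. -/
theorem commutes_cap {s : Strand} {x y j k : RatFunc ℚ} (hk : k = 1 ∨ k = -1) :
    Commutes (.cap s) [(x, k), (y, -k), (x, j)] [(x, j)] := by
  have hk2 : k * k = 1 := by rcases hk with rfl | rfl <;> ring
  intro m hm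
  match m, hm with
  | [a, b, c], _ =>
    refine ⟨fun g => ?_, fun f hf => ?_⟩
    · cases a <;> cases b <;> cases c <;> simp [act, contract, moves, sg]
      · linear_combination g [false] * x * hk2
      · linear_combination -g [true] * x * hk2
    · revert hf
      cases a <;> cases b <;> cases c <;> simp [moves] <;>
      · rintro rfl; simp [signs, sg]; first | linear_combination j * hk2 | linear_combination -j * hk2

/-- The sign of the direction of a strand. -/
def Strand.sign (s : Strand) : RatFunc ℚ := if s.up then 1 else -1

theorem Strand.sign_cases (s : Strand) : s.sign = 1 ∨ s.sign = -1 := by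
  unfold Strand.sign; cases s.up <;> simp

theorem Strand.sign_rev (s : Strand) : s.rev.sign = -s.sign := by
  unfold Strand.sign Strand.rev; cases s.up <;> simp

/-- The data of the gaps of a line with the strands `S`, from left to right: the leftmost gap has
the value `x`, and the value changes by `f s b` across a strand `s` with the tag `b`. The tags
single out some of the components of the diagram. -/
def pot (f : Strand → Bool → RatFunc ℚ → RatFunc ℚ) : RatFunc ℚ → List Strand → (ℕ → Bool) →
    List (RatFunc ℚ × RatFunc ℚ)
  | x, [], _ => [(x, 1)]
  | x, s :: S, t => (x, s.sign) :: pot f (f s (t 0) x) S (fun p => t (p + 1))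

/-- The data of all gaps but the last one, see `pot`. -/
def potInit (f : Strand → Bool → RatFunc ℚ → RatFunc ℚ) : RatFunc ℚ → List Strand → (ℕ → Bool) →
    List (RatFunc ℚ × RatFunc ℚ)
  | _, [], _ => []
  | x, s :: S, t => (x, s.sign) :: potInit f (f s (t 0) x) S (fun p => t (p + 1))

/-- The value in the last gap, see `pot`. -/
def potLast (f : Strand → Bool → RatFunc ℚ → RatFunc ℚ) : RatFunc ℚ → List Strand → (ℕ → Bool) →
    RatFunc ℚ
  | x, [], _ => x
  | x, s :: S, t => potLast f (f s (t 0) x) S (fun p => t (p + 1))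

variable (f : Strand → Bool → RatFunc ℚ → RatFunc ℚ)

theorem length_potInit (x : RatFunc ℚ) (S : List Strand) (t : ℕ → Bool) :
    (potInit f x S t).length = S.length := by
  induction S generalizing x t with
  | nil => rfl
  | cons s S ih => simp [potInit, ih]

theorem length_pot (x : RatFunc ℚ) (S : List Strand) (t : ℕ → Bool) :
    (pot f x S t).length = S.length + 1 := by
  induction S generalizing x t with
  | nil => rfl
  | cons s S ih => simp [pot, ih]

theorem pot_append (x : RatFunc ℚ) (S S' : List Strand) (t : ℕ → Bool) :
    pot f x (S ++ S') t = potInit f x S t ++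
      pot f (potLast f x S t) S' (fun p => t (S.length + p)) := by
  induction S generalizing x t with
  | nil => simp [potInit, potLast]
  | cons s S ih => simp [pot, potInit, potLast, ih, Nat.add_right_comm]

theorem pot_eq_cons (x : RatFunc ℚ) (S : List Strand) (t : ℕ → Bool) :
    ∃ j R, pot f x S t = (x, j) :: R ∧ R.length = S.length := by
  cases S with
  | nil => exact ⟨1, [], rfl, rfl⟩
  | cons s S => exact ⟨_, _, rfl, by rw [length_pot]; simp⟩

theorem pot_congr (x : RatFunc ℚ) (S : List Strand) {t t' : ℕ → Bool}
    (h : ∀ p, p < S.length → t p = t' p) : pot f x S t = pot f x S t' := by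
  induction S generalizing x t t' with
  | nil => rfl
  | cons s S ih =>
    simp only [pot, h 0 (by simp)]
    rw [ih _ fun p hp => h (p + 1) (by simpa using hp)]

theorem potInit_congr (x : RatFunc ℚ) (S : List Strand) {t t' : ℕ → Bool}
    (h : ∀ p, p < S.length → t p = t' p) : potInit f x S t = potInit f x S t' := by
  induction S generalizing x t t' with
  | nil => rfl
  | cons s S ih =>
    simp only [potInit, h 0 (by simp)]
    rw [ih _ fun p hp => h (p + 1) (by simpa using hp)]

theorem potLast_congr (x : RatFunc ℚ) (S : List Strand) {t t' : ℕ → Bool}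
    (h : ∀ p, p < S.length → t p = t' p) : potLast f x S t = potLast f x S t' := by
  induction S generalizing x t t' with
  | nil => rfl
  | cons s S ih =>
    simp only [potLast, h 0 (by simp)]
    rw [ih _ fun p hp => h (p + 1) (by simpa using hp)]

theorem snd_mem_pot (x : RatFunc ℚ) (S : List Strand) (t : ℕ → Bool) :
    ∀ e ∈ pot f x S t, e.2 = 1 ∨ e.2 = -1 := by
  induction S generalizing x t with
  | nil => simp [pot]
  | cons s S ih =>
    simp only [pot, List.mem_cons, forall_eq_or_imp]
    exact ⟨s.sign_cases, ih _ _⟩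

theorem map_snd_pot (g : Strand → Bool → RatFunc ℚ → RatFunc ℚ) (x y : RatFunc ℚ)
    (S : List Strand) (t t' : ℕ → Bool) :
    (pot f x S t).map Prod.snd = (pot g y S t').map Prod.snd := by
  induction S generalizing x y t t' with
  | nil => rfl
  | cons s S ih => simp [pot, ih _ (g s (t' 0) y) _ (fun p => t' (p + 1))]

/-- The values on the gaps of a piece all of whose strands carry the tag `b` are harmonic. -/
def PieceHarmonic (P : Piece) (b : Bool) : Prop :=
  ∀ x j : RatFunc ℚ, potLast f x P.dom (fun _ => b) = potLast f x P.cod (fun _ => b) ∧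
    Commutes P (potInit f x P.dom (fun _ => b) ++ [(potLast f x P.dom (fun _ => b), j)])
      (potInit f x P.cod (fun _ => b) ++ [(potLast f x P.dom (fun _ => b), j)])

/-- A rule that is harmonic at a piece gives compatible data on the two boundary lines of the layer.
-/
theorem layerCompat_pot (l : Layer) (b : Bool) (x : RatFunc ℚ) {t t' : ℕ → Bool}
    (hP : PieceHarmonic f l.piece b) (hl : ∀ p < l.left.length, t p = t' p)
    (hr : ∀ r < l.right.length, t (l.left.length + l.piece.dom.length + r) =
      t' (l.left.length + l.piece.cod.length + r))
    (hd : ∀ p < l.piece.dom.length, t (l.left.length + p) = b)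
    (hc : ∀ p < l.piece.cod.length, t' (l.left.length + p) = b) :
    LayerCompat l (pot f x l.source t) (pot f x l.target t') := by
  obtain ⟨L, P, R⟩ := l
  simp only [Layer.source, Layer.target] at *
  rw [List.append_assoc, List.append_assoc, pot_append, pot_append, pot_append, pot_append,
    potInit_congr f x L hl, potLast_congr f x L hl]
  set y := potLast f x L t'
  rw [potInit_congr f y P.dom hd, potInit_congr f y P.cod hc, potLast_congr f y P.dom hd,
    potLast_congr f y P.cod hc, ← (hP y 1).1,
    pot_congr f _ R (t' := fun p => t' (L.length + (P.cod.length + p)))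
      (fun p hp => by simpa [Nat.add_assoc] using hr p hp)]
  obtain ⟨j, R', h1, h2⟩ := pot_eq_cons f (potLast f y P.dom fun _ => b) R
    fun p => t' (L.length + (P.cod.length + p))
  rw [h1]
  refine ⟨_, _, _, R', ?_, ?_, length_potInit f x L t', ?_, ?_, h2, (hP y j).2⟩
  · simp
  · simp
  · simp [length_potInit]
  · simp [length_potInit]

/-- The rule for the powers `t ^ n` of the index `n` with respect to the tagged strands. -/
def mulJump : Strand → Bool → RatFunc ℚ → RatFunc ℚ := fun s b x =>
  if b then tq (4 * s.flow) * x else x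

/-- The rule for the index with respect to the tagged strands, counted with their directions and
without their colors. -/
def addJump : Strand → Bool → RatFunc ℚ → RatFunc ℚ := fun s b x =>
  if b then x + s.sign else x

theorem tq_add (a b : ℤ) : tq (a + b) = tq a * tq b := zpow_add₀ RatFunc.X_ne_zero a b
theorem tq_zero : tq 0 = 1 := zpow_zero _
theorem tq_neg (a : ℤ) : tq (-a) = (tq a)⁻¹ := zpow_neg _ _
theorem tq_ne_zero (a : ℤ) : tq a ≠ 0 := zpow_ne_zero _ RatFunc.X_ne_zero
theorem tq_mul_neg (a : ℤ) : tq a * tq (-a) = 1 := by rw [← tq_add]; simp [tq_zero]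
theorem tq_two_mul (a : ℤ) : tq (2 * a) = tq a * tq a := by rw [two_mul, tq_add]
theorem tq_four_mul (a : ℤ) : tq (4 * a) = tq (2 * a) * tq (2 * a) := by
  rw [← tq_two_mul]; congr 1; ring

theorem brace_zero : brace 0 = 0 := by simp [brace]

theorem Strand.flow_rev (s : Strand) : s.rev.flow = -s.flow := by
  unfold Strand.flow Strand.rev; cases s.up <;> simp

/-- The linear equation of `commutes_merge`, for powers of the index with respect to the entering
edges, and for a constant function. -/
theorem merge_relation (i k : ℕ) : tq (2 * i) * brace k +
    brace i * tq (-(2 * k)) * (tq (4 * k) * tq (4 * i)) - brace (i + k) * tq (4 * i) = 0 ∧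
    tq (2 * i) * brace k + brace i * tq (-(2 * k)) - brace (i + k) = 0 := by
  have h1 := tq_mul_neg (2 * i)
  have h2 := tq_mul_neg (2 * k)
  simp only [brace, mul_add, tq_add, neg_add, tq_four_mul]
  constructor
  · linear_combination (tq (2 * i) * tq (-(2 * k)) - tq (2 * i) * tq (2 * k) ^ 2 * tq (-(2 * k))) * h1 +
      (tq (2 * i) ^ 3 * tq (2 * k) - tq (2 * k) * tq (2 * i)) * h2
  · ring

/-- The powers of the index with respect to any union of components are harmonic. -/
theorem pieceHarmonic_mul (P : Piece) (b : Bool) : PieceHarmonic mulJump P b := by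
  intro x j
  have hr : ∀ s : Strand, tq (4 * s.rev.flow) * (tq (4 * s.flow) * x) = x := fun s => by
    rw [s.flow_rev, ← mul_assoc, mul_comm (tq _), mul_neg, tq_mul_neg, one_mul]
  have hu : ∀ n : ℕ, (up n).flow = n := fun n => by simp [up, Strand.flow]
  have su : ∀ n : ℕ, (up n).sign = 1 := fun n => by simp [up, Strand.sign]
  cases P with
  | cup s =>
    simp only [Piece.dom, Piece.cod, potLast, potInit, List.nil_append, List.cons_append,
      s.sign_rev]
    have : mulJump s.rev b (mulJump s b x) = x := by cases b <;> simp [mulJump, hr]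
    exact ⟨this.symm, commutes_cup s.sign_cases⟩
  | cap s =>
    simp only [Piece.dom, Piece.cod, potLast, potInit, List.nil_append, List.cons_append,
      s.sign_rev]
    have : mulJump s.rev b (mulJump s b x) = x := by cases b <;> simp [mulJump, hr]
    rw [this]
    exact ⟨rfl, commutes_cap s.sign_cases⟩
  | twist s a => exact ⟨rfl, commutes_twist⟩
  | pos i k =>
    simp only [Piece.dom, Piece.cod, potLast, potInit, List.nil_append, List.cons_append, su]
    have h : mulJump (up k) b (mulJump (up i) b x) = mulJump (up i) b (mulJump (up k) b x) := by
      simp only [mulJump]; split <;> ring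
    refine ⟨h, commutes_crossing rfl (fun _ _ _ => rfl) ?_⟩
    cases b
    · simp [mulJump]
    · simp [mulJump, hu]; ring
  | neg i k =>
    simp only [Piece.dom, Piece.cod, potLast, potInit, List.nil_append, List.cons_append, su]
    have h : mulJump (up k) b (mulJump (up i) b x) = mulJump (up i) b (mulJump (up k) b x) := by
      simp only [mulJump]; split <;> ring
    refine ⟨h, commutes_crossing rfl (fun _ _ _ => rfl) ?_⟩
    have h2 := tq_mul_neg (4 * k)
    cases b
    · simp [mulJump]
    · simp [mulJump, hu]
      linear_combination (tq (4 * i) * x - x) * h2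
  | merge i k =>
    simp only [Piece.dom, Piece.cod, potLast, potInit, List.nil_append, List.cons_append, su]
    have h : mulJump (up k) b (mulJump (up i) b x) = mulJump (up (i + k)) b x := by
      simp only [mulJump, hu]; split
      · push_cast; rw [mul_add, tq_add]; ring
      · rfl
    refine ⟨h, commutes_merge ?_⟩
    obtain ⟨h1, h2⟩ := merge_relation i k
    cases b
    · simp [mulJump]; linear_combination x * h2
    · simp [mulJump, hu]; linear_combination x * h1
  | split i k =>
    simp only [Piece.dom, Piece.cod, potLast, potInit, List.nil_append, List.cons_append, su]
    have h : mulJump (up k) b (mulJump (up i) b x) = mulJump (up (i + k)) b x := by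
      simp only [mulJump, hu]; split
      · push_cast; rw [mul_add, tq_add]; ring
      · rfl
    exact ⟨h.symm, commutes_split⟩

end

noncomputable section

/-! ### Harmonicity of the uncolored index -/

theorem pieceHarmonic_congr {f g : Strand → Bool → RatFunc ℚ → RatFunc ℚ} {P : Piece}
    {b b' : Bool} (h : ∀ s x, f s b x = g s b' x) (hg : PieceHarmonic g P b') :
    PieceHarmonic f P b := by
  have h1 : ∀ x S, potInit f x S (fun _ => b) = potInit g x S (fun _ => b') := by
    intro x S
    induction S generalizing x with
    | nil => rfl
    | cons s S ih => simp [potInit, h, ih]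
  have h2 : ∀ x S, potLast f x S (fun _ => b) = potLast g x S (fun _ => b') := by
    intro x S
    induction S generalizing x with
    | nil => rfl
    | cons s S ih => simp [potLast, h, ih]
  unfold PieceHarmonic
  simp only [h1, h2]
  exact hg

/-- The uncolored index is harmonic at twists, maxima and minima, and at crossings at which all
tagged strands have the color `0`. -/
theorem pieceHarmonic_add {P : Piece} {b : Bool} (hv : b = true → P.isVertex = false)
    (hc : b = true → ∀ s ∈ P.dom, s.color = 0) : PieceHarmonic addJump P b := by
  cases b
  · exact pieceHarmonic_congr (fun s x => by simp [addJump, mulJump]) (pieceHarmonic_mul P false)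
  specialize hv rfl
  specialize hc rfl
  intro x j
  have su : ∀ n : ℕ, (up n).sign = 1 := fun n => by simp [up, Strand.sign]
  cases P with
  | cup s =>
    simp only [Piece.dom, Piece.cod, potLast, potInit, List.nil_append, List.cons_append,
      s.sign_rev]
    have : addJump s.rev true (addJump s true x) = x := by simp [addJump, s.sign_rev]
    exact ⟨this.symm, commutes_cup s.sign_cases⟩
  | cap s =>
    simp only [Piece.dom, Piece.cod, potLast, potInit, List.nil_append, List.cons_append,
      s.sign_rev]
    have : addJump s.rev true (addJump s true x) = x := by simp [addJump, s.sign_rev]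
    rw [this]
    exact ⟨rfl, commutes_cap s.sign_cases⟩
  | twist s a => exact ⟨rfl, commutes_twist⟩
  | pos i k =>
    simp only [Piece.dom, Piece.cod, potLast, potInit, List.nil_append, List.cons_append, su]
    refine ⟨by simp [addJump, su], commutes_crossing rfl (fun _ _ _ => rfl) ?_⟩
    simp [Piece.dom, up] at hc
    simp [addJump, hc, tq_zero, su]
  | neg i k =>
    simp only [Piece.dom, Piece.cod, potLast, potInit, List.nil_append, List.cons_append, su]
    refine ⟨by simp [addJump, su], commutes_crossing rfl (fun _ _ _ => rfl) ?_⟩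
    simp [Piece.dom, up] at hc
    simp [addJump, hc, tq_zero, su]
  | merge i k => simp [Piece.isVertex] at hv
  | split i k => simp [Piece.isVertex] at hv

/-! ### Lines of a tangle -/

theorem IsTangle.source_getElem {S T : List Strand} {w : List Layer} (hw : IsTangle S w T)
    {k : ℕ} (hk : k < w.length) : w[k].source = (S :: w.map Layer.target).getD k [] := by
  induction w generalizing S k with
  | nil => simp at hk
  | cons l w ih =>
    obtain ⟨rfl, hw⟩ := hw
    cases k with
    | zero => rfl
    | succ k =>
      have := ih hw (k := k) (by simpa using hk)
      simpa using this

theorem IsTangle.splitAt {S T : List Strand} {w : List Layer} (hw : IsTangle S w T)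
    {k : ℕ} (hk : k ≤ w.length) :
    IsTangle S (w.take k) ((S :: w.map Layer.target).getD k []) ∧
      IsTangle ((S :: w.map Layer.target).getD k []) (w.drop k) T := by
  induction w generalizing S k with
  | nil =>
    obtain rfl : k = 0 := by simpa using hk
    cases hw; exact ⟨rfl, rfl⟩
  | cons l w ih =>
    obtain ⟨rfl, hw⟩ := hw
    cases k with
    | zero => exact ⟨rfl, rfl, hw⟩
    | succ k =>
      obtain ⟨h1, h2⟩ := ih hw (k := k) (by simpa using hk)
      exact ⟨⟨rfl, h1⟩, h2⟩

variable {w : List Layer} {T : List Strand}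

theorem source_eq_strandsAt (hw : IsTangle [] w T) {k : ℕ} (hk : k < w.length) :
    w[k].source = strandsAt w k := hw.source_getElem hk

theorem target_eq_strandsAt (w : List Layer) {k : ℕ} (hk : k < w.length) :
    w[k].target = strandsAt w (k + 1) := by
  simp [strandsAt, List.getD, hk]

theorem isTangle_take (hw : IsTangle [] w T) {k : ℕ} (hk : k ≤ w.length) :
    IsTangle [] (w.take k) (strandsAt w k) := (hw.splitAt hk).1

theorem isTangle_drop (hw : IsTangle [] w T) {k : ℕ} (hk : k ≤ w.length) :
    IsTangle (strandsAt w k) (w.drop k) T := (hw.splitAt hk).2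

theorem strandsAt_length (hw : IsTangle [] w T) : strandsAt w w.length = T := by
  have := isTangle_drop hw le_rfl
  simpa [IsTangle] using this

theorem strandsAt_of_lt (w : List Layer) {k : ℕ} (hk : w.length < k) : strandsAt w k = [] := by
  unfold strandsAt
  rw [List.getD_eq_default]; simpa using hk

theorem IsPoint.lt (hw : IsTangle [] w []) {x : ℕ × ℕ} (hx : IsPoint w x) : x.1 < w.length := by
  by_contra h
  rcases (not_lt.1 h).eq_or_lt with h | h
  · simp [IsPoint, ← h, strandsAt_length hw] at hx
  · simp [IsPoint, strandsAt_of_lt w h] at hx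

/-! ### Independence of the initial point -/

/-- The set of points given by its indicator function `t` is a union of components of the diagram.
-/
def IsClosed (w : List Layer) (t : ℕ × ℕ → Bool) : Prop :=
  ∀ x y, PointStep w x y → t x = t y

/-- The data of the gaps of the line number `k` of a diagram, with the value `x` in the unbounded
region, the rule `f` and the tags `t`, see `pot`. -/
def lineData (f : Strand → Bool → RatFunc ℚ → RatFunc ℚ) (x : RatFunc ℚ) (w : List Layer)
    (t : ℕ × ℕ → Bool) (k : ℕ) : List (RatFunc ℚ × RatFunc ℚ) :=
  pot f x (strandsAt w k) (fun p => t (k, p))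

theorem compat_lineData (hw : IsTangle [] w T) {t : ℕ × ℕ → Bool} (ht : IsClosed w t)
    (f : Strand → Bool → RatFunc ℚ → RatFunc ℚ) (x : RatFunc ℚ)
    (hf : ∀ (k : ℕ) (hk : k < w.length) (b : Bool),
      (∀ p < w[k].piece.dom.length, t (k, w[k].left.length + p) = b) →
      (∀ p < w[k].piece.cod.length, t (k + 1, w[k].left.length + p) = b) →
      PieceHarmonic f w[k].piece b) : Compat w (lineData f x w t) := by
  apply compat_of_forall
  intro k hk
  have hb : ∃ b, (∀ p < w[k].piece.dom.length, t (k, w[k].left.length + p) = b) ∧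
      (∀ p < w[k].piece.cod.length, t (k + 1, w[k].left.length + p) = b) := by
    by_cases h : 0 < w[k].piece.dom.length
    · refine ⟨t (k, w[k].left.length + 0), fun p hp => ?_, fun p hp => ?_⟩
      · exact ht _ _ (PointStep.bottom ⟨k, hk⟩ p 0 hp h)
      · exact (ht _ _ (PointStep.through ⟨k, hk⟩ 0 p h hp)).symm
    · by_cases h' : 0 < w[k].piece.cod.length
      · refine ⟨t (k + 1, w[k].left.length + 0), fun p hp => ?_, fun p hp => ?_⟩
        · omega
        · exact ht _ _ (PointStep.top ⟨k, hk⟩ p 0 hp h')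
      · exact ⟨true, fun p hp => by omega, fun p hp => by omega⟩
  obtain ⟨b, h1, h2⟩ := hb
  unfold lineData
  rw [← source_eq_strandsAt hw hk, ← target_eq_strandsAt w hk]
  exact layerCompat_pot f w[k] b x (hf k hk b h1 h2)
    (fun p hp => ht _ _ (PointStep.left ⟨k, hk⟩ p hp))
    (fun r hr => ht _ _ (PointStep.right ⟨k, hk⟩ r hr)) h1 h2

/-- The jump of a function on the gaps across a point, with the sign of the direction of the strand.
-/
def jump (X : ℕ → List (RatFunc ℚ × RatFunc ℚ)) (x : ℕ × ℕ) : RatFunc ℚ :=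
  (((X x.1).getD x.2 0).1 - ((X x.1).getD (x.2 + 1) 0).1) * ((X x.1).getD x.2 0).2

/-- For a harmonic function, the amplitudes for two initial points are proportional to its jumps
across these points. -/
theorem amp_exchange_of_le (hw : IsTangle [] w []) {X O : ℕ → List (RatFunc ℚ × RatFunc ℚ)}
    (hX : Compat w X) (hX0 : (X 0).length = 1) (hX1 : ∀ k, ∀ e ∈ X k, e.2 = 1 ∨ e.2 = -1)
    (hO : Compat w O) (hO1 : ∀ k, ∀ e ∈ O k, e.1 = 1)
    (hOX : ∀ k, (O k).map Prod.snd = (X k).map Prod.snd)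
    (hlen : ∀ k, (X k).length = (strandsAt w k).length + 1) {x y : ℕ × ℕ}
    (hx : IsPoint w x) (hy : IsPoint w y) (hxy : x.1 ≤ y.1) :
    jump X x * amp w y = jump X y * amp w x := by
  obtain ⟨ℓ, p⟩ := x
  obtain ⟨ℓ', p'⟩ := y
  have h1 := hx.lt hw
  have h2 := hy.lt hw
  simp only [IsPoint] at hx hy
  simp only at h1 h2 hxy
  set w₁ := w.take ℓ with hw₁
  set w₂ := (w.drop ℓ).take (ℓ' - ℓ) with hw₂
  set w₃ := w.drop ℓ' with hw₃
  have e₁ : w₁.length = ℓ := by rw [hw₁, List.length_take]; omega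
  have e₂ : w₂.length = ℓ' - ℓ := by rw [hw₂, List.length_take, List.length_drop]; omega
  have e₁₂ : w.take ℓ' = w₁ ++ w₂ := by
    rw [hw₁, hw₂, ← List.take_add]; congr 1; omega
  have e₂₃ : w.drop ℓ = w₂ ++ w₃ := by
    rw [hw₂, hw₃]
    conv_rhs => rw [show ℓ' = ℓ + (ℓ' - ℓ) by omega, ← List.drop_drop]
    rw [show ℓ + (ℓ' - ℓ) - ℓ = ℓ' - ℓ by omega, List.take_append_drop]
  have e : w = w₁ ++ w₂ ++ w₃ := by rw [← e₁₂, hw₃, List.take_append_drop]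
  have n₃ : w₃ ≠ [] := by
    rw [hw₃]; intro h; rw [List.drop_eq_nil_iff] at h; omega
  have t₁ : IsTangle [] w₁ (strandsAt w ℓ) := isTangle_take hw h1.le
  have t₃ : IsTangle (strandsAt w ℓ') w₃ [] := isTangle_drop hw h2.le
  have t₂ : IsTangle (strandsAt w ℓ) w₂ (strandsAt w ℓ') := by
    have h3 := isTangle_drop hw h1.le
    have h4 := (h3.splitAt (k := ℓ' - ℓ) (by simp; omega)).1
    convert h4 using 1
    unfold strandsAt
    rw [List.map_drop]
    obtain hz | hz := Nat.eq_zero_or_pos (ℓ' - ℓ)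
    · rw [hz, show ℓ' = ℓ by omega]; simp
    · obtain ⟨m, hm⟩ : ∃ m, ℓ' - ℓ = m + 1 := ⟨ℓ' - ℓ - 1, by omega⟩
      rw [hm, show ℓ' = (ℓ + m) + 1 by omega]
      simp [List.getD]
  have key := exchange t₁ t₂ t₃ n₃ (X := X) (O := O) (e ▸ hX) hX0 hX1 (e ▸ hO) hO1 hOX
    (X ℓ) (X ℓ') (by rw [e₁]) (by rw [e₁, e₂, show ℓ + (ℓ' - ℓ) = ℓ' by omega])
    (u := p) (v := p + 1) (r := p') (r' := p' + 1) (by rw [hlen]; omega) (by rw [hlen]; omega)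
    (by rw [hlen]; omega) (by rw [hlen]; omega)
  have hp : p < (X ℓ).length := by rw [hlen]; omega
  have hp1 : p + 1 < (X ℓ).length := by rw [hlen]; omega
  have hp' : p' < (X ℓ').length := by rw [hlen]; omega
  have hp1' : p' + 1 < (X ℓ').length := by rw [hlen]; omega
  have i₁ : ins (X ℓ) p (ins (X ℓ) (p + 1) (sweep w₂ (upper w₃))) =
      fun I => -((X ℓ)[p]'hp).2 * mark p (sweep w₂ (upper w₃)) I :=
    funext fun I => ins_ins _ _ hp1 (hX1 ℓ) _ I
  have i₂ : ins (X ℓ') p' (ins (X ℓ') (p' + 1) (upper w₃)) =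
      fun I => -((X ℓ')[p']'hp').2 * mark p' (upper w₃) I :=
    funext fun I => ins_ins _ _ hp1' (hX1 ℓ') _ I
  have j₂ : ∀ c : RatFunc ℚ, sweep w₂ (fun I => c * mark p' (upper w₃) I) =
      fun I => c * sweep w₂ (mark p' (upper w₃)) I := fun c => funext fun I => sweep_smul _ _ _ _
  rw [i₁, i₂, j₂, sweep_smul, sweep_smul] at key
  have a₁ : amp w (ℓ, p) = sweep w₁ (mark p (sweep w₂ (upper w₃))) [false] := by
    rw [amp, ← hw₁, e₂₃, upper_append _ _ n₃]
  have a₂ : amp w (ℓ', p') = sweep w₁ (sweep w₂ (mark p' (upper w₃))) [false] := by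
    rw [amp, e₁₂, sweep_append]
  rw [← a₁, ← a₂] at key
  simp only [jump]
  rw [List.getD_eq_getElem _ _ hp, List.getD_eq_getElem _ _ hp1, List.getD_eq_getElem _ _ hp',
    List.getD_eq_getElem _ _ hp1']
  have s₁ : ((X ℓ)[p]'hp).2 * ((X ℓ)[p]'hp).2 = 1 := by
    rcases hX1 ℓ _ (List.getElem_mem hp) with h | h <;> rw [h] <;> ring
  have s₂ : ((X ℓ')[p']'hp').2 * ((X ℓ')[p']'hp').2 = 1 := by
    rcases hX1 ℓ' _ (List.getElem_mem hp') with h | h <;> rw [h] <;> ring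
  linear_combination (-((X ℓ)[p]'hp).2 * ((X ℓ')[p']'hp').2) * key -
    (((X ℓ)[p]'hp).1 - ((X ℓ)[p + 1]'hp1).1) * ((X ℓ)[p]'hp).2 * amp w (ℓ', p') * s₂ +
    (((X ℓ')[p']'hp').1 - ((X ℓ')[p' + 1]'hp1').1) * ((X ℓ')[p']'hp').2 * amp w (ℓ, p) * s₁

theorem amp_exchange (hw : IsTangle [] w []) {X O : ℕ → List (RatFunc ℚ × RatFunc ℚ)}
    (hX : Compat w X) (hX0 : (X 0).length = 1) (hX1 : ∀ k, ∀ e ∈ X k, e.2 = 1 ∨ e.2 = -1)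
    (hO : Compat w O) (hO1 : ∀ k, ∀ e ∈ O k, e.1 = 1)
    (hOX : ∀ k, (O k).map Prod.snd = (X k).map Prod.snd)
    (hlen : ∀ k, (X k).length = (strandsAt w k).length + 1) {x y : ℕ × ℕ}
    (hx : IsPoint w x) (hy : IsPoint w y) : jump X x * amp w y = jump X y * amp w x := by
  rcases le_total x.1 y.1 with h | h
  · exact amp_exchange_of_le hw hX hX0 hX1 hO hO1 hOX hlen hx hy h
  · exact (amp_exchange_of_le hw hX hX0 hX1 hO hO1 hOX hlen hy hx h).symm

theorem fst_mem_pot_trivial (x : RatFunc ℚ) (S : List Strand) (t : ℕ → Bool) :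
    ∀ e ∈ pot (fun _ _ x => x) x S t, e.1 = x := by
  induction S generalizing t with
  | nil => simp [pot]
  | cons s S ih => simpa [pot] using fun a b h => ih _ _ h

/-- The exchange relation for the function on the gaps given by a harmonic rule. The constant
function serves as the second harmonic function. -/
theorem amp_exchange_lineData (hw : IsTangle [] w []) {t : ℕ × ℕ → Bool}
    {f : Strand → Bool → RatFunc ℚ → RatFunc ℚ} {x₀ : RatFunc ℚ}
    (hX : Compat w (lineData f x₀ w t)) {x y : ℕ × ℕ} (hx : IsPoint w x) (hy : IsPoint w y) :
    jump (lineData f x₀ w t) x * amp w y = jump (lineData f x₀ w t) y * amp w x := by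
  refine amp_exchange hw hX (by simp [lineData, length_pot, strandsAt])
    (fun k => snd_mem_pot _ _ _ _) (O := lineData (fun _ _ x => x) 1 w fun _ => false)
    (compat_lineData hw (fun _ _ _ => rfl) _ _ ?_) (fun k => fst_mem_pot_trivial _ _ _)
    (fun k => map_snd_pot _ _ _ _ _ _ _) (fun k => length_pot _ _ _ _) hx hy
  intro k hk b h1 h2
  exact pieceHarmonic_congr (b' := false) (fun s x => by simp [mulJump])
    (pieceHarmonic_mul w[k].piece false)

theorem getD_pot (f : Strand → Bool → RatFunc ℚ → RatFunc ℚ) (x : RatFunc ℚ) (S : List Strand)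
    (t : ℕ → Bool) {p : ℕ} (hp : p < S.length) :
    (pot f x S t).getD p 0 = (potLast f x (S.take p) t, S[p].sign) ∧
    ((pot f x S t).getD (p + 1) 0).1 = f S[p] (t p) (potLast f x (S.take p) t) := by
  induction S generalizing x t p with
  | nil => simp at hp
  | cons s S ih =>
    cases p with
    | zero =>
      obtain ⟨j, R, h, -⟩ := pot_eq_cons f (f s (t 0) x) S (fun p => t (p + 1))
      simp [pot, potLast, h]
    | succ p =>
      have := ih (f s (t 0) x) (fun p => t (p + 1)) (p := p) (by simpa using hp)
      simpa [pot, potLast] using this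

theorem jump_lineData (f : Strand → Bool → RatFunc ℚ → RatFunc ℚ) (x₀ : RatFunc ℚ)
    (w : List Layer) (t : ℕ × ℕ → Bool) {x : ℕ × ℕ} (hx : x.2 < (strandsAt w x.1).length) :
    jump (lineData f x₀ w t) x =
      (potLast f x₀ ((strandsAt w x.1).take x.2) (fun p => t (x.1, p)) -
      f (strandsAt w x.1)[x.2] (t x)
        (potLast f x₀ ((strandsAt w x.1).take x.2) (fun p => t (x.1, p)))) *
      (strandsAt w x.1)[x.2].sign := by
  obtain ⟨h1, h2⟩ := getD_pot f x₀ (strandsAt w x.1) (fun p => t (x.1, p)) hx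
  unfold jump
  unfold lineData
  rw [h1, h2]

theorem potLast_mulJump (x : RatFunc ℚ) (S : List Strand) :
    potLast mulJump x S (fun _ => true) = tq (4 * (S.map Strand.flow).sum) * x := by
  induction S generalizing x with
  | nil => simp [potLast, tq_zero]
  | cons s S ih => simp [potLast, ih, mulJump, mul_add, tq_add]; ring

theorem index_succ (w : List Layer) {x : ℕ × ℕ} (hx : x.2 < (strandsAt w x.1).length) :
    index w (x.1, x.2 + 1) = index w x + (strandsAt w x.1)[x.2].flow := by
  unfold index
  rw [List.take_add_one]
  simp [hx]

theorem jump_mul (w : List Layer) {x : ℕ × ℕ} (hx : x.2 < (strandsAt w x.1).length) :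
    jump (lineData mulJump 1 w fun _ => true) x = -basepointFactor w x := by
  rw [jump_lineData _ _ _ _ hx, potLast_mulJump]
  unfold basepointFactor
  simp only
  rw [index_succ w hx]
  rw [show (List.map Strand.flow ((strandsAt w x.1).take x.2)).sum = index w x from rfl]
  set s := (strandsAt w x.1)[x.2]
  simp only [mulJump, if_true]
  rw [mul_one, ← tq_add]
  have h : 4 * s.flow + 4 * index w x = 4 * (index w x + s.flow) := by ring
  rw [h]
  unfold Strand.sign Strand.flow
  cases s.up
  · simp only [Bool.false_eq_true, if_false]
    rw [max_eq_left (by omega), min_eq_right (by omega)]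
    ring
  · simp only [if_true]
    rw [max_eq_right (by omega), min_eq_left (by omega)]
    ring

/-- The quotient of the amplitude by `|δ|` does not depend on the initial point: the powers of the
index are harmonic. -/
theorem amp_mul_basepointFactor (hw : IsTangle [] w []) {x y : ℕ × ℕ} (hx : IsPoint w x)
    (hy : IsPoint w y) :
    basepointFactor w x * amp w y = basepointFactor w y * amp w x := by
  have hX : Compat w (lineData mulJump 1 w fun _ => true) :=
    compat_lineData hw (fun _ _ _ => rfl) _ _ fun k hk b _ _ => pieceHarmonic_mul _ _
  have := amp_exchange_lineData hw hX hx hy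
  rw [jump_mul w hx, jump_mul w hy] at this
  linear_combination -this

theorem tq_injective {a b : ℤ} (h : tq a = tq b) : a = b := by
  by_contra hab
  have key : ∀ n : ℕ, 0 < n → (RatFunc.X : RatFunc ℚ) ^ n ≠ 1 := by
    intro n hn h1
    have h2 : algebraMap (Polynomial ℚ) (RatFunc ℚ) (Polynomial.X ^ n) =
        algebraMap (Polynomial ℚ) (RatFunc ℚ) 1 := by
      rw [map_pow, RatFunc.algebraMap_X, h1, map_one]
    have h3 := RatFunc.algebraMap_injective ℚ h2
    have := congrArg Polynomial.natDegree h3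
    simp at this
    omega
  have h1 : tq (a - b) = 1 := by
    rw [sub_eq_add_neg, tq_add, tq_neg, h, mul_inv_cancel₀ (tq_ne_zero b)]
  have h2 : tq (b - a) = 1 := by
    rw [sub_eq_add_neg, tq_add, tq_neg, h, mul_inv_cancel₀ (tq_ne_zero b)]
  rcases lt_or_gt_of_ne hab with hlt | hlt
  · obtain ⟨n, hn⟩ := Int.eq_ofNat_of_zero_le (show 0 ≤ b - a by omega)
    rw [hn] at h2
    exact key n (by omega) (by simpa [tq] using h2)
  · obtain ⟨n, hn⟩ := Int.eq_ofNat_of_zero_le (show 0 ≤ a - b by omega)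
    rw [hn] at h1
    exact key n (by omega) (by simpa [tq] using h1)

theorem basepointFactor_ne_zero {D : Diagram} {x : ℕ × ℕ} (hx : IsBasepoint D x) :
    basepointFactor D.layers x ≠ 0 := by
  obtain ⟨s, hs, hc⟩ := hx
  obtain ⟨hx, rfl⟩ := List.getElem?_eq_some_iff.1 hs
  have hf : (strandsAt D.layers x.1)[x.2].flow ≠ 0 := by
    unfold Strand.flow; split <;> omega
  unfold basepointFactor
  simp only
  rw [index_succ _ hx]
  intro h
  have := tq_injective (sub_eq_zero.1 h)
  omega

/-! ### Disconnected diagrams -/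

/-- At a vertex of color `0`, all corners in the circle region have the weight `0`. -/
theorem act_eq_zero {P : Piece} (hv : P.isVertex = true) (hc : ∀ s ∈ P.dom, s.color = 0)
    (h : Cov) (m : List Bool) : act P h m = 0 := by
  have hb : brace 0 = 0 := brace_zero
  cases P with
  | merge i k =>
    simp [Piece.dom, up] at hc
    obtain ⟨rfl, rfl⟩ := hc
    match m with
    | [x, false, z] => simp [act, moves, hb]
    | [x, true, z] => cases x <;> cases z <;> simp [act, moves, hb]
    | [] | [_] | [_, _] | _ :: _ :: _ :: _ :: _ => simp [act, moves]
  | split i k =>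
    simp [Piece.dom, up] at hc
    obtain ⟨rfl, rfl⟩ := hc
    match m with
    | [x, z] => simp [act, moves, hb]
    | [] | [_] | _ :: _ :: _ :: _ => simp [act, moves]
  | _ => simp [Piece.isVertex] at hv

theorem mark_zero (p : ℕ) : mark p (fun _ => 0) = fun _ => 0 := by
  induction p with
  | zero => funext I; unfold mark; split <;> rfl
  | succ p ih =>
    funext I
    cases I with
    | nil => rfl
    | cons b I => simp [mark, ih]

theorem sweep_zero (w : List Layer) : sweep w (fun _ => 0) = fun _ => 0 := by
  funext I
  simpa using sweep_smul w 0 (fun _ => 0) I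

theorem sweep_eq_zero {u v : List Layer} {l : Layer} (hl : ∀ h m, act l.piece h m = 0) (h : Cov) :
    sweep (u ++ l :: v) h = fun _ => 0 := by
  rw [sweep_append, sweep_cons]
  have : step l (sweep v h) = fun _ => 0 := funext fun I => hl _ _
  rw [this, sweep_zero]

theorem amp_eq_zero_of_act (hw : IsTangle [] w []) {k : ℕ} (hk : k < w.length)
    (hl : ∀ h m, act w[k].piece h m = 0) (x : ℕ × ℕ) : amp w x = 0 := by
  unfold amp
  by_cases hx : k < x.1
  · have : w.take x.1 = w.take k ++ w[k] :: (w.take x.1).drop (k + 1) := by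
      have h := List.take_append_drop k (w.take x.1)
      rw [List.take_take, min_eq_left hx.le,
        List.drop_eq_getElem_cons (by rw [List.length_take]; omega), List.getElem_take] at h
      exact h.symm
    rw [this, sweep_eq_zero hl]
  · have h0 : w.drop x.1 ≠ [] := by simp; omega
    obtain ⟨u, s, hu, -⟩ := exists_last (isTangle_drop hw (by omega : x.1 ≤ w.length)) h0
    have hkn : k < w.length - 1 := by
      by_contra hcon
      have h1 : w[k] = (w.drop x.1).getLast h0 := by
        rw [List.getLast_drop, List.getLast_eq_getElem]; congr 1; omega
      have h2 : (w.drop x.1).getLast h0 = ⟨[], .cap s, []⟩ := by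
        simp [hu]
      have h3 := hl (fun _ => 1) [false, true, false]
      rw [h1, h2] at h3
      simp [act, moves] at h3
    have e : (w.drop x.1).dropLast = ((w.drop x.1).dropLast).take (k - x.1) ++
        w[k] :: ((w.drop x.1).dropLast).drop (k - x.1 + 1) := by
      conv_lhs => rw [← List.take_append_drop (k - x.1) (w.drop x.1).dropLast]
      have hlt : k - x.1 < (w.drop x.1).dropLast.length := by
        rw [List.length_dropLast, List.length_drop]; omega
      rw [List.drop_eq_getElem_cons hlt]
      congr 2
      simp only [List.getElem_dropLast, List.getElem_drop]
      congr 1; omega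
    rw [upper, e, sweep_eq_zero hl, mark_zero, sweep_zero]

/-- The amplitude of a disconnected diagram vanishes: there is a harmonic function that is constant
next to the component of the initial point and jumps across another one. -/
theorem amp_eq_zero_of_not_isConnected (hw : IsTangle [] w []) (hc : ¬ MOY.IsConnected w)
    {x : ℕ × ℕ} (hx : IsPoint w x) : amp w x = 0 := by
  classical
  obtain ⟨y, hy, hxy⟩ : ∃ y, IsPoint w y ∧ ¬ Relation.EqvGen (PointStep w) x y := by
    by_contra hcon
    push Not at hcon
    exact hc fun a b ha hb => (hcon a ha).symm.trans _ _ _ (hcon b hb)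
  set t : ℕ × ℕ → Bool := fun z => decide (Relation.EqvGen (PointStep w) y z) with ht
  have htc : IsClosed w t := by
    intro a b hab
    simp only [ht, decide_eq_decide]
    exact ⟨fun h => h.trans _ _ _ (.rel _ _ hab), fun h => h.trans _ _ _ (.symm _ _ (.rel _ _ hab))⟩
  have htx : t x = false := by simpa [ht] using fun h => hxy (Relation.EqvGen.symm _ _ h)
  by_cases hcol : ∃ (z : ℕ × ℕ) (hz : z.2 < (strandsAt w z.1).length), t z = true ∧
      0 < (strandsAt w z.1)[z.2].color
  -- a strand of positive color in another component: take the powers of the index with respect to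
  -- this component
  · obtain ⟨z, hz, htz, hcz⟩ := hcol
    have hX : Compat w (lineData mulJump 1 w t) :=
      compat_lineData hw htc _ _ fun k hk b _ _ => pieceHarmonic_mul _ _
    have key := amp_exchange_lineData hw hX (x := z) hz hx
    have h1 : jump (lineData mulJump 1 w t) x = 0 := by
      rw [jump_lineData _ _ _ _ hx, htx]; simp [mulJump]
    rw [h1, zero_mul, mul_eq_zero] at key
    refine key.resolve_left ?_
    rw [jump_lineData _ _ _ _ hz, htz]
    set s := (strandsAt w z.1)[z.2]
    have hne : ∀ S t', potLast mulJump 1 S t' ≠ 0 := by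
      intro S
      suffices h : ∀ (S : List Strand) (x : RatFunc ℚ) t', x ≠ 0 → potLast mulJump x S t' ≠ 0 from
        fun t' => h S 1 t' one_ne_zero
      intro S
      induction S with
      | nil => exact fun x t' h => h
      | cons s S ih =>
        intro x t' h
        apply ih
        unfold mulJump
        split
        · exact mul_ne_zero (tq_ne_zero _) h
        · exact h
    have hs : s.sign ≠ 0 := by rcases s.sign_cases with h | h <;> rw [h] <;> simp
    refine mul_ne_zero ?_ hs
    simp only [mulJump, if_true]
    rw [← one_sub_mul]
    refine mul_ne_zero ?_ (hne _ _)
    rw [sub_ne_zero, ← tq_zero]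
    intro h
    have := tq_injective h
    unfold Strand.flow at this
    split at this <;> omega
  -- all colors of the other component are `0`: the powers of the index are constant, but the
  -- uncolored index is harmonic, unless there is a vertex of color `0`, whose weight is `0`
  · push Not at hcol
    by_cases hv : ∃ (k : ℕ) (hk : k < w.length), w[k].piece.isVertex = true ∧
        ∀ s ∈ w[k].piece.dom, s.color = 0
    · obtain ⟨k, hk, h1, h2⟩ := hv
      exact amp_eq_zero_of_act hw hk (act_eq_zero h1 h2) x
    push Not at hv
    have hX : Compat w (lineData addJump 0 w t) := by
      refine compat_lineData hw htc _ _ fun k hk b h1 h2 => ?_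
      have h3 : b = true → ∀ s ∈ w[k].piece.dom, s.color = 0 := by
        rintro rfl s hs
        obtain ⟨p, hp, rfl⟩ := List.getElem_of_mem hs
        have hsrc := source_eq_strandsAt hw hk
        have hlt : w[k].left.length + p < (strandsAt w k).length := by
          rw [← hsrc, w[k].length_source]; omega
        have h4 := hcol (k, w[k].left.length + p) hlt (h1 p hp)
        have h5 : (strandsAt w k)[w[k].left.length + p] = w[k].piece.dom[p] := by
          simp only [← hsrc, Layer.source, List.append_assoc]
          rw [List.getElem_append_right (by omega), List.getElem_append_left (by omega)]
          congr 1; omega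
        simp only [h5] at h4
        omega
      refine pieceHarmonic_add (fun hb => ?_) h3
      by_contra hcon
      obtain ⟨s, hs, h4⟩ := hv k hk (by simpa using hcon)
      exact h4 (h3 hb s hs)
    have key := amp_exchange_lineData hw hX (x := y) hy hx
    have hty : t y = true := by simpa [ht] using Relation.EqvGen.refl y
    have h1 : jump (lineData addJump 0 w t) x = 0 := by
      rw [jump_lineData _ _ _ _ hx, htx]; simp [addJump]
    rw [h1, zero_mul, mul_eq_zero] at key
    refine key.resolve_left ?_
    rw [jump_lineData _ _ _ _ hy, hty]
    simp only [addJump, if_true]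
    set s := (strandsAt w y.1)[y.2]
    rcases s.sign_cases with h | h <;> rw [h] <;> simp

end

noncomputable section

/-! ### Covering the vertices of a forest -/

section Forest

open MvPolynomial

variable {V C K ι : Type*} [CommSemiring K]

/-- The graph with edges `e ∈ E` from `bot e` to `top e` is a forest: there is no non-zero
flow without sources and sinks. -/
def IsForest (E : Finset ι) (bot top : ι → V) : Prop :=
  ∀ m : ι → ℚ, (∀ φ : V → ℚ, ∑ e ∈ E, m e * (φ (bot e) - φ (top e)) = 0) → ∀ e ∈ E, m e = 0

theorem IsForest.ne [DecidableEq ι] {E : Finset ι} {bot top : ι → V} (h : IsForest E bot top) {e : ι}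
    (he : e ∈ E) : bot e ≠ top e := by
  intro heq
  have := h (fun e' => if e' = e then 1 else 0) (fun φ => by simp [heq]) e he
  simp at this

variable [DecidableEq V]

/-- The exponent of the square-free monomial that is the product of the variables in `S`. -/
def ones (S : Finset V) : V →₀ ℕ := ∑ v ∈ S, Finsupp.single v 1

theorem ones_apply (S : Finset V) (v : V) : ones S v = if v ∈ S then 1 else 0 := by
  simp [ones, Finsupp.finsetSum_apply, Finsupp.single_apply]

/-- The contraction of the edge from `a` to `b`: it moves `b` to `a`. -/
def glue (a b v : V) : V := if v = b then a else v

theorem mapDomain_glue {a b : V} (hab : a ≠ b) (u : V →₀ ℕ) (v : V) :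
    u.mapDomain (glue a b) v = if v = b then 0 else if v = a then u a + u b else u v := by
  induction u using Finsupp.induction_linear with
  | zero => simp
  | add f g hf hg =>
    rw [Finsupp.mapDomain_add, Finsupp.add_apply, hf, hg]
    split_ifs
    · rfl
    · exact add_add_add_comm _ _ _ _
    · rfl
  | single x n =>
    rw [Finsupp.mapDomain_single]
    simp only [Finsupp.single_apply, glue]
    by_cases hx : x = b
    · subst hx
      by_cases h1 : v = x
      · simp [h1, hab]
      · by_cases h2 : v = a
        · simp [h2, hab, hab.symm]
        · simp [h1, h2, Ne.symm h1, Ne.symm h2]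
    · by_cases h1 : v = b
      · simp [h1, hx]
      · by_cases h2 : v = a
        · simp [h2, hx, hab]
        · simp [h1, h2, hx]

/-- If an edge from `a` to `b` covers one of its ends, then the other end is covered from elsewhere.
This is the same as to cover the vertex that arises when the edge is contracted. -/
theorem coeff_contract {S : Finset V} {a b : V} (ha : a ∈ S) (hb : b ∈ S) (hab : a ≠ b)
    (F : MvPolynomial V K) :
    coeff (ones S) ((X a + X b) * F) = coeff (ones (S.erase b)) (rename (glue a b) F) := by
  induction F using MvPolynomial.induction_on' with
  | add p q hp hq => rw [mul_add, coeff_add, hp, hq, map_add, coeff_add]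
  | monomial u c =>
    rw [rename_monomial, add_mul, X, X, monomial_mul, monomial_mul, coeff_add, one_mul]
    simp only [coeff_monomial]
    have hA : Finsupp.single a 1 + u = ones S ↔
        u a = 0 ∧ u b = 1 ∧ ∀ x, x ≠ a → x ≠ b → u x = if x ∈ S then 1 else 0 := by
      rw [Finsupp.ext_iff]
      simp only [Finsupp.add_apply, Finsupp.single_apply, ones_apply]
      constructor
      · intro h
        refine ⟨by simpa [ha] using h a, by simpa [hb, hab] using h b, fun x hx hx' => ?_⟩
        simpa [hx.symm] using h x
      · rintro ⟨h1, h2, h3⟩ x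
        by_cases hx : x = a
        · simp [hx, h1, ha]
        by_cases hx' : x = b
        · simp [hx', h2, hb, hab]
        simp [Ne.symm hx, h3 x hx hx']
    have hB : Finsupp.single b 1 + u = ones S ↔
        u a = 1 ∧ u b = 0 ∧ ∀ x, x ≠ a → x ≠ b → u x = if x ∈ S then 1 else 0 := by
      rw [Finsupp.ext_iff]
      simp only [Finsupp.add_apply, Finsupp.single_apply, ones_apply]
      constructor
      · intro h
        refine ⟨by simpa [ha, hab.symm] using h a, by simpa [hb] using h b, fun x hx hx' => ?_⟩
        simpa [hx'.symm] using h x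
      · rintro ⟨h1, h2, h3⟩ x
        by_cases hx : x = a
        · simp [hx, h1, ha, hab.symm]
        by_cases hx' : x = b
        · simp [hx', h2, hb]
        simp [Ne.symm hx', h3 x hx hx']
    have hC : u.mapDomain (glue a b) = ones (S.erase b) ↔
        u a + u b = 1 ∧ ∀ x, x ≠ a → x ≠ b → u x = if x ∈ S then 1 else 0 := by
      rw [Finsupp.ext_iff]
      simp only [ones_apply, mapDomain_glue hab, Finset.mem_erase]
      constructor
      · intro h
        refine ⟨by simpa [hab, ha] using h a, fun x hx hx' => by simpa [hx, hx'] using h x⟩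
      · rintro ⟨h1, h3⟩ x
        by_cases hx' : x = b
        · simp [hx']
        by_cases hx : x = a
        · simp [hx, h1, ha, hab]
        simp [hx, hx', h3 x hx hx']
    classical
    rw [if_congr hA rfl rfl, if_congr hB rfl rfl, if_congr hC rfl rfl]
    by_cases h3 : ∀ x, x ≠ a → x ≠ b → u x = if x ∈ S then 1 else 0
    · simp only [eq_true h3, and_true]
      rcases Nat.eq_zero_or_pos (u a) with h1 | h1
      · simp [h1]
      · rcases Nat.eq_zero_or_pos (u b) with h2 | h2
        · simp [h2]
        · rw [if_neg (by omega), if_neg (by omega), if_neg (by omega)]; simp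
    · rw [if_neg (fun h => h3 h.2.2), if_neg (fun h => h3 h.2.2), if_neg (fun h => h3 h.2)]
      simp

/-- The contraction of an edge turns a forest into a forest. -/
theorem IsForest.contract [DecidableEq ι] {E : Finset ι} {bot top : ι → V} {e₀ : ι} (he : e₀ ∉ E)
    (h : IsForest (insert e₀ E) bot top) :
    IsForest E (fun e => glue (bot e₀) (top e₀) (bot e))
      (fun e => glue (bot e₀) (top e₀) (top e)) := by
  have hne := h.ne (Finset.mem_insert_self _ _)
  set a := bot e₀
  set b := top e₀
  have hE₀ : ∀ e ∈ E, e ≠ e₀ := fun e hE h => he (by rwa [h] at hE)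
  intro m hm e hE
  set δ : V → ℚ := fun v => if v = b then 1 else 0 with hδ
  set c : ℚ := ∑ e ∈ E, m e * (δ (bot e) - δ (top e)) with hc
  have key := h (Function.update m e₀ c) (fun φ => ?_) e (Finset.mem_insert_of_mem hE)
  · rwa [Function.update_of_ne (hE₀ e hE)] at key
  · rw [Finset.sum_insert he, Function.update_self]
    have h1 : ∑ e ∈ E, Function.update m e₀ c e * (φ (bot e) - φ (top e)) =
        ∑ e ∈ E, m e * (φ (bot e) - φ (top e)) :=
      Finset.sum_congr rfl fun e hE => by
        rw [Function.update_of_ne (hE₀ e hE)]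
    have h2 := hm φ
    -- `φ` differs from its pullback along the contraction by a multiple of `δ`
    have h3 : ∀ v, φ v = φ (glue a b v) + (φ b - φ a) * δ v := by
      intro v
      simp only [glue, hδ]
      split_ifs with hv
      · rw [hv]; ring
      · ring
    have h4 : ∑ e ∈ E, m e * (φ (bot e) - φ (top e)) = (φ b - φ a) * c := by
      rw [← sub_zero (∑ e ∈ E, m e * (φ (bot e) - φ (top e))), ← h2, hc, Finset.mul_sum,
        ← Finset.sum_sub_distrib]
      refine Finset.sum_congr rfl fun e _ => ?_
      have ha := h3 (bot e)
      have hb := h3 (top e)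
      linear_combination m e * ha - m e * hb
    rw [h1, h4]; ring

/-- In a forest, there is one orientation of the edges for which every vertex is covered exactly
once, by a marker or by the head of an edge, if every tree contains exactly one marker, and
there is none otherwise. -/
theorem coeff_forest [DecidableEq C] [DecidableEq ι] (E : Finset ι) : ∀ (bot top : ι → V) (S :
    Finset V) (q : V → C)
    (M : V →₀ ℕ), (∀ e ∈ E, bot e ∈ S ∧ top e ∈ S) → IsForest E bot top →
    (∀ e ∈ E, q (bot e) = q (top e)) →
    (∀ x ∈ S, ∀ y ∈ S, q x = q y →
      Relation.EqvGen (fun x y => ∃ e ∈ E, x = bot e ∧ y = top e) x y) →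
    (∀ v ∈ M.support, v ∈ S) →
    coeff (ones S) ((∏ e ∈ E, (X (bot e) + X (top e))) * monomial M (1 : K)) =
      if M.mapDomain q = ones (S.image q) then 1 else 0 := by
  induction E using Finset.induction_on with
  | empty =>
    intro bot top S q M _ _ _ h2 hM
    have hinj : Set.InjOn q S := by
      intro x hx y hy hxy
      have h := h2 x hx y hy hxy
      clear hxy hx hy
      induction h with
      | rel _ _ h => simp at h
      | refl => rfl
      | symm _ _ _ ih => exact ih.symm
      | trans _ _ _ _ _ ih ih' => exact ih.trans ih'
    have h1 : ones (S.image q) = (ones S).mapDomain q := by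
      rw [ones, Finset.sum_image hinj, ones, Finsupp.mapDomain_finsetSum]
      simp [Finsupp.mapDomain_single]
    have h3 : M.mapDomain q = ones (S.image q) ↔ M = ones S := by
      rw [h1]
      refine (Finsupp.mapDomain_injOn (S : Set V) hinj).eq_iff (fun v hv => hM v hv) ?_
      intro v hv
      by_contra hS
      rw [Finset.mem_coe] at hv hS
      rw [Finsupp.mem_support_iff, ones_apply, if_neg hS] at hv
      exact hv rfl
    rw [Finset.prod_empty, one_mul, coeff_monomial, if_congr h3 rfl rfl]
  | insert e₀ E he ih =>
    intro bot top S q M hE hF h1 h2 hM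
    have hne := hF.ne (Finset.mem_insert_self _ _)
    obtain ⟨ha, hb⟩ := hE e₀ (Finset.mem_insert_self _ _)
    have hqab := h1 e₀ (Finset.mem_insert_self _ _)
    have hqg : ∀ v, q (glue (bot e₀) (top e₀) v) = q v := by
      intro v; unfold glue; split_ifs with h
      · rw [h, hqab]
      · rfl
    have hgS : ∀ v ∈ S, glue (bot e₀) (top e₀) v ∈ S.erase (top e₀) := by
      intro v hv; unfold glue; split_ifs with h
      · exact Finset.mem_erase.2 ⟨hne, ha⟩
      · exact Finset.mem_erase.2 ⟨h, hv⟩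
    rw [Finset.prod_insert he, mul_assoc, coeff_contract ha hb hne, map_mul, map_prod,
      rename_monomial]
    simp only [map_add, rename_X]
    rw [ih (fun e => glue (bot e₀) (top e₀) (bot e)) (fun e => glue (bot e₀) (top e₀) (top e))
      (S.erase (top e₀)) q]
    · rw [← Finsupp.mapDomain_comp]
      have e1 : q ∘ glue (bot e₀) (top e₀) = q := funext hqg
      have e2 : (S.erase (top e₀)).image q = S.image q := by
        ext c
        simp only [Finset.mem_image]
        constructor
        · rintro ⟨x, hx, rfl⟩; exact ⟨x, Finset.mem_of_mem_erase hx, rfl⟩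
        · rintro ⟨x, hx, rfl⟩; exact ⟨_, hgS x hx, hqg x⟩
      rw [e1, e2]
    · intro e h
      obtain ⟨h1, h2⟩ := hE e (Finset.mem_insert_of_mem h)
      exact ⟨hgS _ h1, hgS _ h2⟩
    · exact hF.contract he
    · intro e h; rw [hqg, hqg]; exact h1 e (Finset.mem_insert_of_mem h)
    · intro x hx y hy hxy
      have h := h2 x (Finset.mem_of_mem_erase hx) y (Finset.mem_of_mem_erase hy) hxy
      have hx' : glue (bot e₀) (top e₀) x = x := if_neg (Finset.ne_of_mem_erase hx)
      have hy' : glue (bot e₀) (top e₀) y = y := if_neg (Finset.ne_of_mem_erase hy)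
      rw [← hx', ← hy']
      clear hxy hx hy hx' hy'
      induction h with
      | rel x y h =>
        obtain ⟨e, h, rfl, rfl⟩ := h
        rcases Finset.mem_insert.1 h with rfl | h
        · have : glue (bot e) (top e) (bot e) = glue (bot e) (top e) (top e) := by
            simp [glue]
          rw [this]; exact .refl _
        · exact .rel _ _ ⟨e, h, rfl, rfl⟩
      | refl => exact .refl _
      | symm _ _ _ ih => exact .symm _ _ ih
      | trans _ _ _ _ _ ih ih' => exact .trans _ _ _ ih ih'
    · intro v hv
      obtain ⟨x, hx, rfl⟩ := Finset.mem_image.1 (Finsupp.mapDomain_support hv)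
      exact hgS x (hM x hx)

end Forest

end

noncomputable section

open MvPolynomial

/-! ### The generating polynomial of a layer -/

/-- The gaps on the horizontal lines, and the circle regions. -/
abbrev Vertex := (ℕ × ℕ) ⊕ ℕ

/-- The number of the line of a gap, or of the layer of a circle region. -/
def height : Vertex → ℕ
  | .inl x => x.1
  | .inr k => k

/-- The generating polynomials: a variable for every gap and every circle region, whose exponent
counts how often it is covered. As every vertex has to be covered exactly once, only the
coefficients of square-free monomials matter. -/
abbrev GapPoly := MvPolynomial Vertex (RatFunc ℚ)

/-- The polynomials in variables of height at least `k`. -/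
abbrev above (k : ℕ) : Subalgebra (RatFunc ℚ) GapPoly :=
  supported (RatFunc ℚ) {v | k ≤ height v}

/-- The polynomials in which the variable `v` does not occur. -/
abbrev without (v : Vertex) : Subalgebra (RatFunc ℚ) GapPoly := supported (RatFunc ℚ) {v}ᶜ

theorem above_le_without {k : ℕ} {v : Vertex} (h : height v < k) : above k ≤ without v := by
  apply supported_mono
  intro x hx hv
  rw [Set.mem_singleton_iff] at hv
  subst hv
  simp only [Set.mem_ofPred_eq] at hx
  omega

theorem above_anti {k l : ℕ} (h : k ≤ l) : above l ≤ above k :=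
  supported_mono fun _ hx => le_trans h hx

theorem X_mem_without {v v' : Vertex} (h : v' ≠ v) : (X v' : GapPoly) ∈ without v :=
  X_mem_supported.2 h

theorem coeff_eq_zero_of_without {v : Vertex} {F : GapPoly} (hF : F ∈ without v)
    {s : Vertex →₀ ℕ} (hs : s v ≠ 0) : coeff s F = 0 := by
  by_contra h
  have h1 : v ∈ F.vars := (mem_vars_iff_mem_support v).2 ⟨s, mem_support_iff.2 h, Finsupp.mem_support_iff.2 hs⟩
  exact (mem_supported.1 hF) h1 rfl

theorem coeff_X_mul_eq_zero {v : Vertex} {s : Vertex →₀ ℕ} (hs : s v = 0) (F : GapPoly) :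
    coeff s (X v * F) = 0 := by
  rw [coeff_X_mul', if_neg]; simpa using hs

/-- A vertex that is covered twice does not contribute to square-free coefficients. -/
theorem coeff_sq_mul {v : Vertex} {s : Vertex →₀ ℕ} (hs : s v ≤ 1) (F : GapPoly) :
    coeff s (X v * (X v * F)) = 0 := by
  rw [coeff_X_mul']
  split_ifs with h
  · apply coeff_X_mul_eq_zero
    simp; omega
  · rfl

/-- Extraction of the linear coefficient of a variable. -/
theorem coeff_linear {v : Vertex} {s : Vertex →₀ ℕ} (hs : s v = 0) {F₀ : GapPoly}
    (h₀ : F₀ ∈ without v) (F₁ F₂ : GapPoly) :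
    coeff (Finsupp.single v 1 + s) (F₀ + X v * F₁ + X v * (X v * F₂)) = coeff s F₁ := by
  rw [coeff_add, coeff_add, coeff_X_mul, coeff_X_mul, coeff_X_mul_eq_zero hs,
    coeff_eq_zero_of_without h₀ (by simp), zero_add, add_zero]

/-- The variable `v` if the bit is set, and `1` otherwise. -/
def bitX (v : Vertex) (b : Bool) : GapPoly := if b then X v else 1

theorem bitX_true (v : Vertex) : bitX v true = X v := rfl
theorem bitX_false (v : Vertex) : bitX v false = 1 := rfl

theorem bitX_mem {v : Vertex} {A : Subalgebra (RatFunc ℚ) GapPoly} (b : Bool)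
    (h : X v ∈ A) : bitX v b ∈ A := by
  unfold bitX; split
  · exact h
  · exact one_mem _

/-- An edge between the vertices `v` and `u` transports the bit of `v` to `u`. -/
theorem coeff_edge {v u : Vertex} {s : Vertex →₀ ℕ} (hs : s v = 0) (hu : s u ≤ 1) (huv : u ≠ v)
    (b : Bool) {F : GapPoly} (hF : F ∈ without v) (G : GapPoly) :
    coeff (Finsupp.single v 1 + s) ((X v + X u) * (bitX v b * (F + X v * G))) =
      coeff s (bitX u b * (F + X u * G)) := by
  have hu' := X_mem_without huv
  cases b
  · rw [bitX_false, bitX_false]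
    rw [show (X v + X u) * (1 * (F + X v * G)) =
      X u * F + X v * (F + X u * G) + X v * (X v * G) by ring]
    rw [coeff_linear hs (mul_mem hu' hF), one_mul]
  · rw [bitX_true, bitX_true]
    rw [show (X v + X u) * (X v * (F + X v * G)) =
      0 + X v * (X u * F) + X v * (X v * (F + X u * G + X v * G)) by ring]
    rw [coeff_linear hs (zero_mem _), mul_add, coeff_add, coeff_sq_mul hu, add_zero]

/-- The special case of `coeff_edge` in which `v` is not covered from elsewhere. -/
theorem coeff_edge' {v u : Vertex} {s : Vertex →₀ ℕ} (hs : s v = 0) (hu : s u ≤ 1) (huv : u ≠ v)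
    (b : Bool) {F : GapPoly} (hF : F ∈ without v) :
    coeff (Finsupp.single v 1 + s) ((X v + X u) * (bitX v b * F)) = coeff s (bitX u b * F) := by
  simpa using coeff_edge hs hu huv b hF 0

/-- The product of the variables of the gaps `(k, p)`, `(k, p + 1)`, … whose bits are set. -/
def rowPoly (k : ℕ) : ℕ → List Bool → GapPoly
  | _, [] => 1
  | p, b :: I => bitX (.inl (k, p)) b * rowPoly k (p + 1) I

/-- The exponent of the product of the variables `(k, p)`, …, `(k, p + n - 1)`. -/
def rowExp (k : ℕ) : ℕ → ℕ → Vertex →₀ ℕ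
  | _, 0 => 0
  | p, n + 1 => Finsupp.single (.inl (k, p)) 1 + rowExp k (p + 1) n

/-- The edges from `(k, p)`, …, `(k, p + n - 1)` to `(k + 1, p')`, …, `(k + 1, p' + n - 1)`. -/
def strip (k : ℕ) : ℕ → ℕ → ℕ → GapPoly
  | _, _, 0 => 1
  | p, p', n + 1 => (X (.inl (k, p)) + X (.inl (k + 1, p'))) * strip k (p + 1) (p' + 1) n

theorem rowPoly_append (k p : ℕ) (I J : List Bool) :
    rowPoly k p (I ++ J) = rowPoly k p I * rowPoly k (p + I.length) J := by
  induction I generalizing p with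
  | nil => simp [rowPoly]
  | cons b I ih =>
    simp [rowPoly, ih, mul_assoc, Nat.add_comm I.length 1, Nat.add_assoc]

theorem rowExp_add (k p m n : ℕ) : rowExp k p (m + n) = rowExp k p m + rowExp k (p + m) n := by
  induction m generalizing p with
  | zero => simp [rowExp]
  | succ m ih =>
    rw [show m + 1 + n = (m + n) + 1 by omega, rowExp, rowExp, ih,
      show p + 1 + m = p + (m + 1) by omega, add_assoc]

theorem strip_succ (k p p' n : ℕ) :
    strip k p p' (n + 1) = strip k p p' n * (X (.inl (k, p + n)) + X (.inl (k + 1, p' + n))) := by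
  induction n generalizing p p' with
  | zero => simp [strip]
  | succ n ih =>
    rw [strip, ih, strip, mul_assoc, show p + 1 + n = p + (n + 1) by omega,
      show p' + 1 + n = p' + (n + 1) by omega]

theorem rowPoly_mem {A : Subalgebra (RatFunc ℚ) GapPoly} {k p : ℕ} {I : List Bool}
    (h : ∀ i < I.length, (X (.inl (k, p + i)) : GapPoly) ∈ A) : rowPoly k p I ∈ A := by
  induction I generalizing p with
  | nil => exact one_mem _
  | cons b I ih =>
    refine mul_mem (bitX_mem _ (h 0 (by simp))) (ih fun i hi => ?_)
    have := h (i + 1) (by simpa using hi)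
    rwa [show p + (i + 1) = p + 1 + i by omega] at this

theorem strip_mem {A : Subalgebra (RatFunc ℚ) GapPoly} {k p p' n : ℕ}
    (h : ∀ i < n, (X (.inl (k, p + i)) : GapPoly) ∈ A)
    (h' : ∀ i < n, (X (.inl (k + 1, p' + i)) : GapPoly) ∈ A) : strip k p p' n ∈ A := by
  induction n generalizing p p' with
  | zero => exact one_mem _
  | succ n ih =>
    refine mul_mem (add_mem (h 0 (by simp)) (h' 0 (by simp))) (ih (fun i hi => ?_) fun i hi => ?_)
    · have := h (i + 1) (by simpa using hi)
      rwa [show p + (i + 1) = p + 1 + i by omega] at this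
    · have := h' (i + 1) (by simpa using hi)
      rwa [show p' + (i + 1) = p' + 1 + i by omega] at this

theorem rowExp_inr (k p n j : ℕ) : rowExp k p n (.inr j) = 0 := by
  induction n generalizing p with
  | zero => simp [rowExp]
  | succ n ih => simp [rowExp, ih]

theorem rowExp_inl (k p n ℓ g : ℕ) :
    rowExp k p n (.inl (ℓ, g)) = if ℓ = k ∧ p ≤ g ∧ g < p + n then 1 else 0 := by
  induction n generalizing p with
  | zero => simp [rowExp]
  | succ n ih =>
    simp only [rowExp, Finsupp.add_apply, ih, Finsupp.single_apply, Sum.inl.injEq, Prod.mk.injEq]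
    split_ifs <;> omega

/-- The vertical gaps next to a piece transport their bits. -/
theorem coeff_strip {k p p' : ℕ} {A : List Bool} {s : Vertex →₀ ℕ}
    (hs : ∀ g, s (.inl (k, g)) ≠ 0 → g < p ∨ p + A.length ≤ g)
    (hs' : ∀ v, s v ≤ 1) {F : GapPoly} (hF : ∀ i < A.length, F ∈ without (.inl (k, p + i))) :
    coeff (rowExp k p A.length + s) (rowPoly k p A * strip k p p' A.length * F) =
      coeff s (rowPoly (k + 1) p' A * F) := by
  induction A generalizing p p' F with
  | nil => simp [rowExp, rowPoly, strip]
  | cons b A ih =>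
    simp only [List.length_cons, rowPoly, strip, rowExp] at hs hF ⊢
    rw [show bitX (.inl (k, p)) b * rowPoly k (p + 1) A *
      ((X (.inl (k, p)) + X (.inl (k + 1, p'))) * strip k (p + 1) (p' + 1) A.length) * F =
      (X (.inl (k, p)) + X (.inl (k + 1, p'))) * (bitX (.inl (k, p)) b *
        (rowPoly k (p + 1) A * strip k (p + 1) (p' + 1) A.length * F)) by ring, add_assoc]
    rw [coeff_edge']
    · rw [mul_left_comm, mul_assoc (bitX _ b), ih]
      · congr 1; ring
      · intro g hg; have := hs g hg; omega
      · intro i hi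
        refine mul_mem (bitX_mem _ (X_mem_without (by simp))) ?_
        have := hF (i + 1) (by omega)
        rwa [show p + (i + 1) = p + 1 + i by omega] at this
    · rw [Finsupp.add_apply, rowExp_inl, if_neg (by omega), zero_add]
      by_contra h; have := hs p h; omega
    · rw [Finsupp.add_apply, rowExp_inl, if_neg (by omega), zero_add]
      exact hs' _
    · simp
    · refine mul_mem (mul_mem (rowPoly_mem fun i hi => ?_) (strip_mem (fun i hi => ?_)
        fun i hi => ?_)) ?_
      · exact X_mem_without (by simp; omega)
      · exact X_mem_without (by simp; omega)
      · exact X_mem_without (by simp)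
      · exact hF 0 (by omega)

/-- The vertex in which a corner of crossing number `c` lies, for a piece at position `a` of
layer `k`.  (The value at the missing south corner of a vertex is immaterial, as its weight is
`0`.) -/
def cornerVertex (k a : ℕ) (P : Piece) (c : ℕ) : Corner → Vertex :=
  if P.isVertex then
    fun
    | .north => .inr k
    | .south => .inr k
    | .west => .inl (k, a + c)
    | .east => .inl (k, a + c + 1)
  else
    fun
    | .north => .inl (k + 1, a + 1)
    | .south => .inl (k, a + 1)
    | .west => .inl (k, a)
    | .east => .inl (k, a + 2)

/-- The weight of a corner. -/
def weight (P : Piece) (c : ℕ) (x : Corner) : RatFunc ℚ := cornerSign P x * cornerWeight P c x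

/-- The sum over the choices of corners at all crossings of a piece. -/
def cornerPoly (k a : ℕ) (P : Piece) : GapPoly :=
  ∏ c : Fin P.numCrossings, ∑ x, C (weight P c x) * X (cornerVertex k a P c x)

/-- The sum over the choices of corners and of the covered ends of the vertical edges in a layer.
The edges join the gaps on the left of the piece on the two boundary lines, and likewise the gaps on
the right of it; the gaps next to the piece are included. -/
def layerPoly (k : ℕ) (l : Layer) : GapPoly :=
  cornerPoly k l.left.length l.piece * strip k 0 0 (l.left.length + 1) *
    strip k (l.left.length + l.piece.dom.length) (l.left.length + l.piece.cod.length)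
      (l.right.length + 1)

/-- The exponent of the circle region of a vertex. -/
def circleExp (k : ℕ) (P : Piece) : Vertex →₀ ℕ :=
  if P.isVertex then Finsupp.single (.inr k) 1 else 0

theorem sum_corner {M : Type*} [AddCommMonoid M] (f : Corner → M) :
    ∑ x, f x = f .north + (f .south + (f .west + f .east)) := by
  have : (Finset.univ : Finset Corner) = {.north, .south, .west, .east} := rfl
  rw [this]
  simp

/-! ### The coefficients for a single piece -/

section Local

variable {k a : ℕ} {s : Vertex →₀ ℕ} {H : GapPoly}

/-- The gap number `i` below a piece at position `a` of layer `k`. -/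
local notation:max "b_" i:max => (Sum.inl (k, a + i) : Vertex)

/-- The gap number `i` above a piece at position `a` of layer `k`. -/
local notation:max "t_" i:max => (Sum.inl (k + 1, a + i) : Vertex)

theorem coeff_crossing (hsb : ∀ i, s (.inl (k, i)) = 0) (hs₁ : ∀ v, s v ≤ 1)
    (hH : H ∈ above (k + 1)) (n r w e : RatFunc ℚ) (x y z : Bool) :
    coeff (Finsupp.single (b_ 0) 1 + (Finsupp.single (b_ 2) 1 + (Finsupp.single (b_ 1) 1 + s)))
      (bitX (b_ 0) x * (bitX (b_ 1) y * bitX (b_ 2) z) *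
        (C n * X (t_ 1) + (C r * X (b_ 1) + (C w * X (b_ 0) + C e * X (b_ 2)))) *
        ((X (b_ 0) + X (t_ 0)) * (X (b_ 2) + X (t_ 2))) * H) =
      ((crossingMoves n r w e x y z).map fun m =>
        m.1 * coeff s (rowPoly (k + 1) a m.2 * H)).sum := by
  have hC : ∀ (c : RatFunc ℚ) (v : Vertex), (C c : GapPoly) ∈ without v :=
    fun c v => Subalgebra.algebraMap_mem _ c
  have hHw : ∀ i, H ∈ without (b_ i) := fun i => above_le_without (by simp [height]) hH
  rw [show bitX (b_ 0) x * (bitX (b_ 1) y * bitX (b_ 2) z) *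
        (C n * X (t_ 1) + (C r * X (b_ 1) + (C w * X (b_ 0) + C e * X (b_ 2)))) *
        ((X (b_ 0) + X (t_ 0)) * (X (b_ 2) + X (t_ 2))) * H =
      (X (b_ 0) + X (t_ 0)) * (bitX (b_ 0) x *
        (bitX (b_ 1) y * bitX (b_ 2) z * (C n * X (t_ 1) + C r * X (b_ 1) + C e * X (b_ 2)) *
          (X (b_ 2) + X (t_ 2)) * H + X (b_ 0) *
          (bitX (b_ 1) y * bitX (b_ 2) z * C w * (X (b_ 2) + X (t_ 2)) * H))) by ring]
  rw [coeff_edge (by simp [hsb]) (by simp [hs₁]) (by simp)]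
  swap
  · refine mul_mem (mul_mem (mul_mem (mul_mem (bitX_mem _ ?_) (bitX_mem _ ?_)) (add_mem (add_mem
      (mul_mem (hC _ _) ?_) (mul_mem (hC _ _) ?_)) (mul_mem (hC _ _) ?_))) (add_mem ?_ ?_)) (hHw 0)
    all_goals exact X_mem_without (by simp)
  rw [show bitX (t_ 0) x * (bitX (b_ 1) y * bitX (b_ 2) z * (C n * X (t_ 1) + C r * X (b_ 1) +
        C e * X (b_ 2)) * (X (b_ 2) + X (t_ 2)) * H + X (t_ 0) *
          (bitX (b_ 1) y * bitX (b_ 2) z * C w * (X (b_ 2) + X (t_ 2)) * H)) =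
      (X (b_ 2) + X (t_ 2)) * (bitX (b_ 2) z *
        (bitX (t_ 0) x * bitX (b_ 1) y * (C n * X (t_ 1) + C r * X (b_ 1) + C w * X (t_ 0)) * H +
          X (b_ 2) * (bitX (t_ 0) x * bitX (b_ 1) y * C e * H))) by ring]
  rw [coeff_edge (by simp [hsb]) (by simp [hs₁]) (by simp)]
  swap
  · refine mul_mem (mul_mem (mul_mem (bitX_mem _ ?_) (bitX_mem _ ?_)) (add_mem (add_mem
      (mul_mem (hC _ _) ?_) (mul_mem (hC _ _) ?_)) (mul_mem (hC _ _) ?_))) (hHw 2)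
    all_goals exact X_mem_without (by simp)
  have hF : ∀ (c : RatFunc ℚ) (F : GapPoly), coeff s (C c * F) = c * coeff s F :=
    fun c F => coeff_C_mul _ _ _
  cases y
  · rw [show bitX (t_ 2) z * (bitX (t_ 0) x * bitX (b_ 1) false * (C n * X (t_ 1) +
          C r * X (b_ 1) + C w * X (t_ 0)) * H + X (t_ 2) *
          (bitX (t_ 0) x * bitX (b_ 1) false * C e * H)) =
        bitX (t_ 2) z * bitX (t_ 0) x * (C n * X (t_ 1) + C w * X (t_ 0) + C e * X (t_ 2)) * H +
          X (b_ 1) * (C r * (bitX (t_ 0) x * bitX (t_ 2) z * H)) +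
          X (b_ 1) * (X (b_ 1) * 0) by rw [bitX_false]; ring]
    rw [coeff_linear (hsb _)]
    · simp [crossingMoves, rowPoly, bitX_false, hF]
    · refine mul_mem (mul_mem (mul_mem (bitX_mem _ ?_) (bitX_mem _ ?_)) (add_mem (add_mem
        (mul_mem (hC _ _) ?_) (mul_mem (hC _ _) ?_)) (mul_mem (hC _ _) ?_))) (hHw 1)
      all_goals exact X_mem_without (by simp)
  · rw [show bitX (t_ 2) z * (bitX (t_ 0) x * bitX (b_ 1) true * (C n * X (t_ 1) +
          C r * X (b_ 1) + C w * X (t_ 0)) * H + X (t_ 2) *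
          (bitX (t_ 0) x * bitX (b_ 1) true * C e * H)) =
        0 + X (b_ 1) * (C n * (bitX (t_ 0) x * (X (t_ 1) * bitX (t_ 2) z) * H) +
            C w * (X (t_ 0) * (bitX (t_ 0) x * (bitX (t_ 2) z * H))) +
            C e * (X (t_ 2) * (bitX (t_ 2) z * (bitX (t_ 0) x * H)))) +
          X (b_ 1) * (X (b_ 1) * (C r * (bitX (t_ 0) x * bitX (t_ 2) z * H))) by
          rw [bitX_true]; ring]
    rw [coeff_linear (hsb _) (zero_mem _), coeff_add, coeff_add, hF, hF, hF]
    have e₁ : coeff s (X (t_ 0) * (bitX (t_ 0) x * (bitX (t_ 2) z * H))) =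
        if x then 0 else coeff s (X (t_ 0) * (bitX (t_ 2) z * H)) := by
      cases x
      · simp [bitX_false]
      · simp only [bitX_true, if_true]; exact coeff_sq_mul (hs₁ _) _
    have e₂ : coeff s (X (t_ 2) * (bitX (t_ 2) z * (bitX (t_ 0) x * H))) =
        if z then 0 else coeff s (X (t_ 2) * (bitX (t_ 0) x * H)) := by
      cases z
      · simp [bitX_false]
      · simp only [bitX_true, if_true]; exact coeff_sq_mul (hs₁ _) _
    rw [e₁, e₂]
    cases x <;> cases z <;>
      simp [crossingMoves, rowPoly, bitX_false, bitX_true, mul_left_comm, mul_assoc, add_assoc]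

theorem coeff_merge (hsb : ∀ i, s (.inl (k, i)) = 0) (hsz : s (.inr k) = 0) (hs₁ : ∀ v, s v ≤ 1)
    (hH : H ∈ above (k + 1)) (u w e u' w' e' : RatFunc ℚ) (x y z : Bool) :
    coeff (Finsupp.single (b_ 0) 1 + (Finsupp.single (b_ 2) 1 + (Finsupp.single (.inr k) 1 +
        (Finsupp.single (b_ 1) 1 + s))))
      (bitX (b_ 0) x * (bitX (b_ 1) y * bitX (b_ 2) z) *
        ((C u * X (.inr k) + (C w * X (b_ 0) + C e * X (b_ 1))) *
          (C u' * X (.inr k) + (C w' * X (b_ 1) + C e' * X (b_ 2)))) *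
        ((X (b_ 0) + X (t_ 0)) * (X (b_ 2) + X (t_ 1))) * H) =
      if y then (if x then 0 else u' * w * coeff s (rowPoly (k + 1) a [true, z] * H)) +
          (if z then 0 else u * e' * coeff s (rowPoly (k + 1) a [x, true] * H))
        else (u * w' + u' * e) * coeff s (rowPoly (k + 1) a [x, z] * H) := by
  have hC : ∀ (c : RatFunc ℚ) (v : Vertex), (C c : GapPoly) ∈ without v :=
    fun c v => Subalgebra.algebraMap_mem _ c
  have hHw : ∀ i, H ∈ without (b_ i) := fun i => above_le_without (by simp [height]) hH
  have hHz : H ∈ without (.inr k) := above_le_without (by simp [height]) hH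
  rw [show bitX (b_ 0) x * (bitX (b_ 1) y * bitX (b_ 2) z) *
        ((C u * X (.inr k) + (C w * X (b_ 0) + C e * X (b_ 1))) *
          (C u' * X (.inr k) + (C w' * X (b_ 1) + C e' * X (b_ 2)))) *
        ((X (b_ 0) + X (t_ 0)) * (X (b_ 2) + X (t_ 1))) * H =
      (X (b_ 0) + X (t_ 0)) * (bitX (b_ 0) x *
        (bitX (b_ 1) y * bitX (b_ 2) z * (C u * X (.inr k) + C e * X (b_ 1)) *
          (C u' * X (.inr k) + C w' * X (b_ 1) + C e' * X (b_ 2)) * (X (b_ 2) + X (t_ 1)) * H +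
        X (b_ 0) * (bitX (b_ 1) y * bitX (b_ 2) z * C w *
          (C u' * X (.inr k) + C w' * X (b_ 1) + C e' * X (b_ 2)) * (X (b_ 2) + X (t_ 1)) * H)))
      by ring]
  rw [coeff_edge (by simp [hsb]) (by simp [hs₁]) (by simp)]
  swap
  · refine mul_mem (mul_mem (mul_mem (mul_mem (mul_mem (bitX_mem _ ?_) (bitX_mem _ ?_)) (add_mem
      (mul_mem (hC _ _) ?_) (mul_mem (hC _ _) ?_))) (add_mem (add_mem (mul_mem (hC _ _) ?_)
      (mul_mem (hC _ _) ?_)) (mul_mem (hC _ _) ?_))) (add_mem ?_ ?_)) (hHw 0)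
    all_goals exact X_mem_without (by simp)
  rw [show bitX (t_ 0) x *
        (bitX (b_ 1) y * bitX (b_ 2) z * (C u * X (.inr k) + C e * X (b_ 1)) *
          (C u' * X (.inr k) + C w' * X (b_ 1) + C e' * X (b_ 2)) * (X (b_ 2) + X (t_ 1)) * H +
        X (t_ 0) * (bitX (b_ 1) y * bitX (b_ 2) z * C w *
          (C u' * X (.inr k) + C w' * X (b_ 1) + C e' * X (b_ 2)) * (X (b_ 2) + X (t_ 1)) * H)) =
      (X (b_ 2) + X (t_ 1)) * (bitX (b_ 2) z *
        (bitX (t_ 0) x * bitX (b_ 1) y * (C u * X (.inr k) + C e * X (b_ 1) + C w * X (t_ 0)) *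
          (C u' * X (.inr k) + C w' * X (b_ 1)) * H +
        X (b_ 2) * (bitX (t_ 0) x * bitX (b_ 1) y *
          (C u * X (.inr k) + C e * X (b_ 1) + C w * X (t_ 0)) * C e' * H))) by ring]
  rw [coeff_edge (by simp [hsb]) (by simp [hs₁]) (by simp)]
  swap
  · refine mul_mem (mul_mem (mul_mem (mul_mem (bitX_mem _ ?_) (bitX_mem _ ?_)) (add_mem (add_mem
      (mul_mem (hC _ _) ?_) (mul_mem (hC _ _) ?_)) (mul_mem (hC _ _) ?_)))
      (add_mem (mul_mem (hC _ _) ?_) (mul_mem (hC _ _) ?_))) (hHw 2)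
    all_goals exact X_mem_without (by simp)
  -- the coefficient of the circle region
  rw [show bitX (t_ 1) z *
        (bitX (t_ 0) x * bitX (b_ 1) y * (C u * X (.inr k) + C e * X (b_ 1) + C w * X (t_ 0)) *
          (C u' * X (.inr k) + C w' * X (b_ 1)) * H +
        X (t_ 1) * (bitX (t_ 0) x * bitX (b_ 1) y *
          (C u * X (.inr k) + C e * X (b_ 1) + C w * X (t_ 0)) * C e' * H)) =
      bitX (t_ 1) z * bitX (t_ 0) x * bitX (b_ 1) y * (C e * X (b_ 1) + C w * X (t_ 0)) *
          (C w' * X (b_ 1) + C e' * X (t_ 1)) * H +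
        X (.inr k) * (bitX (t_ 1) z * bitX (t_ 0) x * bitX (b_ 1) y *
          (C u * (C w' * X (b_ 1) + C e' * X (t_ 1)) +
            C u' * (C e * X (b_ 1) + C w * X (t_ 0))) * H) +
        X (.inr k) * (X (.inr k) * (bitX (t_ 1) z * bitX (t_ 0) x * bitX (b_ 1) y *
          (C u * C u') * H)) by ring]
  rw [coeff_linear (by simp [hsz])]
  swap
  · refine mul_mem (mul_mem (mul_mem (mul_mem (mul_mem (bitX_mem _ ?_) (bitX_mem _ ?_))
      (bitX_mem _ ?_)) (add_mem (mul_mem (hC _ _) ?_) (mul_mem (hC _ _) ?_)))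
      (add_mem (mul_mem (hC _ _) ?_) (mul_mem (hC _ _) ?_))) hHz
    all_goals exact X_mem_without (by simp)
  have hF : ∀ (c : RatFunc ℚ) (F : GapPoly), coeff s (C c * F) = c * coeff s F :=
    fun c F => coeff_C_mul _ _ _
  cases y
  · rw [show bitX (t_ 1) z * bitX (t_ 0) x * bitX (b_ 1) false *
          (C u * (C w' * X (b_ 1) + C e' * X (t_ 1)) +
            C u' * (C e * X (b_ 1) + C w * X (t_ 0))) * H =
        bitX (t_ 1) z * bitX (t_ 0) x * (C u * C e' * X (t_ 1) + C u' * C w * X (t_ 0)) * H +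
        X (b_ 1) * (C (u * w' + u' * e) * (bitX (t_ 0) x * bitX (t_ 1) z * H)) +
        X (b_ 1) * (X (b_ 1) * 0) by rw [bitX_false, C_add, C_mul, C_mul]; ring]
    rw [coeff_linear (hsb _)]
    · rw [hF]; simp [rowPoly, mul_assoc]
    · refine mul_mem (mul_mem (mul_mem (bitX_mem _ ?_) (bitX_mem _ ?_)) (add_mem
        (mul_mem (mul_mem (hC _ _) (hC _ _)) ?_) (mul_mem (mul_mem (hC _ _) (hC _ _)) ?_)))
        (hHw 1)
      all_goals exact X_mem_without (by simp)
  · rw [show bitX (t_ 1) z * bitX (t_ 0) x * bitX (b_ 1) true *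
          (C u * (C w' * X (b_ 1) + C e' * X (t_ 1)) +
            C u' * (C e * X (b_ 1) + C w * X (t_ 0))) * H =
        0 + X (b_ 1) * (C (u' * w) * (X (t_ 0) * (bitX (t_ 0) x * (bitX (t_ 1) z * H))) +
            C (u * e') * (X (t_ 1) * (bitX (t_ 1) z * (bitX (t_ 0) x * H)))) +
          X (b_ 1) * (X (b_ 1) * (C (u * w' + u' * e) * (bitX (t_ 0) x * bitX (t_ 1) z * H)))
          by rw [bitX_true, C_add, C_mul, C_mul, C_mul, C_mul]; ring]
    rw [coeff_linear (hsb _) (zero_mem _), coeff_add, hF, hF]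
    have e₁ : coeff s (X (t_ 0) * (bitX (t_ 0) x * (bitX (t_ 1) z * H))) =
        if x then 0 else coeff s (X (t_ 0) * (bitX (t_ 1) z * H)) := by
      cases x
      · simp [bitX_false]
      · simp only [bitX_true, if_true]; exact coeff_sq_mul (hs₁ _) _
    have e₂ : coeff s (X (t_ 1) * (bitX (t_ 1) z * (bitX (t_ 0) x * H))) =
        if z then 0 else coeff s (X (t_ 1) * (bitX (t_ 0) x * H)) := by
      cases z
      · simp [bitX_false]
      · simp only [bitX_true, if_true]; exact coeff_sq_mul (hs₁ _) _
    rw [e₁, e₂]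
    cases x <;> cases z <;>
      simp [rowPoly, bitX_false, bitX_true, mul_left_comm, mul_assoc]

theorem coeff_split (hsb : ∀ i, s (.inl (k, i)) = 0) (hsz : s (.inr k) = 0) (hs₁ : ∀ v, s v ≤ 1)
    (hH : H ∈ above (k + 1)) (u w e : RatFunc ℚ) (x z : Bool) :
    coeff (Finsupp.single (b_ 0) 1 + (Finsupp.single (b_ 1) 1 + (Finsupp.single (.inr k) 1 + s)))
      (bitX (b_ 0) x * bitX (b_ 1) z *
        (C u * X (.inr k) + (C w * X (b_ 0) + C e * X (b_ 1))) *
        ((X (b_ 0) + X (t_ 0)) * (X (b_ 1) + X (t_ 2))) * H) =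
      u * coeff s (rowPoly (k + 1) a [x, false, z] * H) := by
  have hC : ∀ (c : RatFunc ℚ) (v : Vertex), (C c : GapPoly) ∈ without v :=
    fun c v => Subalgebra.algebraMap_mem _ c
  have hHw : ∀ i, H ∈ without (b_ i) := fun i => above_le_without (by simp [height]) hH
  have hHz : H ∈ without (.inr k) := above_le_without (by simp [height]) hH
  rw [show bitX (b_ 0) x * bitX (b_ 1) z *
        (C u * X (.inr k) + (C w * X (b_ 0) + C e * X (b_ 1))) *
        ((X (b_ 0) + X (t_ 0)) * (X (b_ 1) + X (t_ 2))) * H =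
      (X (b_ 0) + X (t_ 0)) * (bitX (b_ 0) x *
        (bitX (b_ 1) z * (C u * X (.inr k) + C e * X (b_ 1)) * (X (b_ 1) + X (t_ 2)) * H +
        X (b_ 0) * (bitX (b_ 1) z * C w * (X (b_ 1) + X (t_ 2)) * H))) by ring]
  rw [coeff_edge (by simp [hsb]) (by simp [hs₁]) (by simp)]
  swap
  · refine mul_mem (mul_mem (mul_mem (bitX_mem _ ?_) (add_mem
      (mul_mem (hC _ _) ?_) (mul_mem (hC _ _) ?_))) (add_mem ?_ ?_)) (hHw 0)
    all_goals exact X_mem_without (by simp)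
  rw [show bitX (t_ 0) x *
        (bitX (b_ 1) z * (C u * X (.inr k) + C e * X (b_ 1)) * (X (b_ 1) + X (t_ 2)) * H +
        X (t_ 0) * (bitX (b_ 1) z * C w * (X (b_ 1) + X (t_ 2)) * H)) =
      (X (b_ 1) + X (t_ 2)) * (bitX (b_ 1) z *
        (bitX (t_ 0) x * (C u * X (.inr k) + C w * X (t_ 0)) * H +
        X (b_ 1) * (bitX (t_ 0) x * C e * H))) by ring]
  rw [coeff_edge (by simp [hsb]) (by simp [hs₁]) (by simp)]
  swap
  · refine mul_mem (mul_mem (bitX_mem _ ?_) (add_mem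
      (mul_mem (hC _ _) ?_) (mul_mem (hC _ _) ?_))) (hHw 1)
    all_goals exact X_mem_without (by simp)
  rw [show bitX (t_ 2) z * (bitX (t_ 0) x * (C u * X (.inr k) + C w * X (t_ 0)) * H +
        X (t_ 2) * (bitX (t_ 0) x * C e * H)) =
      bitX (t_ 2) z * bitX (t_ 0) x * (C w * X (t_ 0) + C e * X (t_ 2)) * H +
        X (.inr k) * (C u * (bitX (t_ 0) x * bitX (t_ 2) z * H)) +
        X (.inr k) * (X (.inr k) * 0) by ring]
  rw [coeff_linear (by simp [hsz]), coeff_C_mul]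
  · simp [rowPoly, bitX_false, add_assoc]
  · refine mul_mem (mul_mem (mul_mem (bitX_mem _ ?_) (bitX_mem _ ?_)) (add_mem
      (mul_mem (hC _ _) ?_) (mul_mem (hC _ _) ?_))) hHz
    all_goals exact X_mem_without (by simp)

theorem coeff_twist (hsb : ∀ i, s (.inl (k, i)) = 0) (hs₁ : ∀ v, s v ≤ 1)
    (hH : H ∈ above (k + 1)) (x z : Bool) :
    coeff (Finsupp.single (b_ 0) 1 + (Finsupp.single (b_ 1) 1 + s))
      (bitX (b_ 0) x * bitX (b_ 1) z *
        ((X (b_ 0) + X (t_ 0)) * (X (b_ 1) + X (t_ 1))) * H) =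
      coeff s (rowPoly (k + 1) a [x, z] * H) := by
  have hHw : ∀ i, H ∈ without (b_ i) := fun i => above_le_without (by simp [height]) hH
  rw [show bitX (b_ 0) x * bitX (b_ 1) z *
        ((X (b_ 0) + X (t_ 0)) * (X (b_ 1) + X (t_ 1))) * H =
      (X (b_ 0) + X (t_ 0)) * (bitX (b_ 0) x *
        ((X (b_ 1) + X (t_ 1)) * (bitX (b_ 1) z * H))) by ring]
  rw [coeff_edge' (by simp [hsb]) (by simp [hs₁]) (by simp), mul_left_comm, mul_left_comm
    (bitX (t_ 0) x), coeff_edge' (by simp [hsb]) (by simp [hs₁]) (by simp)]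
  · simp [rowPoly, mul_left_comm, mul_assoc]
  · refine mul_mem (bitX_mem _ ?_) (hHw 1)
    all_goals exact X_mem_without (by simp)
  · refine mul_mem (add_mem ?_ ?_) (mul_mem (bitX_mem _ ?_) (hHw 0))
    all_goals exact X_mem_without (by simp)

theorem coeff_cap (hsb : ∀ i, s (.inl (k, i)) = 0) (hs₁ : ∀ v, s v ≤ 1)
    (hH : H ∈ above (k + 1)) (x y z : Bool) :
    coeff (Finsupp.single (b_ 0) 1 + (Finsupp.single (b_ 2) 1 + (Finsupp.single (b_ 1) 1 + s)))
      (bitX (b_ 0) x * (bitX (b_ 1) y * bitX (b_ 2) z) *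
        ((X (b_ 0) + X (t_ 0)) * (X (b_ 2) + X (t_ 0))) * H) =
      if y then (if x && z then 0 else coeff s (rowPoly (k + 1) a [x || z] * H)) else 0 := by
  have hHw : ∀ i, H ∈ without (b_ i) := fun i => above_le_without (by simp [height]) hH
  rw [show bitX (b_ 0) x * (bitX (b_ 1) y * bitX (b_ 2) z) *
        ((X (b_ 0) + X (t_ 0)) * (X (b_ 2) + X (t_ 0))) * H =
      (X (b_ 0) + X (t_ 0)) * (bitX (b_ 0) x *
        ((X (b_ 2) + X (t_ 0)) * (bitX (b_ 2) z * (bitX (b_ 1) y * H)))) by ring]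
  rw [coeff_edge' (by simp [hsb]) (by simp [hs₁]) (by simp), mul_left_comm, mul_left_comm
    (bitX (t_ 0) x), coeff_edge' (by simp [hsb]) (by simp [hs₁]) (by simp)]
  · cases y
    · rw [show bitX (t_ 0) z * (bitX (t_ 0) x * (bitX (b_ 1) false * H)) =
        bitX (t_ 0) z * bitX (t_ 0) x * H + X (b_ 1) * 0 + X (b_ 1) * (X (b_ 1) * 0) by
        rw [bitX_false]; ring, coeff_linear (by simp [hsb])]
      · simp
      · refine mul_mem (mul_mem (bitX_mem _ ?_) (bitX_mem _ ?_)) (hHw 1)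
        all_goals exact X_mem_without (by simp)
    · rw [show bitX (t_ 0) z * (bitX (t_ 0) x * (bitX (b_ 1) true * H)) =
        0 + X (b_ 1) * (bitX (t_ 0) z * (bitX (t_ 0) x * H)) + X (b_ 1) * (X (b_ 1) * 0) by
        rw [bitX_true]; ring, coeff_linear (by simp [hsb]) (zero_mem _)]
      cases x <;> cases z <;> simp [rowPoly, bitX_true, bitX_false]
      exact coeff_sq_mul (hs₁ _) _
  · refine mul_mem (bitX_mem _ ?_) (mul_mem (bitX_mem _ ?_) (hHw 2))
    all_goals exact X_mem_without (by simp)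
  · refine mul_mem (add_mem ?_ ?_) (mul_mem (bitX_mem _ ?_) (mul_mem (bitX_mem _ ?_) (hHw 0)))
    all_goals exact X_mem_without (by simp)

theorem coeff_cup (hsb : ∀ i, s (.inl (k, i)) = 0) (hH : H ∈ above (k + 1)) (x : Bool) :
    coeff (Finsupp.single (b_ 0) 1 + s)
      (bitX (b_ 0) x * ((X (b_ 0) + X (t_ 0)) * (X (b_ 0) + X (t_ 2))) * H) =
      if x then coeff s (rowPoly (k + 1) a [true, false, true] * H) else
        coeff s (rowPoly (k + 1) a [true, false, false] * H) +
          coeff s (rowPoly (k + 1) a [false, false, true] * H) := by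
  have hHw : ∀ i, H ∈ without (b_ i) := fun i => above_le_without (by simp [height]) hH
  cases x
  · rw [show bitX (b_ 0) false * ((X (b_ 0) + X (t_ 0)) * (X (b_ 0) + X (t_ 2))) * H =
      X (t_ 0) * X (t_ 2) * H + X (b_ 0) * (X (t_ 0) * H + X (t_ 2) * H) +
        X (b_ 0) * (X (b_ 0) * H) by rw [bitX_false]; ring, coeff_linear (by simp [hsb])]
    · simp [rowPoly, bitX_true, bitX_false, add_assoc]
    · exact mul_mem (mul_mem (X_mem_without (by simp)) (X_mem_without (by simp))) (hHw 0)
  · rw [show bitX (b_ 0) true * ((X (b_ 0) + X (t_ 0)) * (X (b_ 0) + X (t_ 2))) * H =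
      0 + X (b_ 0) * (X (t_ 0) * X (t_ 2) * H) +
        X (b_ 0) * (X (b_ 0) * ((X (t_ 0) + X (t_ 2) + X (b_ 0)) * H)) by
      rw [bitX_true]; ring, coeff_linear (by simp [hsb]) (zero_mem _)]
    simp [rowPoly, bitX_true, bitX_false, add_assoc]

end Local

end

noncomputable section

open MvPolynomial

/-! ### Transfer operators are coefficient extractions -/

theorem cornerVertex_of_isVertex (k a c : ℕ) {P : Piece} (h : P.isVertex = true) :
    cornerVertex k a P c .north = .inr k ∧ cornerVertex k a P c .south = .inr k ∧
    cornerVertex k a P c .west = .inl (k, a + c) ∧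
    cornerVertex k a P c .east = .inl (k, a + c + 1) := by
  simp [cornerVertex, h]

theorem cornerVertex_of_not_isVertex (k a c : ℕ) {P : Piece} (h : P.isVertex = false) :
    cornerVertex k a P c .north = .inl (k + 1, a + 1) ∧
    cornerVertex k a P c .south = .inl (k, a + 1) ∧
    cornerVertex k a P c .west = .inl (k, a) ∧
    cornerVertex k a P c .east = .inl (k, a + 2) := by
  simp [cornerVertex, h]

theorem cornerPoly_eq (k a : ℕ) (P : Piece) : cornerPoly k a P =
    ∏ c ∈ Finset.range P.numCrossings, ∑ x, C (weight P c x) * X (cornerVertex k a P c x) :=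
  Fin.prod_univ_eq_prod_range (fun c => ∑ x, C (weight P c x) * X (cornerVertex k a P c x)) _

/-- To cover all gaps below a piece and its circle region exactly once amounts to applying the
transfer operator of the piece. The two edges join the outermost gaps next to the piece, on the
bottom and the top line of the layer. -/
theorem coeff_act (P : Piece) {k a : ℕ} {s : Vertex →₀ ℕ} {H : GapPoly}
    (hs : ∀ v, height v ≤ k → s v = 0) (hs₁ : ∀ v, s v ≤ 1) (hH : H ∈ above (k + 1))
    {m : List Bool} (hm : m.length = P.dom.length + 1) :
    coeff (rowExp k a (P.dom.length + 1) + (circleExp k P + s))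
      (rowPoly k a m * cornerPoly k a P *
        ((X (.inl (k, a)) + X (.inl (k + 1, a))) *
          (X (.inl (k, a + P.dom.length)) + X (.inl (k + 1, a + P.cod.length)))) * H) =
      act P (fun m' => coeff s (rowPoly (k + 1) a m' * H)) m := by
  have hsb : ∀ i, s (.inl (k, i)) = 0 := fun i => hs _ le_rfl
  have hsz : s (.inr k) = 0 := hs _ le_rfl
  cases P with
  | cup r =>
    obtain ⟨x, rfl⟩ : ∃ x, m = [x] := List.length_eq_one_iff.1 hm
    have key := coeff_cup (a := a) hsb hH x
    simp only [Piece.dom, Piece.cod, rowExp, circleExp, Piece.isVertex, cornerPoly_eq,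
      Piece.numCrossings, rowPoly, List.length_nil, List.length_cons] at key ⊢
    simp only [mul_one, Finset.range_zero, Finset.prod_empty,
      Nat.reduceAdd,
      Bool.false_eq_true, if_false, zero_add, add_zero] at key ⊢
    rw [key]
    cases x <;> simp [act, moves, rowPoly]
  | cap r =>
    obtain ⟨x, y, z, rfl⟩ : ∃ x y z, m = [x, y, z] := List.length_eq_three.1 hm
    have key := coeff_cap (a := a) hsb hs₁ hH x y z
    have e : (Finsupp.single (.inl (k, a)) 1 : Vertex →₀ ℕ) + (Finsupp.single (.inl (k, a + 1)) 1 +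
        (Finsupp.single (.inl (k, a + 2)) 1 + 0)) + (0 + s) =
        Finsupp.single (.inl (k, a + 0)) 1 + (Finsupp.single (.inl (k, a + 2)) 1 +
        (Finsupp.single (.inl (k, a + 1)) 1 + s)) := by
      rw [Nat.add_zero]; abel_nf
    simp only [Piece.dom, Piece.cod, rowExp, circleExp, Piece.isVertex, cornerPoly_eq,
      Piece.numCrossings, rowPoly, List.length_nil, List.length_cons] at key ⊢
    simp only [Nat.reduceAdd, mul_one, Finset.range_zero,
      Finset.prod_empty, Bool.false_eq_true, if_false, zero_add, add_zero, Nat.add_assoc]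
      at key e ⊢
    rw [e, key]
    cases x <;> cases y <;> cases z <;> simp [act, moves, rowPoly]
  | twist r b =>
    obtain ⟨x, z, rfl⟩ : ∃ x z, m = [x, z] := List.length_eq_two.1 hm
    have key := coeff_twist (a := a) hsb hs₁ hH x z
    simp only [Piece.dom, Piece.cod, rowExp, circleExp, Piece.isVertex, cornerPoly_eq,
      Piece.numCrossings, rowPoly, List.length_nil, List.length_cons] at key ⊢
    simp only [mul_one, Finset.range_zero,
      Finset.prod_empty, Bool.false_eq_true, if_false, zero_add, add_zero]
      at key ⊢
    rw [add_assoc, key]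
    simp [act, moves, rowPoly]
  | pos i j =>
    obtain ⟨x, y, z, rfl⟩ : ∃ x y z, m = [x, y, z] := List.length_eq_three.1 hm
    have key := coeff_crossing (a := a) hsb hs₁ hH (-tq (4 * i)) 1 (tq (4 * i)) 1 x y z
    have e : (Finsupp.single (.inl (k, a)) 1 : Vertex →₀ ℕ) + (Finsupp.single (.inl (k, a + 1)) 1 +
        (Finsupp.single (.inl (k, a + 2)) 1 + 0)) + (0 + s) =
        Finsupp.single (.inl (k, a + 0)) 1 + (Finsupp.single (.inl (k, a + 2)) 1 +
        (Finsupp.single (.inl (k, a + 1)) 1 + s)) := by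
      rw [Nat.add_zero]; abel_nf
    simp only [Piece.dom, Piece.cod, rowExp, circleExp, Piece.isVertex, cornerPoly_eq,
      Piece.numCrossings, rowPoly, List.length_nil, List.length_cons, Finset.prod_range_one,
      sum_corner, weight, cornerSign, cornerWeight,
      cornerVertex_of_not_isVertex (P := .pos i j) _ _ _ rfl, act, moves] at key ⊢
    simp only [Nat.reduceAdd, mul_one, one_mul, neg_mul,
      Bool.false_eq_true, if_false, zero_add, add_zero, Nat.add_assoc]
      at key e ⊢
    rw [e, key]
  | neg i j =>
    obtain ⟨x, y, z, rfl⟩ : ∃ x y z, m = [x, y, z] := List.length_eq_three.1 hm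
    have key := coeff_crossing (a := a) hsb hs₁ hH (-tq (-(4 * j))) 1 1 (tq (-(4 * j))) x y z
    have e : (Finsupp.single (.inl (k, a)) 1 : Vertex →₀ ℕ) + (Finsupp.single (.inl (k, a + 1)) 1 +
        (Finsupp.single (.inl (k, a + 2)) 1 + 0)) + (0 + s) =
        Finsupp.single (.inl (k, a + 0)) 1 + (Finsupp.single (.inl (k, a + 2)) 1 +
        (Finsupp.single (.inl (k, a + 1)) 1 + s)) := by
      rw [Nat.add_zero]; abel_nf
    simp only [Piece.dom, Piece.cod, rowExp, circleExp, Piece.isVertex, cornerPoly_eq,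
      Piece.numCrossings, rowPoly, List.length_nil, List.length_cons, Finset.prod_range_one,
      sum_corner, weight, cornerSign, cornerWeight,
      cornerVertex_of_not_isVertex (P := .neg i j) _ _ _ rfl, act, moves] at key ⊢
    simp only [Nat.reduceAdd, mul_one, one_mul, neg_mul,
      Bool.false_eq_true, if_false, zero_add, add_zero, Nat.add_assoc]
      at key e ⊢
    rw [e, key]
  | split i j =>
    obtain ⟨x, z, rfl⟩ : ∃ x z, m = [x, z] := List.length_eq_two.1 hm
    have key := coeff_split (a := a) hsb hsz hs₁ hH (brace (i + j)) (tq (2 * (i + j)))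
      (tq (-(2 * (i + j)))) x z
    simp only [Piece.dom, Piece.cod, rowExp, circleExp, Piece.isVertex, cornerPoly_eq,
      Piece.numCrossings, rowPoly, List.length_nil, List.length_cons, Finset.prod_range_one,
      sum_corner, weight, cornerSign, cornerWeight,
      cornerVertex_of_isVertex (P := .split i j) _ _ _ rfl, circleWeight, act, moves]
      at key ⊢
    simp only [Nat.reduceAdd, mul_one, one_mul,
      if_true, zero_add, add_zero, Nat.add_assoc, Nat.cast_add, map_zero, zero_mul, List.map_cons,
      List.map_nil, List.sum_cons, List.sum_nil, rowPoly] at key ⊢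
    rw [add_assoc, key]
  | merge i j =>
    obtain ⟨x, y, z, rfl⟩ : ∃ x y z, m = [x, y, z] := List.length_eq_three.1 hm
    have key := coeff_merge (a := a) hsb hsz hs₁ hH (brace i) (tq (2 * i)) (tq (-(2 * i)))
      (brace j) (tq (2 * j)) (tq (-(2 * j))) x y z
    have e : (Finsupp.single (.inl (k, a)) 1 : Vertex →₀ ℕ) + (Finsupp.single (.inl (k, a + 1)) 1 +
        (Finsupp.single (.inl (k, a + 2)) 1 + 0)) + (Finsupp.single (.inr k) 1 + s) =
        Finsupp.single (.inl (k, a + 0)) 1 + (Finsupp.single (.inl (k, a + 2)) 1 +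
        (Finsupp.single (.inr k) 1 + (Finsupp.single (.inl (k, a + 1)) 1 + s))) := by
      rw [Nat.add_zero]; abel_nf
    have hb : brace i * tq (2 * j) + brace j * tq (-(2 * i)) = brace (i + j) := by
      simp only [brace, mul_add, neg_add, tq_add]
      ring
    rw [hb] at key
    simp only [Piece.dom, Piece.cod, rowExp, circleExp, Piece.isVertex, cornerPoly_eq,
      Piece.numCrossings, rowPoly, List.length_nil, List.length_cons, Finset.prod_range_succ,
      Finset.prod_range_zero,
      sum_corner, weight, cornerSign, cornerWeight,
      cornerVertex_of_isVertex (P := .merge i j) _ _ _ rfl, circleWeight]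
      at key ⊢
    simp only [Nat.reduceAdd, mul_one, one_mul,
      if_true, zero_add, add_zero, Nat.add_assoc, map_zero, zero_mul] at key e ⊢
    rw [e, key]
    cases x <;> cases y <;> cases z <;>
      simp [act, moves, rowPoly, mul_comm, mul_assoc]

end

noncomputable section

open MvPolynomial

theorem rowExp_le_one (k p n : ℕ) (v : Vertex) : rowExp k p n v ≤ 1 := by
  rcases v with ⟨ℓ, g⟩ | j
  · rw [rowExp_inl]; split_ifs <;> simp
  · simp [rowExp_inr]

theorem circleExp_apply (k : ℕ) (P : Piece) (v : Vertex) :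
    circleExp k P v = if P.isVertex = true ∧ v = .inr k then 1 else 0 := by
  unfold circleExp
  split_ifs with h1 h2 h2
  · simp [h2.2]
  · rw [Finsupp.single_apply, if_neg]; exact fun h => h2 ⟨h1, h.symm⟩
  · exact absurd h2.1 h1
  · rfl

theorem C_mem (A : Subalgebra (RatFunc ℚ) GapPoly) (c : RatFunc ℚ) : (C c : GapPoly) ∈ A :=
  Subalgebra.algebraMap_mem A c

theorem cornerPoly_mem {A : Subalgebra (RatFunc ℚ) GapPoly} {k a : ℕ} {P : Piece}
    (h : ∀ c < P.numCrossings, ∀ x, X (cornerVertex k a P c x) ∈ A) : cornerPoly k a P ∈ A :=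
  prod_mem fun c _ => sum_mem fun x _ => mul_mem (C_mem _ _) (h c c.2 x)

/-- The gaps of the corners of a piece are next to the piece. -/
theorem cornerVertex_cases (k a : ℕ) (P : Piece) {c : ℕ} (hc : c < P.numCrossings) (x : Corner) :
    cornerVertex k a P c x = .inr k ∨
    (∃ i ≤ P.dom.length, cornerVertex k a P c x = .inl (k, a + i)) ∨
    ∃ i ≤ P.cod.length, cornerVertex k a P c x = .inl (k + 1, a + i) := by
  by_cases hv : P.isVertex = true
  · obtain ⟨h1, h2, h3, h4⟩ := cornerVertex_of_isVertex k a c hv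
    have hlt : c < P.dom.length := by
      cases P <;> simp_all [Piece.isVertex, Piece.numCrossings, Piece.dom]
    cases x
    · exact .inl h1
    · exact .inl h2
    · exact .inr (.inl ⟨c, hlt.le, h3⟩)
    · exact .inr (.inl ⟨c + 1, hlt, h4⟩)
  · obtain ⟨h1, h2, h3, h4⟩ := cornerVertex_of_not_isVertex k a c (by simpa using hv)
    have hlt : P.dom.length = 2 ∧ P.cod.length = 2 := by
      cases P <;> simp_all [Piece.isVertex, Piece.numCrossings, Piece.dom, Piece.cod]
    cases x
    · exact .inr (.inr ⟨1, by omega, h1⟩)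
    · exact .inr (.inl ⟨1, by omega, h2⟩)
    · exact .inr (.inl ⟨0, by omega, h3⟩)
    · exact .inr (.inl ⟨2, by omega, h4⟩)

theorem X_mem_above {k : ℕ} {v : Vertex} (h : k ≤ height v) : (X v : GapPoly) ∈ above k :=
  X_mem_supported.2 h

theorem layerPoly_mem (k : ℕ) (l : Layer) : layerPoly k l ∈ above k := by
  refine mul_mem (mul_mem (cornerPoly_mem fun c hc x => X_mem_above ?_)
    (strip_mem (fun i _ => X_mem_above ?_) fun i _ => X_mem_above ?_))
    (strip_mem (fun i _ => X_mem_above ?_) fun i _ => X_mem_above ?_)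
  · rcases cornerVertex_cases k l.left.length l.piece hc x with h | ⟨i, _, h⟩ | ⟨i, _, h⟩ <;>
      rw [h] <;> simp [height]
  all_goals simp [height]

/-- The exponents of the gaps on the bottom line of a layer and of its circle region. -/
def layerExp (k : ℕ) (l : Layer) : Vertex →₀ ℕ :=
  rowExp k 0 (l.source.length + 1) + circleExp k l.piece

theorem layerExp_of_height {k : ℕ} {l : Layer} {v : Vertex} (h : height v ≠ k) :
    layerExp k l v = 0 := by
  unfold layerExp
  rw [Finsupp.add_apply, circleExp_apply]
  rcases v with ⟨ℓ, g⟩ | j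
  · simp only [height] at h
    rw [rowExp_inl, if_neg (by tauto)]; simp
  · simp only [height] at h
    rw [rowExp_inr, if_neg (by simp [h])]

theorem layerExp_le_one (k : ℕ) (l : Layer) (v : Vertex) : layerExp k l v ≤ 1 := by
  unfold layerExp
  rw [Finsupp.add_apply, circleExp_apply]
  rcases v with ⟨ℓ, g⟩ | j
  · simpa using rowExp_le_one _ _ _ _
  · rw [rowExp_inr]; split_ifs <;> simp

/-- To cover all gaps on the bottom line of a layer, and its circle region, exactly once amounts to
applying the transfer operator of the layer. -/
theorem coeff_step (l : Layer) {k : ℕ} {s : Vertex →₀ ℕ} {G : GapPoly} {h : Cov}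
    (hs : ∀ v, height v ≤ k → s v = 0) (hs₁ : ∀ v, s v ≤ 1) (hG : G ∈ above (k + 1))
    (hh : ∀ I : List Bool, I.length = l.target.length + 1 →
      h I = coeff s (rowPoly (k + 1) 0 I * G))
    {I : List Bool} (hI : I.length = l.source.length + 1) :
    step l h I = coeff (layerExp k l + s) (rowPoly k 0 I * (layerPoly k l * G)) := by
  obtain ⟨A, m, D, rfl, hA, hm, hD⟩ := exists_split l hI
  have hkk : ∀ g, s (.inl (k, g)) = 0 := fun g => hs _ le_rfl
  rw [step_append l h hA hm]
  set a := l.left.length with ha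
  set d := l.piece.dom.length with hd
  set c := l.piece.cod.length with hc
  have hGw : ∀ g, G ∈ without (.inl (k, g)) := fun g => above_le_without (by simp [height]) hG
  have e : layerExp k l + s = rowExp k 0 A.length + (rowExp k (a + d + 1) D.length +
      (rowExp k a (d + 1) + (circleExp k l.piece + s))) := by
    rw [layerExp, l.length_source, ← ha, ← hd, ← hD,
      show a + d + D.length + 1 = A.length + ((d + 1) + D.length) by omega, rowExp_add, rowExp_add,
      zero_add, hA, show a + (d + 1) = a + d + 1 by omega]
    abel_nf
  have e' : rowPoly k 0 (A ++ m ++ D) * (layerPoly k l * G) =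
      rowPoly k 0 A * strip k 0 0 A.length * (rowPoly k (a + d + 1) D *
        strip k (a + d + 1) (a + c + 1) D.length *
        (rowPoly k a m * cornerPoly k a l.piece * ((X (.inl (k, a)) + X (.inl (k + 1, a))) *
          (X (.inl (k, a + d)) + X (.inl (k + 1, a + c)))) * G)) := by
    rw [rowPoly_append, rowPoly_append, layerPoly, strip_succ, strip, List.length_append, hm, ← hd,
      ← hc, ← ha, ← hD, hA, Nat.zero_add, Nat.zero_add]
    rw [show a + (d + 1) = a + d + 1 by omega]
    ring
  have hcov : ∀ i, i < a ∨ a + d + 1 ≤ i → ∀ x, x < l.piece.numCrossings → ∀ y,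
      cornerVertex k a l.piece x y ≠ .inl (k, i) := by
    intro i hi x hx y
    rcases cornerVertex_cases k a l.piece hx y with h | ⟨j, hj, h⟩ | ⟨j, _, h⟩ <;> rw [h]
    · simp
    · simp only [ne_eq, Sum.inl.injEq, Prod.mk.injEq, true_and]; omega
    · simp
  have hmid : ∀ i, i < a ∨ a + d + 1 ≤ i →
      rowPoly k a m * cornerPoly k a l.piece * ((X (.inl (k, a)) + X (.inl (k + 1, a))) *
        (X (.inl (k, a + d)) + X (.inl (k + 1, a + c)))) * G ∈ without (.inl (k, i)) := by
    intro i hi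
    refine mul_mem (mul_mem (mul_mem (rowPoly_mem fun j hj => X_mem_without ?_)
      (cornerPoly_mem fun x hx y => X_mem_without (hcov i hi x hx y)))
      (mul_mem (add_mem (X_mem_without ?_) (X_mem_without ?_))
      (add_mem (X_mem_without ?_) (X_mem_without ?_)))) (hGw i)
    all_goals simp
    all_goals omega
  rw [e, e', coeff_strip, mul_left_comm, coeff_strip (p' := a + c + 1)]
  · rw [show rowPoly (k + 1) (a + c + 1) D * (rowPoly (k + 1) 0 A * (rowPoly k a m *
      cornerPoly k a l.piece * ((X (.inl (k, a)) + X (.inl (k + 1, a))) *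
        (X (.inl (k, a + d)) + X (.inl (k + 1, a + c)))) * G)) =
      rowPoly k a m * cornerPoly k a l.piece * ((X (.inl (k, a)) + X (.inl (k + 1, a))) *
        (X (.inl (k, a + d)) + X (.inl (k + 1, a + c)))) *
        (rowPoly (k + 1) 0 A * rowPoly (k + 1) (a + c + 1) D * G) by ring]
    rw [coeff_act l.piece hs hs₁ _ hm]
    · apply act_congr
      intro m' hm'
      rw [hh _ (by rw [l.length_target]; simp; omega), rowPoly_append, rowPoly_append,
        List.length_append, hm', hA, Nat.zero_add, Nat.zero_add,
        show a + (l.piece.cod.length + 1) = a + c + 1 by omega]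
      congr 1; ring
    · refine mul_mem (mul_mem (rowPoly_mem fun i _ => X_mem_above ?_)
        (rowPoly_mem fun i _ => X_mem_above ?_)) hG
      all_goals simp [height]
  · intro g hg
    left
    simp only [Finsupp.add_apply, rowExp_inl, circleExp_apply, hkk] at hg
    by_contra hcon
    apply hg
    rw [if_neg (by omega)]; simp
  · intro v
    simp only [Finsupp.add_apply, circleExp_apply]
    rcases v with ⟨ℓ, g⟩ | j
    · rw [rowExp_inl]
      by_cases hl : ℓ = k
      · subst hl; rw [hkk]; split_ifs <;> simp_all
      · rw [if_neg (by tauto)]; simpa using hs₁ _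
    · rw [rowExp_inr]
      by_cases hl : j = k
      · subst hl; rw [hs _ le_rfl]; split_ifs <;> simp
      · rw [if_neg (by simp [hl])]; simpa using hs₁ _
  · intro i hi
    exact mul_mem (rowPoly_mem fun j _ => X_mem_without (by simp)) (hmid _ (by omega))
  · intro g hg
    right
    simp only [Finsupp.add_apply, rowExp_inl, circleExp_apply, hkk] at hg
    by_contra hcon
    apply hg
    rw [if_neg (by omega), if_neg (by omega)]; simp
  · intro v
    simp only [Finsupp.add_apply, circleExp_apply]
    rcases v with ⟨ℓ, g⟩ | j
    · rw [rowExp_inl, rowExp_inl]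
      by_cases hl : ℓ = k
      · subst hl; rw [hkk]; split_ifs <;> simp_all; omega
      · rw [if_neg (by tauto), if_neg (by tauto)]; simpa using hs₁ _
    · rw [rowExp_inr, rowExp_inr]
      by_cases hl : j = k
      · subst hl; rw [hs _ le_rfl]; split_ifs <;> simp
      · rw [if_neg (by simp [hl])]; simpa using hs₁ _
  · intro i hi
    refine mul_mem (mul_mem (rowPoly_mem fun j _ => X_mem_without ?_)
      (strip_mem (fun j _ => X_mem_without ?_) fun j _ => X_mem_without ?_)) (hmid _ (by omega))
    all_goals simp
    all_goals omega

/-- The product of the polynomials of consecutive layers, the first of which has the number `k`. -/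
def towerPoly : ℕ → List Layer → GapPoly
  | _, [] => 1
  | k, l :: w => layerPoly k l * towerPoly (k + 1) w

/-- The sum of the exponents of consecutive layers. -/
def towerExp : ℕ → List Layer → Vertex →₀ ℕ
  | _, [] => 0
  | k, l :: w => layerExp k l + towerExp (k + 1) w

theorem towerPoly_mem (k : ℕ) (w : List Layer) : towerPoly k w ∈ above k := by
  induction w generalizing k with
  | nil => exact one_mem _
  | cons l w ih => exact mul_mem (layerPoly_mem _ _) (above_anti (by omega) (ih (k + 1)))

theorem towerPoly_append (k : ℕ) (w w' : List Layer) :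
    towerPoly k (w ++ w') = towerPoly k w * towerPoly (k + w.length) w' := by
  induction w generalizing k with
  | nil => simp [towerPoly]
  | cons l w ih =>
    simp [towerPoly, ih, mul_assoc, Nat.add_comm w.length 1, Nat.add_assoc]

theorem towerExp_append (k : ℕ) (w w' : List Layer) :
    towerExp k (w ++ w') = towerExp k w + towerExp (k + w.length) w' := by
  induction w generalizing k with
  | nil => simp [towerExp]
  | cons l w ih =>
    simp [towerExp, ih, add_assoc, Nat.add_comm w.length 1]

theorem towerExp_of_lt {k : ℕ} {w : List Layer} {v : Vertex} (h : height v < k) :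
    towerExp k w v = 0 := by
  induction w generalizing k with
  | nil => rfl
  | cons l w ih =>
    rw [towerExp, Finsupp.add_apply, ih (by omega), layerExp_of_height (by omega)]

theorem towerExp_of_ge {k : ℕ} {w : List Layer} {v : Vertex} (h : k + w.length ≤ height v) :
    towerExp k w v = 0 := by
  induction w generalizing k with
  | nil => rfl
  | cons l w ih =>
    simp only [List.length_cons] at h
    rw [towerExp, Finsupp.add_apply, ih (by omega), layerExp_of_height (by omega)]

theorem towerExp_le_one (k : ℕ) (w : List Layer) (v : Vertex) : towerExp k w v ≤ 1 := by
  induction w generalizing k with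
  | nil => simp [towerExp]
  | cons l w ih =>
    rw [towerExp, Finsupp.add_apply]
    by_cases h : height v = k
    · rw [towerExp_of_lt (by omega)]; exact layerExp_le_one _ _ _
    · rw [layerExp_of_height h, zero_add]; exact ih _

/-- The transfer operator of a tangle extracts the coefficient for which all gaps of the tangle,
except those on its top line, and all circle regions are covered exactly once. -/
theorem coeff_sweep {S T : List Strand} {w : List Layer} (hw : IsTangle S w T) {k : ℕ}
    {s : Vertex →₀ ℕ} {G : GapPoly} {h : Cov}
    (hs : ∀ v, height v < k + w.length → s v = 0) (hs₁ : ∀ v, s v ≤ 1)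
    (hG : G ∈ above (k + w.length))
    (hh : ∀ I : List Bool, I.length = T.length + 1 →
      h I = coeff s (rowPoly (k + w.length) 0 I * G))
    {I : List Bool} (hI : I.length = S.length + 1) :
    sweep w h I = coeff (towerExp k w + s) (rowPoly k 0 I * (towerPoly k w * G)) := by
  induction w generalizing S k I with
  | nil => cases hw; simpa [towerExp, towerPoly, sweep] using hh I hI
  | cons l w ih =>
    obtain ⟨rfl, hw⟩ := hw
    simp only [List.length_cons] at hs hG hh
    rw [show k + (w.length + 1) = k + 1 + w.length by omega] at hs hG hh
    rw [sweep_cons, coeff_step l (s := towerExp (k + 1) w + s) (G := towerPoly (k + 1) w * G)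
      _ _ _ (fun J hJ => ih hw hs hG hh hJ) hI]
    · rw [towerExp, towerPoly, add_assoc, mul_assoc]
    · intro v hv
      rw [Finsupp.add_apply, towerExp_of_lt (by omega), hs v (by omega)]
    · intro v
      rw [Finsupp.add_apply]
      by_cases h : height v < k + 1 + w.length
      · rw [hs v h]; exact towerExp_le_one _ _ _
      · rw [towerExp_of_ge (by omega), zero_add]; exact hs₁ v
    · exact mul_mem (towerPoly_mem _ _) (above_anti (by omega) hG)

/-- To mark two gaps is to multiply with their variables. -/
theorem mark_eq_coeff {k q p : ℕ} {s : Vertex →₀ ℕ} {G : GapPoly} {h : Cov}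
    (hs₁ : ∀ v, s v ≤ 1) {n : ℕ}
    (hh : ∀ I : List Bool, I.length = n → h I = coeff s (rowPoly k q I * G))
    {I : List Bool} (hI : I.length = n) (hp : p + 1 < n) :
    mark p h I = coeff s (rowPoly k q I * (X (.inl (k, q + p)) * X (.inl (k, q + p + 1)) * G)) := by
  induction p generalizing q n h G I with
  | zero =>
    obtain ⟨x, y, I, rfl⟩ : ∃ x y J, I = x :: y :: J := by
      match I with
      | [] => simp at hI; omega
      | [_] => simp at hI; omega
      | x :: y :: J => exact ⟨x, y, J, rfl⟩
    have sq : ∀ v (F : GapPoly), coeff s (X v * (X v * F)) = 0 := fun v F => coeff_sq_mul (hs₁ v) F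
    cases x
    · cases y
      · simp only [mark, Nat.add_zero]
        rw [hh _ (by simpa using hI)]
        simp only [rowPoly, bitX_true, bitX_false]
        congr 1; ring
      · simp only [mark, rowPoly, bitX_true, bitX_false, Nat.add_zero]
        rw [← sq (.inl (k, q + 1)) (rowPoly k (q + 1 + 1) I * (X (.inl (k, q)) * G))]
        congr 1; ring
    · simp only [mark, rowPoly, bitX_true, Nat.add_zero]
      rw [← sq (.inl (k, q)) (bitX (Sum.inl (k, q + 1)) y * rowPoly k (q + 1 + 1) I *
        (X (.inl (k, q + 1)) * G))]
      congr 1; ring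
  | succ p ih =>
    obtain ⟨x, I, rfl⟩ : ∃ x J, I = x :: J := by
      match I with
      | [] => simp at hI; omega
      | x :: J => exact ⟨x, J, rfl⟩
    simp only [mark, rowPoly]
    obtain ⟨n, rfl⟩ : ∃ n', n = n' + 1 := ⟨n - 1, by omega⟩
    rw [ih (q := q + 1) (n := n) (G := bitX (.inl (k, q)) x * G)]
    · rw [show q + 1 + p = q + (p + 1) by omega]; congr 1; ring
    · intro J hJ
      rw [hh _ (by simp [hJ])]
      simp only [rowPoly]; congr 1; ring
    · simpa using hI
    · omega

/-- The final covector requires that all gaps below the final maximum are covered. -/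
theorem fin_eq_coeff (k : ℕ) {I : List Bool} (hI : I.length = 3) :
    fin I = coeff (rowExp k 0 3) (rowPoly k 0 I) := by
  obtain ⟨x, y, z, rfl⟩ := List.length_eq_three.1 hI
  have hX : ∀ (b : Bool) (v : Vertex), bitX v b = monomial (if b then Finsupp.single v 1 else 0) 1 := by
    intro b v; cases b
    · simp [bitX]
    · simp [bitX, X]
  simp only [rowPoly, hX, monomial_mul, mul_one, coeff_monomial, fin, Nat.zero_add, Nat.reduceAdd]
  have : ([x, y, z] = [true, true, true]) ↔ ((if x then Finsupp.single (.inl (k, 0)) 1 else 0) +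
      ((if y then Finsupp.single (.inl (k, 1)) 1 else 0) +
      (if z then Finsupp.single (.inl (k, 2)) 1 else 0)) : Vertex →₀ ℕ) = rowExp k 0 3 := by
    constructor
    · rintro h
      simp only [List.cons.injEq, and_true] at h
      simp [h, rowExp]
    · intro h
      have h0 := DFunLike.congr_fun h (.inl (k, 0))
      have h1 := DFunLike.congr_fun h (.inl (k, 1))
      have h2 := DFunLike.congr_fun h (.inl (k, 2))
      simp only [Finsupp.add_apply, rowExp_inl] at h0 h1 h2
      clear h hX
      cases x <;> cases y <;> cases z <;> simp_all
  simp [this]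

end

noncomputable section

/-! ### The regions of a connected diagram are trees -/

/-- The vertical edges between the gaps of consecutive lines: in every layer, one for each gap on
the left of the piece and one for each gap on the right of it. -/
abbrev GapEdge (u : List Layer) :=
  (k : Fin u.length) × (Fin (u[k].left.length + 1) ⊕ Fin (u[k].right.length + 1))

/-- The lower end of a vertical edge. -/
def edgeBot (u : List Layer) : GapEdge u → Vertex
  | ⟨k, .inl g⟩ => .inl (k, g)
  | ⟨k, .inr r⟩ => .inl (k, u[k].left.length + u[k].piece.dom.length + r)

/-- The upper end of a vertical edge. -/
def edgeTop (u : List Layer) : GapEdge u → Vertex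
  | ⟨k, .inl g⟩ => .inl (k + 1, g)
  | ⟨k, .inr r⟩ => .inl (k + 1, u[k].left.length + u[k].piece.cod.length + r)

/-- The indicator function of the gaps `(ℓ, 0)`, …, `(ℓ, p)`. -/
def initial (ℓ p : ℕ) : Vertex → ℚ
  | .inl x => if x.1 = ℓ ∧ x.2 ≤ p then 1 else 0
  | .inr _ => 0

theorem eq_zero_of_partial_sums {n : ℕ} {f : Fin n → ℚ}
    (h : ∀ p < n, ∑ i, (if i.val ≤ p then f i else 0) = 0) : f = 0 := by
  induction n with
  | zero => exact Subsingleton.elim _ _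
  | succ n ih =>
    have h1 : (fun i : Fin n => f i.castSucc) = 0 := by
      apply ih
      intro p hp
      have := h p (by omega)
      rw [Fin.sum_univ_castSucc] at this
      simpa [show ¬ n ≤ p by omega] using this
    funext i
    refine Fin.lastCases ?_ (fun i => congrFun h1 i) i
    have := h n (by omega)
    rw [Fin.sum_univ_castSucc] at this
    simp only [Fin.val_castSucc, Fin.val_last, le_refl, if_true] at this
    have h2 : ∑ i : Fin n, (if i.val ≤ n then f i.castSucc else 0) = 0 :=
      Finset.sum_eq_zero fun i _ => by
        have := congrFun h1 i
        simp only [Pi.zero_apply] at this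
        rw [this]; simp
    rw [h2, zero_add] at this
    exact this

theorem eq_zero_of_partial_sums₂ {a R δ : ℕ} (hδ : 0 < δ) {f : Fin (a + 1) → ℚ}
    {f' : Fin (R + 1) → ℚ} (h : ∀ p, ∑ i, (if i.val ≤ p then f i else 0) +
      ∑ i, (if a + δ + i.val ≤ p then f' i else 0) = 0) : f = 0 ∧ f' = 0 := by
  have h1 : f = 0 := by
    apply eq_zero_of_partial_sums
    intro p hp
    have h2 := h p
    have h3 : ∑ i : Fin (R + 1), (if a + δ + i.val ≤ p then f' i else 0) = 0 :=
      Finset.sum_eq_zero fun i _ => if_neg (by omega)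
    rwa [h3, add_zero] at h2
  refine ⟨h1, eq_zero_of_partial_sums fun p hp => ?_⟩
  have h2 := h (a + δ + p)
  rw [h1] at h2
  simpa using h2

section

variable {u : List Layer} (m : GapEdge u → ℚ)

theorem sum_initial_bot (k : Fin u.length) (p : ℕ) :
    ∑ e, m e * initial k p (edgeBot u e) =
      ∑ i, (if i.val ≤ p then m ⟨k, .inl i⟩ else 0) +
      ∑ i, (if u[k].left.length + u[k].piece.dom.length + i.val ≤ p
        then m ⟨k, .inr i⟩ else 0) := by
  rw [Fintype.sum_sigma, Finset.sum_eq_single k]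
  · rw [Fintype.sum_sum_type]
    simp [edgeBot, initial]
  · intro j _ hj
    rw [Fintype.sum_sum_type]
    have : (j : ℕ) ≠ k := fun h => hj (Fin.ext h)
    simp [edgeBot, initial, this]
  · simp

theorem sum_initial_top (k : Fin u.length) (p : ℕ) :
    ∑ e, m e * initial (k + 1) p (edgeTop u e) =
      ∑ i, (if i.val ≤ p then m ⟨k, .inl i⟩ else 0) +
      ∑ i, (if u[k].left.length + u[k].piece.cod.length + i.val ≤ p
        then m ⟨k, .inr i⟩ else 0) := by
  rw [Fintype.sum_sigma, Finset.sum_eq_single k]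
  · rw [Fintype.sum_sum_type]
    simp [edgeTop, initial]
  · intro j _ hj
    rw [Fintype.sum_sum_type]
    have : (j : ℕ) ≠ k := fun h => hj (Fin.ext h)
    simp [edgeTop, initial, this]
  · simp

theorem sum_initial_bot_of_le {ℓ : ℕ} (h : u.length ≤ ℓ) (p : ℕ) :
    ∑ e, m e * initial ℓ p (edgeBot u e) = 0 := by
  refine Finset.sum_eq_zero fun e _ => ?_
  obtain ⟨k, g | r⟩ := e
  · have : (k : ℕ) ≠ ℓ := by omega
    simp [edgeBot, initial, this]
  · have : (k : ℕ) ≠ ℓ := by omega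
    simp [edgeBot, initial, this]

theorem sum_initial_top_zero (p : ℕ) : ∑ e, m e * initial 0 p (edgeTop u e) = 0 := by
  refine Finset.sum_eq_zero fun e _ => ?_
  obtain ⟨k, g | r⟩ := e <;> simp [edgeTop, initial]

end

theorem Piece.dom_or_cod (P : Piece) : 0 < P.dom.length ∨ 0 < P.cod.length := by
  cases P <;> simp [Piece.dom, Piece.cod]

/-- The gaps of a connected diagram, joined by vertical edges, form a forest. For a flow without
sources and sinks, let `N ℓ p` be the flow upwards through the gaps `(ℓ, 0)`, …, `(ℓ, p)`. This
stream function is constant on the components of the diagram, it vanishes at the final maximum, and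
its differences determine the flow. -/
theorem isForest_gapEdge {u : List Layer} {s : Strand}
    (hw : IsTangle [] (u ++ [⟨[], .cap s, []⟩]) [])
    (hc : MOY.IsConnected (u ++ [⟨[], .cap s, []⟩])) :
    IsForest Finset.univ (edgeBot u) (edgeTop u) := by
  intro m hm
  set w := u ++ [⟨[], .cap s, []⟩] with hwdef
  set N : ℕ → ℕ → ℚ := fun ℓ p => ∑ e, m e * initial ℓ p (edgeBot u e) with hN
  have hNtop : ∀ ℓ p, ∑ e, m e * initial ℓ p (edgeTop u e) = N ℓ p := by
    intro ℓ p
    have := hm (initial ℓ p)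
    simp only [mul_sub, Finset.sum_sub_distrib] at this
    simp only [hN]; linarith
  have hbot : ∀ (k : Fin u.length) p, N k p =
      ∑ i, (if i.val ≤ p then m ⟨k, .inl i⟩ else 0) +
      ∑ i, (if u[k].left.length + u[k].piece.dom.length + i.val ≤ p
        then m ⟨k, .inr i⟩ else 0) := fun k p => sum_initial_bot m k p
  have htop : ∀ (k : Fin u.length) p, N (k + 1) p =
      ∑ i, (if i.val ≤ p then m ⟨k, .inl i⟩ else 0) +
      ∑ i, (if u[k].left.length + u[k].piece.cod.length + i.val ≤ p
        then m ⟨k, .inr i⟩ else 0) := fun k p => by rw [← hNtop]; exact sum_initial_top m k p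
  have hlast : ∀ p, N u.length p = 0 := fun p => sum_initial_bot_of_le m le_rfl p
  have hwl : w.length = u.length + 1 := by simp [hwdef]
  have hget : ∀ (k : ℕ) (hk : k < u.length), w[k]'(by omega) = u[k] := fun k hk =>
    List.getElem_append_left hk
  have hgetl : w[u.length]'(by omega) = ⟨[], .cap s, []⟩ := by simp [hwdef]
  -- the flow through the gaps on the left of a point is the same for all points of a component
  have hstep : ∀ x y, PointStep w x y → N x.1 x.2 = N y.1 y.2 := by
    intro x y hxy
    have hbt : ∀ (k : ℕ) (hk : k < u.length) p q,
        (∀ i, i ≤ u[k].left.length → (i ≤ p ↔ i ≤ q)) →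
        (∀ i, u[k].left.length + u[k].piece.dom.length + i ≤ p ↔
          u[k].left.length + u[k].piece.cod.length + i ≤ q) → N k p = N (k + 1) q := by
      intro k hk p q h1 h2
      rw [hbot ⟨k, hk⟩, htop ⟨k, hk⟩]
      congr 1
      · exact Finset.sum_congr rfl fun i _ => if_congr (h1 _ (Nat.lt_succ_iff.1 i.2)) rfl rfl
      · exact Finset.sum_congr rfl fun i _ => if_congr (h2 _) rfl rfl
    cases hxy with
    | left k p hp =>
      obtain ⟨k, hk⟩ := k
      simp only [Fin.getElem_fin] at hp ⊢
      rcases Nat.lt_succ_iff_lt_or_eq.1 (hwl ▸ hk) with hk' | rfl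
      · rw [hget k hk'] at hp
        exact hbt k hk' p p (fun i _ => Iff.rfl) fun i => by omega
      · simp [hgetl] at hp
    | right k r hr =>
      obtain ⟨k, hk⟩ := k
      simp only [Fin.getElem_fin] at hr ⊢
      rcases Nat.lt_succ_iff_lt_or_eq.1 (hwl ▸ hk) with hk' | rfl
      · simp only [hget k hk'] at hr ⊢
        exact hbt k hk' _ _ (fun i _ => by omega) fun i => by omega
      · simp [hgetl] at hr
    | bottom k p q hp hq =>
      obtain ⟨k, hk⟩ := k
      simp only [Fin.getElem_fin] at hp hq ⊢
      rcases Nat.lt_succ_iff_lt_or_eq.1 (hwl ▸ hk) with hk' | rfl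
      · simp only [hget k hk'] at hp hq ⊢
        rw [hbot ⟨k, hk'⟩, hbot ⟨k, hk'⟩]
        congr 1
        · exact Finset.sum_congr rfl fun i _ => if_congr (by
            have := i.2; simp only [Fin.getElem_fin] at this; omega) rfl rfl
        · exact Finset.sum_congr rfl fun i _ => if_congr (by
            simp only [Fin.getElem_fin]; omega) rfl rfl
      · rw [hlast, hlast]
    | top k p q hp hq =>
      obtain ⟨k, hk⟩ := k
      simp only [Fin.getElem_fin] at hp hq ⊢
      rcases Nat.lt_succ_iff_lt_or_eq.1 (hwl ▸ hk) with hk' | rfl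
      · simp only [hget k hk'] at hp hq ⊢
        rw [htop ⟨k, hk'⟩, htop ⟨k, hk'⟩]
        congr 1
        · exact Finset.sum_congr rfl fun i _ => if_congr (by
            have := i.2; simp only [Fin.getElem_fin] at this; omega) rfl rfl
        · exact Finset.sum_congr rfl fun i _ => if_congr (by
            simp only [Fin.getElem_fin]; omega) rfl rfl
      · simp [hgetl, Piece.cod] at hp
    | through k p q hp hq =>
      obtain ⟨k, hk⟩ := k
      simp only [Fin.getElem_fin] at hp hq ⊢
      rcases Nat.lt_succ_iff_lt_or_eq.1 (hwl ▸ hk) with hk' | rfl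
      · simp only [hget k hk'] at hp hq ⊢
        exact hbt k hk' _ _ (fun i _ => by omega) fun i => by omega
      · simp [hgetl, Piece.cod] at hq
  have hlastS : strandsAt w u.length = [s, s.rev] := by
    rw [← source_eq_strandsAt hw (by omega : u.length < w.length), hgetl]
    simp [Layer.source, Piece.dom]
  have hpoint : ∀ x, IsPoint w x → N x.1 x.2 = 0 := by
    intro x hx
    have h0 : IsPoint w (u.length, 0) := by simp [IsPoint, hlastS]
    have h := hc x _ hx h0
    have hinv : ∀ x y, Relation.EqvGen (PointStep w) x y → N x.1 x.2 = N y.1 y.2 := by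
      intro x y h
      induction h with
      | rel _ _ h => exact hstep _ _ h
      | refl => rfl
      | symm _ _ _ ih => exact ih.symm
      | trans _ _ _ _ _ ih ih' => exact ih.trans ih'
    rw [hinv _ _ h, hlast]
  have htotal : ∀ k p, (strandsAt w k).length ≤ p → N k p = 0 := by
    intro k
    induction k with
    | zero => intro p _; rw [← hNtop, sum_initial_top_zero]
    | succ k ih =>
      intro p hp
      by_cases hk : k < u.length
      · rw [← ih _ le_rfl, hbot ⟨k, hk⟩, htop ⟨k, hk⟩]
        have hk' : k < w.length := by omega
        rw [← target_eq_strandsAt w hk', Layer.length_target, hget k hk] at hp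
        have h1 := w[k].length_source
        rw [source_eq_strandsAt hw hk', hget k hk] at h1
        rw [h1]
        congr 1
        · exact Finset.sum_congr rfl fun i _ => if_congr (by
            have := i.2; simp only [Fin.getElem_fin] at this; omega) rfl rfl
        · exact Finset.sum_congr rfl fun i _ => if_congr (by
            have := i.2; simp only [Fin.getElem_fin] at this ⊢; omega) rfl rfl
      · exact sum_initial_bot_of_le m (by omega) p
  have hzero : ∀ k p, N k p = 0 := by
    intro k p
    by_cases h : p < (strandsAt w k).length
    · exact hpoint (k, p) h
    · exact htotal k p (by omega)
  rintro ⟨k, e⟩ -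
  have key : (fun i => m ⟨k, .inl i⟩) = 0 ∧ (fun i => m ⟨k, .inr i⟩) = 0 := by
    rcases u[k].piece.dom_or_cod with hd | hd
    · exact eq_zero_of_partial_sums₂ hd fun p => (hbot k p).symm.trans (hzero _ _)
    · exact eq_zero_of_partial_sums₂ hd fun p => (htop k p).symm.trans (hzero _ _)
  rcases e with i | i
  · exact congrFun key.1 i
  · exact congrFun key.2 i

end

noncomputable section

open MvPolynomial

/-! ### The state sum as a transfer amplitude -/

/-- The amplitude is the coefficient of the polynomial of the whole diagram for which all gaps and
circle regions are covered exactly once. (The gap above the final maximum is omitted.) -/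
theorem amp_eq_coeff {u : List Layer} {s : Strand} (hw : IsTangle [] (u ++ [⟨[], .cap s, []⟩]) [])
    {x : ℕ × ℕ} (hx : IsPoint (u ++ [⟨[], .cap s, []⟩]) x) :
    amp (u ++ [⟨[], .cap s, []⟩]) x =
      coeff (towerExp 0 u + rowExp u.length 0 3)
        (towerPoly 0 u * (X (.inl x) * X (.inl (x.1, x.2 + 1)))) := by
  obtain ⟨ℓ, p⟩ := x
  have hlt := hx.lt hw
  set w := u ++ [⟨[], .cap s, []⟩] with hwdef
  have hwl' : w.length = u.length + 1 := by simp [hwdef]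
  simp only [hwl'] at hlt
  replace hx : p < (strandsAt w ℓ).length := hx
  have hℓ : ℓ ≤ u.length := by omega
  have htake : w.take ℓ = u.take ℓ := by rw [hwdef, List.take_append_of_le_length hℓ]
  have hdrop : w.drop ℓ = u.drop ℓ ++ [⟨[], .cap s, []⟩] := by
    rw [hwdef, List.drop_append_of_le_length hℓ]
  have hwl : ℓ ≤ w.length := by simp [hwdef]; omega
  have t₁ := isTangle_take hw hwl
  have t₂ := isTangle_drop hw hwl
  rw [htake] at t₁
  rw [hdrop] at t₂
  obtain ⟨u', s', he, t₂⟩ := exists_last t₂ (by simp)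
  obtain ⟨rfl, -⟩ := List.append_inj' he rfl
  have hlen₁ : (u.take ℓ).length = ℓ := by simp [hℓ]
  have hlen₂ : ℓ + (u.drop ℓ).length = u.length := by rw [List.length_drop]; omega
  have hup : ∀ I : List Bool, I.length = (strandsAt w ℓ).length + 1 →
      upper (w.drop ℓ) I = coeff (towerExp ℓ (u.drop ℓ) + rowExp u.length 0 3)
        (rowPoly ℓ 0 I * towerPoly ℓ (u.drop ℓ)) := by
    intro I hI
    rw [upper, hdrop, List.dropLast_concat,
      coeff_sweep t₂ (k := ℓ) (s := rowExp u.length 0 3) (G := 1) _ (rowExp_le_one _ _ _)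
        (one_mem _) _ hI, mul_one]
    · rintro (⟨a, g⟩ | j) hv
      · rw [hlen₂] at hv
        simp only [height] at hv
        rw [rowExp_inl, if_neg (by omega)]
      · exact rowExp_inr _ _ _ _
    · intro J hJ
      rw [mul_one, hlen₂]
      exact fin_eq_coeff _ (by simpa using hJ)
  have hs₁ : ∀ v, (towerExp ℓ (u.drop ℓ) + rowExp u.length 0 3) v ≤ 1 := by
    intro v
    rw [Finsupp.add_apply]
    by_cases h : height v < u.length
    · have : rowExp u.length 0 3 v = 0 := by
        rcases v with ⟨a, g⟩ | j
        · simp only [height] at h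
          rw [rowExp_inl, if_neg (by omega)]
        · exact rowExp_inr _ _ _ _
      rw [this]; exact towerExp_le_one _ _ _
    · rw [towerExp_of_ge (by omega), zero_add]; exact rowExp_le_one _ _ _ _
  have hmark : ∀ I : List Bool, I.length = (strandsAt w ℓ).length + 1 →
      mark p (upper (w.drop ℓ)) I = coeff (towerExp ℓ (u.drop ℓ) + rowExp u.length 0 3)
        (rowPoly ℓ 0 I * (X (.inl (ℓ, p)) * X (.inl (ℓ, p + 1)) * towerPoly ℓ (u.drop ℓ))) := by
    intro I hI
    rw [mark_eq_coeff hs₁ hup hI (by omega), Nat.zero_add]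
  rw [amp, htake, coeff_sweep t₁ (k := 0) (s := towerExp ℓ (u.drop ℓ) + rowExp u.length 0 3)
    (G := X (.inl (ℓ, p)) * X (.inl (ℓ, p + 1)) * towerPoly ℓ (u.drop ℓ)) _ hs₁ _ _ rfl]
  · conv_rhs => rw [← List.take_append_drop ℓ u]
    rw [towerExp_append, towerPoly_append, hlen₁, Nat.zero_add, List.take_append_drop, add_assoc]
    congr 1
    simp only [rowPoly, bitX_false]
    ring
  · intro v hv
    rw [hlen₁, Nat.zero_add] at hv
    rw [Finsupp.add_apply, towerExp_of_lt hv, zero_add]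
    rcases v with ⟨a, g⟩ | j
    · simp only [height] at hv
      rw [rowExp_inl, if_neg (by omega)]
    · exact rowExp_inr _ _ _ _
  · rw [hlen₁, Nat.zero_add]
    exact mul_mem (mul_mem (X_mem_above (by simp [height])) (X_mem_above (by simp [height])))
      (towerPoly_mem _ _)
  · intro I hI
    rw [hlen₁, Nat.zero_add]
    exact hmark I hI

theorem strip_eq_prod (k p p' n : ℕ) : strip k p p' n =
    ∏ i : Fin n, (X (.inl (k, p + i)) + X (.inl (k + 1, p' + i))) := by
  induction n with
  | zero => simp [strip]
  | succ n ih => rw [strip_succ, ih, Fin.prod_univ_castSucc]; rfl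

theorem towerPoly_eq_prod (j : ℕ) (u : List Layer) :
    towerPoly j u = ∏ k : Fin u.length, layerPoly (j + k) u[k] := by
  induction u generalizing j with
  | nil => simp [towerPoly]
  | cons l u ih =>
    rw [towerPoly, ih]
    change _ = ∏ k : Fin (u.length + 1), layerPoly (j + k) ((l :: u)[k.val])
    rw [Fin.prod_univ_succ]
    refine congrArg₂ _ rfl (Finset.prod_congr rfl fun k _ => ?_)
    rw [show j + 1 + (k : ℕ) = j + k.succ by simp; omega]
    rfl

/-- The polynomial of a diagram is a sum over the choices of corners times a sum over the choices of
ends of the vertical edges. -/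
theorem towerPoly_eq (u : List Layer) : towerPoly 0 u =
    (∏ k : Fin u.length, cornerPoly k u[k].left.length u[k].piece) *
      ∏ e, (X (edgeBot u e) + X (edgeTop u e)) := by
  rw [towerPoly_eq_prod, Fintype.prod_sigma, ← Finset.prod_mul_distrib]
  refine Finset.prod_congr rfl fun k _ => ?_
  rw [Nat.zero_add, layerPoly, mul_assoc, Fintype.prod_sum_type, strip_eq_prod, strip_eq_prod]
  simp only [edgeBot, edgeTop, Nat.zero_add]

theorem prod_cornerPoly (u : List Layer) :
    ∏ k : Fin u.length, cornerPoly k u[k].left.length u[k].piece =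
      ∑ s : Crossing u → Corner, C (∏ c, weight u[c.1].piece c.2 (s c)) *
        monomial (∑ c : Crossing u, Finsupp.single
          (cornerVertex c.1 u[c.1].left.length u[c.1].piece c.2 (s c)) 1) 1 := by
  have h1 : ∏ k : Fin u.length, cornerPoly k u[k].left.length u[k].piece =
      ∏ c : Crossing u, ∑ x, C (weight u[c.1].piece c.2 x) *
        X (cornerVertex c.1 u[c.1].left.length u[c.1].piece c.2 x) := by
    rw [Fintype.prod_sigma]; rfl
  rw [h1, Finset.prod_univ_sum, Fintype.piFinset_univ]
  refine Finset.sum_congr rfl fun s _ => ?_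
  rw [Finset.prod_mul_distrib, map_prod]
  congr 1
  rw [monomial_sum_one]
  rfl

theorem prod_concat {M : Type*} [CommMonoid M] (f : ℕ → Layer → M) (u : List Layer) (l : Layer) :
    ∏ k : Fin (u ++ [l]).length, f k (u ++ [l])[k] =
      (∏ k : Fin u.length, f k u[k]) * f u.length l := by
  have h : (u ++ [l]).length = u.length + 1 := by simp
  have h1 : ∏ k : Fin (u ++ [l]).length, f k (u ++ [l])[k] =
      ∏ k : Fin (u.length + 1), f k ((u ++ [l])[k.val]'(by rw [h]; exact k.2)) :=
    Fintype.prod_equiv (finCongr h) _ _ fun k => rfl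
  rw [h1, Fin.prod_univ_castSucc]
  congr 1
  · refine Finset.prod_congr rfl fun k _ => ?_
    simp
  · simp

/-- The vertices of the forest: the gaps below the final maximum and the circle regions. -/
def vertices (u : List Layer) : Finset Vertex := (towerExp 0 u + rowExp u.length 0 3).support

theorem towerExp_apply {j k : ℕ} {u : List Layer} (hk : k < u.length) {v : Vertex}
    (hv : height v = j + k) : towerExp j u v = layerExp (j + k) u[k] v := by
  induction u generalizing j k with
  | nil => simp at hk
  | cons l u ih =>
    rw [towerExp, Finsupp.add_apply]
    cases k with
    | zero => rw [towerExp_of_lt (by omega)]; rfl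
    | succ k =>
      rw [layerExp_of_height (by omega), ih (k := k) (by simpa using hk) (by omega), zero_add,
        show j + 1 + k = j + (k + 1) by omega]
      rfl

theorem ones_vertices (u : List Layer) :
    ones (vertices u) = towerExp 0 u + rowExp u.length 0 3 := by
  ext v
  rw [ones_apply, vertices]
  have h : (towerExp 0 u + rowExp u.length 0 3) v ≤ 1 := by
    rw [Finsupp.add_apply]
    by_cases h : height v < u.length
    · have : rowExp u.length 0 3 v = 0 := by
        rcases v with ⟨a, g⟩ | j
        · simp only [height] at h
          rw [rowExp_inl, if_neg (by omega)]
        · exact rowExp_inr _ _ _ _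
      rw [this]; exact towerExp_le_one _ _ _
    · rw [towerExp_of_ge (by omega), zero_add]; exact rowExp_le_one _ _ _ _
  split_ifs with hv
  · rw [Finsupp.mem_support_iff] at hv; omega
  · simpa using (Finsupp.notMem_support_iff.1 hv).symm

section

variable {u : List Layer} {s : Strand}

theorem inl_mem_vertices
    (hw : IsTangle [] (u ++ [⟨[], .cap s, []⟩]) []) (x : ℕ × ℕ) : .inl x ∈ vertices u ↔
    x.1 ≤ u.length ∧ x.2 ≤ (strandsAt (u ++ [⟨[], .cap s, []⟩]) x.1).length := by
  obtain ⟨ℓ, g⟩ := x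
  rw [vertices, Finsupp.mem_support_iff, Finsupp.add_apply]
  rcases lt_trichotomy ℓ u.length with h | h | h
  · rw [towerExp_apply (k := ℓ) h (by simp [height]), layerExp, Finsupp.add_apply, rowExp_inl,
      circleExp_apply, rowExp_inl]
    have h2 := source_eq_strandsAt hw (k := ℓ) (by simp; omega)
    rw [List.getElem_append_left h] at h2
    rw [h2]
    simp [h.le, h.ne]
  · subst h
    have h2 := source_eq_strandsAt hw (k := u.length) (by simp)
    rw [towerExp_of_ge (by simp [height]), rowExp_inl]
    simp [← h2, Layer.source, Piece.dom]
    omega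
  · rw [towerExp_of_ge (by simp [height]; omega), rowExp_inl]
    simp [h.ne', h]

theorem inr_mem_vertices (k : ℕ) : .inr k ∈ vertices u ↔
    ∃ h : k < u.length, u[k].piece.isVertex = true := by
  rw [vertices, Finsupp.mem_support_iff, Finsupp.add_apply, rowExp_inr]
  by_cases h : k < u.length
  · rw [towerExp_apply (k := k) h (by simp [height]), layerExp, Finsupp.add_apply, rowExp_inr,
      circleExp_apply]
    simp [h]
  · rw [towerExp_of_ge (by simp [height]; omega)]
    simp [h]

end

end

noncomputable section

open MvPolynomial

/-! ### States and coverings of forests -/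

/-- The states are the assignments for which every region is covered exactly once, if the two
regions next to the initial point count as covered. -/
theorem sum_single_eq_ones_iff {κ C : Type*} [Fintype κ] [DecidableEq C] (f : κ → C) {F : Finset C}
    {a b : C} (ha : a ∈ F) (hb : b ∈ F) (hab : a ≠ b) :
    (∑ c, Finsupp.single (f c) 1 + Finsupp.single a 1 + Finsupp.single b 1 = ones F) ↔
      Set.BijOn (fun c => some (f c)) Set.univ (some '' ((F : Set C) \ {a, b})) := by
  have happ : ∀ R, (∑ c, Finsupp.single (f c) 1 + Finsupp.single a 1 + Finsupp.single b 1 :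
      C →₀ ℕ) R = (Finset.univ.filter fun c => f c = R).card + (if a = R then 1 else 0) +
        if b = R then 1 else 0 := by
    intro R
    simp only [Finsupp.add_apply, Finsupp.finsetSum_apply, Finsupp.single_apply,
      Finset.card_filter]
  constructor
  · intro h
    have hR : ∀ R, (Finset.univ.filter fun c => f c = R).card + (if a = R then 1 else 0) +
        (if b = R then 1 else 0) = if R ∈ F then 1 else 0 := by
      intro R; rw [← happ, h, ones_apply]
    have hpos : ∀ c, 0 < (Finset.univ.filter fun c' => f c' = f c).card := fun c =>
      Finset.card_pos.2 ⟨c, by simp⟩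
    have hle : ∀ R, (Finset.univ.filter fun c => f c = R).card ≤ 1 := by
      intro R; have := hR R; split_ifs at this <;> omega
    refine ⟨?_, ?_, ?_⟩
    · intro c _
      have h1 := hR (f c)
      have h2 := hpos c
      refine ⟨f c, ⟨?_, ?_⟩, rfl⟩
      · by_contra hcon
        rw [Finset.mem_coe] at hcon
        rw [if_neg hcon] at h1; omega
      · rintro (h3 | h3)
        · rw [if_pos h3.symm] at h1; split_ifs at h1 <;> omega
        · rw [if_pos (Eq.symm h3)] at h1; split_ifs at h1 <;> omega
    · intro c _ c' _ hcc
      have h1 := Finset.card_le_one.1 (hle (f c))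
      exact h1 c (by simp) c' (by simpa using (Option.some_injective _ hcc).symm)
    · rintro _ ⟨R, ⟨hRF, hRab⟩, rfl⟩
      have h1 := hR R
      simp only [Set.mem_insert_iff, Set.mem_singleton_iff, not_or] at hRab
      rw [if_neg (Ne.symm hRab.1), if_neg (Ne.symm hRab.2), if_pos (Finset.mem_coe.1 hRF)] at h1
      obtain ⟨c, hc⟩ := Finset.card_pos.1 (by omega :
        0 < (Finset.univ.filter fun c => f c = R).card)
      exact ⟨c, trivial, by simpa using hc⟩
  · rintro ⟨h1, h2, h3⟩
    ext R
    rw [happ, ones_apply]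
    have hf : ∀ c, f c ∈ F ∧ f c ≠ a ∧ f c ≠ b := by
      intro c
      obtain ⟨R, ⟨hRF, hRab⟩, hR⟩ := h1 (Set.mem_univ c)
      simp only [Option.some.injEq] at hR
      subst hR
      simpa using And.intro hRF hRab
    by_cases hRF : R ∈ F
    · rw [if_pos hRF]
      by_cases hRa : a = R
      · have : (Finset.univ.filter fun c => f c = R) = ∅ := by
          ext c; simp only [Finset.mem_filter]; simpa using fun h => (hf c).2.1 (h.trans hRa.symm)
        rw [this, if_pos hRa, if_neg (fun h => hab (hRa.trans h.symm))]; rfl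
      by_cases hRb : b = R
      · have : (Finset.univ.filter fun c => f c = R) = ∅ := by
          ext c; simp only [Finset.mem_filter]; simpa using fun h => (hf c).2.2 (h.trans hRb.symm)
        rw [this, if_neg hRa, if_pos hRb]; rfl
      rw [if_neg hRa, if_neg hRb]
      obtain ⟨c, -, hc⟩ := h3 ⟨R, ⟨hRF, by simp [Ne.symm hRa, Ne.symm hRb]⟩, rfl⟩
      have : (Finset.univ.filter fun c => f c = R) = {c} := by
        ext c'
        simp only [Finset.mem_filter, Finset.mem_univ, true_and, Finset.mem_singleton]
        simp only [Option.some.injEq] at hc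
        exact ⟨fun h => h2 trivial trivial (by simp [h, hc]), fun h => h ▸ hc⟩
      rw [this]; rfl
    · have : (Finset.univ.filter fun c => f c = R) = ∅ := by
        ext c; simp only [Finset.mem_filter]; simpa using fun h : f c = R => hRF (h ▸ (hf c).1)
      rw [this, if_neg hRF, if_neg (by rintro rfl; exact hRF ha),
        if_neg (by rintro rfl; exact hRF hb)]
      rfl

/-- The region of a gap, or a circle region. -/
def regionOf (w : List Layer) : Vertex → Face w ⊕ ℕ := Sum.map (face w) id

theorem cornerRegion_eq {w : List Layer} (c : Crossing w) {y : Corner}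
    (h : w[c.1].piece.isVertex = true → y ≠ .south) :
    cornerRegion w c y =
      some (regionOf w (cornerVertex c.1 w[c.1].left.length w[c.1].piece c.2 y)) := by
  unfold cornerRegion cornerVertex regionOf
  by_cases hv : w[c.1].piece.isVertex = true
  · simp only [hv, if_true]
    cases y
    · rfl
    · exact absurd rfl (h hv)
    · rfl
    · rfl
  · simp only [hv]
    cases y <;> rfl

theorem weight_south {P : Piece} (hP : P.isVertex = true) (c : ℕ) : weight P c .south = 0 := by
  cases P with
  | merge i j => cases c <;> simp [weight, cornerWeight, circleWeight]
  | split i j => simp [weight, cornerWeight, circleWeight]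
  | _ => simp [Piece.isVertex] at hP

theorem index_gapStep {w : List Layer} (hw : IsTangle [] w []) {x y : ℕ × ℕ}
    (h : GapStep w x y) : index w x = index w y := by
  have hflow : ∀ P : Piece, (P.dom.map Strand.flow).sum = (P.cod.map Strand.flow).sum := by
    intro P
    cases P <;> simp [Piece.dom, Piece.cod, Strand.flow, Strand.rev, up]
    · split_ifs <;> simp_all
    · split_ifs <;> simp_all
    · ring
    · ring
  cases h with
  | left k g hg =>
    obtain ⟨k, hk⟩ := k
    simp only [Fin.getElem_fin] at hg
    unfold index
    rw [← source_eq_strandsAt hw hk, ← target_eq_strandsAt w hk]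
    simp only [Layer.source, Layer.target, List.append_assoc]
    rw [List.take_append_of_le_length hg, List.take_append_of_le_length hg]
  | right k r hr =>
    obtain ⟨k, hk⟩ := k
    simp only [Fin.getElem_fin] at hr
    unfold index
    rw [← source_eq_strandsAt hw hk, ← target_eq_strandsAt w hk]
    simp only [Layer.source, Layer.target, Fin.getElem_fin]
    rw [← List.length_append, ← List.length_append, List.take_length_add_append,
      List.take_length_add_append]
    simp [hflow]

/-- The regions on the two sides of a strand of non-zero color are different, because they have
different indices. -/
theorem face_ne {w : List Layer} (hw : IsTangle [] w []) {x : ℕ × ℕ} {s : Strand}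
    (hs : (strandsAt w x.1)[x.2]? = some s) (hc : 0 < s.color) :
    face w x ≠ face w (x.1, x.2 + 1) := by
  intro h
  obtain ⟨hx, rfl⟩ := List.getElem?_eq_some_iff.1 hs
  have h1 : index w x = index w (x.1, x.2 + 1) :=
    congrArg (Quot.lift (index w) fun _ _ => index_gapStep hw) h
  rw [index_succ w hx] at h1
  unfold Strand.flow at h1
  split_ifs at h1 <;> omega

section

variable {u : List Layer} {s : Strand}

theorem edge_mem_vertices (hw : IsTangle [] (u ++ [⟨[], .cap s, []⟩]) []) (e : GapEdge u) :
    edgeBot u e ∈ vertices u ∧ edgeTop u e ∈ vertices u := by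
  obtain ⟨⟨k, hk⟩, e⟩ := e
  have hk' : k < (u ++ [(⟨[], .cap s, []⟩ : Layer)]).length := by simp; omega
  have h1 := source_eq_strandsAt hw hk'
  have h2 := target_eq_strandsAt (u ++ [⟨[], .cap s, []⟩]) hk'
  rw [List.getElem_append_left hk] at h1 h2
  rcases e with ⟨g, hg⟩ | ⟨r, hr⟩
  · simp only [edgeBot, edgeTop, inl_mem_vertices hw, ← h1, ← h2, Layer.length_source,
      Layer.length_target]
    simp only [Fin.getElem_fin] at hg
    omega
  · simp only [edgeBot, edgeTop, inl_mem_vertices hw, ← h1, ← h2, Layer.length_source,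
      Layer.length_target]
    simp only [Fin.getElem_fin] at hr ⊢
    omega

theorem regionOf_edge (e : GapEdge u) :
    regionOf (u ++ [⟨[], .cap s, []⟩]) (edgeBot u e) =
      regionOf (u ++ [⟨[], .cap s, []⟩]) (edgeTop u e) := by
  obtain ⟨⟨k, hk⟩, e⟩ := e
  have hk' : k < (u ++ [(⟨[], .cap s, []⟩ : Layer)]).length := by simp; omega
  have hget : (u ++ [(⟨[], .cap s, []⟩ : Layer)])[k] = u[k] := List.getElem_append_left hk
  rcases e with ⟨g, hg⟩ | ⟨r, hr⟩
  · have := GapStep.left (w := u ++ [⟨[], .cap s, []⟩]) ⟨k, hk'⟩ g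
      (by simp only [Fin.getElem_fin, hget] at hg ⊢; omega)
    exact congrArg Sum.inl (Quot.sound this)
  · have := GapStep.right (w := u ++ [⟨[], .cap s, []⟩]) ⟨k, hk'⟩ r
      (by simp only [Fin.getElem_fin, hget] at hr ⊢; omega)
    simp only [Fin.getElem_fin, hget] at this
    exact congrArg Sum.inl (Quot.sound this)

/-- Two gaps of the same region are joined by vertical edges that do not use the line above the
final maximum. -/
theorem eqvGen_of_regionOf (hw : IsTangle [] (u ++ [⟨[], .cap s, []⟩]) []) {a b : Vertex}
    (ha : a ∈ vertices u) (hb : b ∈ vertices u)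
    (h : regionOf (u ++ [⟨[], .cap s, []⟩]) a = regionOf (u ++ [⟨[], .cap s, []⟩]) b) :
    Relation.EqvGen (fun x y => ∃ e ∈ (Finset.univ : Finset (GapEdge u)),
      x = edgeBot u e ∧ y = edgeTop u e) a b := by
  set R := fun x y => ∃ e ∈ (Finset.univ : Finset (GapEdge u)), x = edgeBot u e ∧ y = edgeTop u e
  set w := u ++ [⟨[], .cap s, []⟩] with hwdef
  have hwl : w.length = u.length + 1 := by simp [hwdef]
  have hget : ∀ (k : ℕ) (hk : k < u.length), w[k]'(by omega) = u[k] := fun k hk =>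
    List.getElem_append_left hk
  have hgetl : w[u.length]'(by omega) = ⟨[], .cap s, []⟩ := by simp [hwdef]
  -- the leftmost and the rightmost gaps lie in the unbounded region
  have hleft : ∀ k ≤ u.length, Relation.EqvGen R (.inl (0, 0)) (.inl (k, 0)) := by
    intro k
    induction k with
    | zero => exact fun _ => .refl _
    | succ k ih =>
      intro hk
      exact (ih (by omega)).trans _ _ _ (.rel _ _ ⟨⟨⟨k, hk⟩, .inl 0⟩, by simp, rfl, rfl⟩)
  have hright : ∀ k ≤ u.length,
      Relation.EqvGen R (.inl (0, 0)) (.inl (k, (strandsAt w k).length)) := by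
    intro k
    induction k with
    | zero => exact fun _ => .refl _
    | succ k ih =>
      intro hk
      refine (ih (by omega)).trans _ _ _ (.rel _ _ ⟨⟨⟨k, hk⟩, .inr (Fin.last _)⟩, by simp, ?_, ?_⟩)
      · simp only [edgeBot, Fin.val_last]
        rw [← source_eq_strandsAt hw (by omega : k < w.length), Layer.length_source, hget k hk]
        rfl
      · simp only [edgeTop, Fin.val_last]
        rw [← target_eq_strandsAt w (by omega : k < w.length), Layer.length_target, hget k hk]
        rfl
  -- the top line is retracted to the line below the last layer
  set ret : ℕ × ℕ → Vertex := fun x => .inl (if x.1 ≤ u.length then x else (u.length, 0)) with hret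
  have hret' : ∀ x y, GapStep w x y → Relation.EqvGen R (ret x) (ret y) := by
    intro x y hxy
    cases hxy with
    | left k g hg =>
      obtain ⟨k, hk⟩ := k
      simp only [Fin.getElem_fin] at hg
      rcases Nat.lt_succ_iff_lt_or_eq.1 (hwl ▸ hk) with hk' | rfl
      · rw [hget k hk'] at hg
        simp only [hret, hk'.le, Nat.succ_le_of_lt hk', if_true]
        exact .rel _ _ ⟨⟨⟨k, hk'⟩, .inl ⟨g, Nat.lt_succ_of_le hg⟩⟩, by simp, rfl, rfl⟩
      · simp only [hgetl, List.length_nil, nonpos_iff_eq_zero] at hg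
        subst hg
        simp only [hret, le_refl, if_true, Nat.not_succ_le_self, if_false]
        exact .refl _
    | right k r hr =>
      obtain ⟨k, hk⟩ := k
      simp only [Fin.getElem_fin] at hr ⊢
      rcases Nat.lt_succ_iff_lt_or_eq.1 (hwl ▸ hk) with hk' | rfl
      · simp only [hget k hk'] at hr ⊢
        simp only [hret, hk'.le, Nat.succ_le_of_lt hk', if_true]
        exact .rel _ _ ⟨⟨⟨k, hk'⟩, .inr ⟨r, Nat.lt_succ_of_le hr⟩⟩, by simp, rfl, rfl⟩
      · simp only [hgetl, List.length_nil, nonpos_iff_eq_zero] at hr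
        subst hr
        simp only [hret, le_refl, if_true, Nat.not_succ_le_self, if_false, hgetl, Piece.dom,
          List.length_nil, List.length_cons, Nat.zero_add, Nat.add_zero]
        have h1 := hright u.length le_rfl
        rw [← source_eq_strandsAt hw (by omega : u.length < w.length), hgetl] at h1
        exact (h1.symm).trans _ _ _ (hleft _ le_rfl)
  have hret'' : ∀ x y, Relation.EqvGen (GapStep w) x y → Relation.EqvGen R (ret x) (ret y) := by
    intro x y h
    induction h with
    | rel _ _ h => exact hret' _ _ h
    | refl => exact .refl _
    | symm _ _ _ ih => exact ih.symm
    | trans _ _ _ _ _ ih ih' => exact ih.trans _ _ _ ih'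
  rcases a with x | j <;> rcases b with y | j'
  · have hx : ret x = .inl x := by
      simp only [hret]; rw [if_pos ((inl_mem_vertices hw x).1 ha).1]
    have hy : ret y = .inl y := by
      simp only [hret]; rw [if_pos ((inl_mem_vertices hw y).1 hb).1]
    rw [← hx, ← hy]
    exact hret'' _ _ (Quot.eqvGen_exact (Sum.inl_injective h))
  · simp [regionOf] at h
  · simp [regionOf] at h
  · have : j = j' := by simpa [regionOf] using h
    rw [this]; exact .refl _

theorem mem_regions_iff {w : List Layer} (hwdef : w = u ++ [⟨[], .cap s, []⟩])
    (hw : IsTangle [] w []) (Q : Face w ⊕ ℕ) :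
    Q ∈ regions w ↔ ∃ v ∈ vertices u, regionOf w v = Q := by
  have hmem := inl_mem_vertices (u := u) (s := s) (hwdef ▸ hw)
  rw [← hwdef] at hmem
  have hwl : w.length = u.length + 1 := by simp [hwdef]
  have hgetl : w[u.length]'(by omega) = ⟨[], .cap s, []⟩ := by simp [hwdef]
  constructor
  · rintro (⟨⟨ℓ, g⟩, ⟨h1, h2⟩, rfl⟩ | ⟨⟨k, hk⟩, h1, rfl⟩)
    · simp only at h1 h2
      by_cases h : ℓ ≤ u.length
      · exact ⟨.inl (ℓ, g), (hmem _).2 ⟨h, h2⟩, rfl⟩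
      · obtain rfl : ℓ = u.length + 1 := by omega
        rw [← hwl, strandsAt_length hw] at h2
        obtain rfl : g = 0 := by simpa using h2
        refine ⟨.inl (u.length, 0), (hmem _).2 ⟨le_rfl, Nat.zero_le _⟩, ?_⟩
        exact congrArg Sum.inl (Quot.sound (GapStep.left ⟨u.length, by omega⟩ 0 (Nat.zero_le _)))
    · simp only [Fin.getElem_fin] at h1
      rcases Nat.lt_succ_iff_lt_or_eq.1 (hwl ▸ hk) with hk' | rfl
      · refine ⟨.inr k, (inr_mem_vertices k).2 ⟨hk', ?_⟩, rfl⟩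
        subst hwdef; rwa [List.getElem_append_left hk'] at h1
      · simp [hgetl, Piece.isVertex] at h1
  · rintro ⟨⟨ℓ, g⟩ | k, hv, rfl⟩
    · obtain ⟨h1, h2⟩ := (hmem _).1 hv
      exact .inl ⟨(ℓ, g), ⟨by simp only at h1 ⊢; omega, h2⟩, rfl⟩
    · obtain ⟨h1, h2⟩ := (inr_mem_vertices k).1 hv
      refine .inr ⟨⟨k, by omega⟩, ?_, rfl⟩
      simp only [Fin.getElem_fin]
      subst hwdef; rwa [List.getElem_append_left h1]

theorem cornerVertex_mem_vertices {w : List Layer} (hwdef : w = u ++ [⟨[], .cap s, []⟩])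
    (hw : IsTangle [] w []) (c : Crossing w) (y : Corner) :
    cornerVertex c.1 w[c.1].left.length w[c.1].piece c.2 y ∈ vertices u := by
  have hmem := inl_mem_vertices (u := u) (s := s) (hwdef ▸ hw)
  rw [← hwdef] at hmem
  have hwl : w.length = u.length + 1 := by simp [hwdef]
  have hgetl : w[u.length]'(by omega) = ⟨[], .cap s, []⟩ := by simp [hwdef]
  obtain ⟨⟨k, hk⟩, c, hc⟩ := c
  simp only [Fin.getElem_fin] at hc ⊢
  have hk' : k < u.length := by
    rcases Nat.lt_succ_iff_lt_or_eq.1 (hwl ▸ hk) with hk' | rfl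
    · exact hk'
    · simp [hgetl, Piece.numCrossings] at hc
  have h1 := source_eq_strandsAt hw hk
  have h2 := target_eq_strandsAt w hk
  have l1 := w[k].length_source
  have l2 := w[k].length_target
  by_cases hv : w[k].piece.isVertex = true ∧ (y = .north ∨ y = .south)
  · have : cornerVertex k w[k].left.length w[k].piece c y = .inr k := by
      obtain ⟨g1, g2, -⟩ := cornerVertex_of_isVertex k w[k].left.length c hv.1
      rcases hv.2 with rfl | rfl
      · exact g1
      · exact g2
    rw [this, inr_mem_vertices]
    refine ⟨hk', ?_⟩
    subst hwdef
    rw [List.getElem_append_left hk'] at hv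
    exact hv.1
  · rcases cornerVertex_cases k w[k].left.length w[k].piece hc y with h | ⟨i, hi, h⟩ | ⟨i, hi, h⟩
    · exfalso
      revert h hv
      unfold cornerVertex
      cases y <;> split_ifs <;> simp_all
    · rw [h, hmem, ← h1, l1]
      omega
    · rw [h, hmem, ← h2, l2]
      omega

end

/-- For a fixed choice of corners, the vertical edges can be used in exactly one way to complete it
to a covering of all gaps if it is a state, and in no way otherwise. -/
theorem stateSum_eq_amp_of_isConnected {w : List Layer} (hw : IsTangle [] w []) {x : ℕ × ℕ}
    (hc : MOY.IsConnected w) (hx : IsPoint w x) (hne : face w x ≠ face w (x.1, x.2 + 1)) :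
    stateSum w x = amp w x := by
  classical
  have h0 : w ≠ [] := by
    rintro rfl
    have := hx.lt hw
    simp at this
  obtain ⟨u, s, rfl, -⟩ := exists_last hw h0
  set w := u ++ [⟨[], .cap s, []⟩] with hwdef
  have hwl : w.length = u.length + 1 := by simp [hwdef]
  have hxl := hx.lt hw
  have hx1 : Sum.inl x ∈ vertices u := (inl_mem_vertices hw _).2 ⟨by omega, by
    have : x.2 < _ := hx
    exact this.le⟩
  have hx2 : Sum.inl (x.1, x.2 + 1) ∈ vertices u := (inl_mem_vertices hw _).2 ⟨by
    simp only; omega, hx⟩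
  rw [amp_eq_coeff hw hx, ← ones_vertices, towerPoly_eq]
  have hprod : ∏ k : Fin u.length, cornerPoly k u[k].left.length u[k].piece =
      ∏ k : Fin w.length, cornerPoly k w[k].left.length w[k].piece := by
    rw [prod_concat (fun k l => cornerPoly k l.left.length l.piece)]
    simp [cornerPoly_eq, Piece.numCrossings]
  rw [hprod, prod_cornerPoly, Finset.sum_mul, Finset.sum_mul, coeff_sum]
  unfold stateSum
  simp only
  rw [if_pos ⟨hc, hne⟩]
  refine Finset.sum_congr rfl fun t _ => ?_
  set M : Vertex →₀ ℕ := ∑ c : Crossing w, Finsupp.single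
    (cornerVertex c.1 w[c.1].left.length w[c.1].piece c.2 (t c)) 1 + Finsupp.single (.inl x) 1 +
    Finsupp.single (.inl (x.1, x.2 + 1)) 1 with hM
  have hmon : (C (∏ c, weight w[c.1].piece c.2 (t c)) *
      monomial (∑ c : Crossing w, Finsupp.single
        (cornerVertex c.1 w[c.1].left.length w[c.1].piece c.2 (t c)) 1) 1 *
      (∏ e, (X (edgeBot u e) + X (edgeTop u e))) * (X (.inl x) * X (.inl (x.1, x.2 + 1))) : GapPoly) =
      C (∏ c, weight w[c.1].piece c.2 (t c)) *
        ((∏ e, (X (edgeBot u e) + X (edgeTop u e))) * monomial M 1) := by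
    have : (monomial M (1 : RatFunc ℚ)) = monomial (∑ c : Crossing w, Finsupp.single
        (cornerVertex c.1 w[c.1].left.length w[c.1].piece c.2 (t c)) 1) 1 *
        (X (.inl x) * X (.inl (x.1, x.2 + 1))) := by
      rw [hM, X, X, monomial_mul, monomial_mul, one_mul, one_mul, add_assoc]
    rw [this]; ring
  rw [hmon, coeff_C_mul, coeff_forest Finset.univ (edgeBot u) (edgeTop u) (vertices u) (regionOf w)
    M (fun e _ => edge_mem_vertices hw e) (isForest_gapEdge hw hc) (fun e _ => regionOf_edge e)
    (fun a ha b hb h => eqvGen_of_regionOf hw ha hb h)]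
  swap
  · intro v hv
    by_contra hcon
    rw [Finsupp.mem_support_iff, hM] at hv
    apply hv
    simp only [Finsupp.add_apply, Finsupp.finsetSum_apply, Finsupp.single_apply]
    rw [if_neg (by rintro rfl; exact hcon hx1), if_neg (by rintro rfl; exact hcon hx2),
      Finset.sum_eq_zero (fun c _ => if_neg
        (by rintro rfl; exact hcon (cornerVertex_mem_vertices hwdef hw c (t c)))), add_zero,
          add_zero]
  by_cases ht : ∃ c : Crossing w, w[c.1].piece.isVertex = true ∧ t c = .south
  · obtain ⟨c, h1, h2⟩ := ht
    have h3 : ∏ c, weight w[c.1].piece c.2 (t c) = 0 :=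
      Finset.prod_eq_zero (Finset.mem_univ c) (by rw [h2]; exact weight_south h1 _)
    rw [h3, zero_mul]
    have h4 : ∏ c : Crossing w, cornerSign w[c.1].piece (t c) *
        cornerWeight w[c.1].piece c.2 (t c) = 0 := h3
    rw [h4]; simp
  · push Not at ht
    have hreg : ((Finset.image (regionOf w) (vertices u) : Finset _) : Set (Face w ⊕ ℕ)) =
        regions w := by
      ext Q
      rw [mem_regions_iff hwdef hw]
      simp
    have hiff : IsState w (face w x) (face w (x.1, x.2 + 1)) t ↔
        M.mapDomain (regionOf w) = ones ((vertices u).image (regionOf w)) := by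
      unfold IsState
      rw [hM, Finsupp.mapDomain_add, Finsupp.mapDomain_add, Finsupp.mapDomain_finsetSum]
      simp only [Finsupp.mapDomain_single]
      rw [sum_single_eq_ones_iff _ (Finset.mem_image_of_mem _ hx1) (Finset.mem_image_of_mem _ hx2)
        (by simpa [regionOf] using hne), hreg]
      have : (fun c => cornerRegion w c (t c)) = fun c => some (regionOf w
          (cornerVertex c.1 w[c.1].left.length w[c.1].piece c.2 (t c))) :=
        funext fun c => cornerRegion_eq c (ht c)
      rw [this]
      rfl
    rw [if_congr hiff rfl rfl]
    split_ifs
    · rw [mul_one]; rfl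
    · rw [mul_zero]

/-- The state sum is the transfer amplitude. For disconnected diagrams, both vanish. -/
theorem stateSum_eq_amp {D : Diagram} {x : ℕ × ℕ} (hx : IsBasepoint D x) :
    stateSum D.layers x = amp D.layers x := by
  obtain ⟨s, hs, hc⟩ := hx
  have hp : IsPoint D.layers x := (List.getElem?_eq_some_iff.1 hs).1
  by_cases h : MOY.IsConnected D.layers
  · exact stateSum_eq_amp_of_isConnected D.isTangle h hp (face_ne D.isTangle hs hc)
  · rw [amp_eq_zero_of_not_isConnected D.isTangle h hp]
    unfold stateSum
    simp only
    rw [if_neg (fun h' => h h'.1)]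

end

noncomputable section

/-! ### Non-crossing matchings of the ends of arcs -/

section Matching

variable {α β : Type*}

/-- The ends of disjoint arcs in a lower half plane, from left to right: every arc has a label
in `α` and is recorded at its two ends, together with its directions there (`true` is upwards).
There are `A` arcs whose left end is directed downwards. -/
inductive Matching : List (α × Bool) → ℕ → Prop
  | nil : Matching [] 0
  | insert (P Q : List (α × Bool)) (x : α) (o : Bool) (A : ℕ) (h : Matching (P ++ Q) A)
      (hx : ∀ o', (x, o') ∉ P ++ Q) :
      Matching (P ++ (x, o) :: (x, !o) :: Q) (A + if o then 0 else 1)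

theorem Matching.map {l : List (α × Bool)} {A : ℕ} (h : Matching l A) (f : α → β)
    (hf : ∀ e ∈ l, ∀ e' ∈ l, f e.1 = f e'.1 → e.1 = e'.1) :
    Matching (l.map fun e => (f e.1, e.2)) A := by
  induction h with
  | nil => exact .nil
  | insert P Q x o A h hx ih =>
    have hsub : ∀ e ∈ P ++ Q, e ∈ P ++ (x, o) :: (x, !o) :: Q := by
      intro e he
      simp only [List.mem_append, List.mem_cons] at he ⊢
      tauto
    have h1 := ih fun e he e' he' => hf e (hsub e he) e' (hsub e' he')
    rw [List.map_append] at h1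
    rw [List.map_append, List.map_cons, List.map_cons]
    refine .insert _ _ _ _ _ h1 ?_
    intro o' ho
    rw [← List.map_append, List.mem_map] at ho
    obtain ⟨e, he, h2⟩ := ho
    simp only [Prod.mk.injEq] at h2
    have h3 : e.1 = x := hf e (hsub e he) (x, o) (by simp) h2.1
    exact hx e.2 (by rw [← h3]; exact he)

variable [DecidableEq α]

/-- No label occurs just once. -/
theorem Matching.count_ne_one {l : List (α × Bool)} {A : ℕ} (h : Matching l A) (x : α) :
    (l.map Prod.fst).count x ≠ 1 := by
  induction h with
  | nil => simp
  | insert P Q z o A h hx ih =>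
    simp only [List.map_append, List.map_cons, List.count_append, List.count_cons] at ih ⊢
    split_ifs <;> omega

/-- The other end of an arc. -/
theorem Matching.exists_mem {P Q : List (α × Bool)} {x : α} {o : Bool} {A : ℕ}
    (h : Matching (P ++ (x, o) :: Q) A) : ∃ o', (x, o') ∈ P ++ Q := by
  have h1 := h.count_ne_one x
  have h2 : x ∈ (P ++ Q).map Prod.fst := by
    rw [← List.count_pos_iff]
    simp only [List.map_append, List.map_cons, List.count_append, List.count_cons_self] at h1 ⊢
    omega
  obtain ⟨⟨_, o'⟩, h3, rfl⟩ := List.mem_map.1 h2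
  exact ⟨o', h3⟩

/-- Give the label `x` to the arc `y`. -/
def relabel (x y v : α) : α := if v = y then x else v

/-- A maximum over two adjacent ends either closes an arc or joins two arcs. In the second case, the
number of arcs whose left end is directed downwards drops by one if the left half of the maximum is
directed upwards, and it does not change otherwise, whatever the positions of the two arcs are. -/
theorem Matching.cap {P Q : List (α × Bool)} {x y : α} {o : Bool} {A : ℕ}
    (h : Matching (P ++ (x, o) :: (y, !o) :: Q) A) :
    (x = y → (∀ o', (x, o') ∉ P ++ Q) ∧ ∃ A', A = A' + (if o then 0 else 1) ∧
      Matching (P ++ Q) A') ∧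
    (x ≠ y → (∃ o', (x, o') ∈ P ++ Q) ∧ ∃ A', A = A' + (if o then 1 else 0) ∧
      Matching ((P ++ Q).map fun e => (relabel x y e.1, e.2)) A') := by
  generalize hl : P ++ (x, o) :: (y, !o) :: Q = l at h
  induction h generalizing P Q with
  | nil => simp at hl
  | insert P' Q' z o' A h hz ih =>
    have hrel : ∀ e : α × Bool, e.1 ≠ y → (relabel x y e.1, e.2) = e := by
      intro e he; simp [relabel, he]
    rcases List.append_eq_append_iff.1 hl with ⟨M, hP, hM⟩ | ⟨M, hP, hM⟩
    · match M with
      | [] =>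
        simp only [List.append_nil, List.nil_append, List.cons.injEq, Prod.mk.injEq] at hP hM
        obtain ⟨⟨rfl, rfl⟩, ⟨rfl, -⟩, rfl⟩ := hM
        subst hP
        exact ⟨fun _ => ⟨hz, A, rfl, h⟩, fun hne => absurd rfl hne⟩
      | [e] =>
        simp only [List.cons_append, List.nil_append, List.cons.injEq, Prod.mk.injEq] at hM
        obtain ⟨rfl, ⟨rfl, rfl⟩, rfl⟩ := hM
        subst hP
        have hne : x ≠ y := by
          rintro rfl; exact hz o (by simp)
        obtain ⟨o₁, ho₁⟩ := Matching.exists_mem (P := P) (x := x) (o := o) (Q := Q')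
          (by simpa using h)
        refine ⟨fun h => absurd h hne, fun _ => ⟨⟨o₁, ?_⟩, A, by cases o <;> simp, ?_⟩⟩
        · simp only [List.mem_append, List.mem_cons] at ho₁ ⊢
          tauto
        have : (P ++ (y, !!o) :: Q').map (fun e => (relabel x y e.1, e.2)) =
            (P ++ [(x, o)]) ++ Q' := by
          have hzP : ∀ e ∈ P, e.1 ≠ y := by
            rintro ⟨_, o'⟩ he rfl; exact hz o' (by simp [he])
          have hzQ : ∀ e ∈ Q', e.1 ≠ y := by
            rintro ⟨_, o'⟩ he rfl; exact hz o' (by simp [he])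
          rw [List.map_append, List.map_cons,
            List.map_congr_left (g := id) fun e he => hrel e (hzP e he),
            List.map_congr_left (l := Q') (g := id) fun e he => hrel e (hzQ e he)]
          simp [relabel]
        rw [this]; exact h
      | e :: e' :: M =>
        simp only [List.cons_append, List.cons.injEq] at hM
        obtain ⟨rfl, rfl, rfl⟩ := hM
        subst hP
        obtain ⟨ih₁, ih₂⟩ := ih (P := P) (Q := M ++ Q') (by simp)
        have hzx : z ≠ x := by rintro rfl; exact hz o (by simp)
        have hzy : z ≠ y := by rintro rfl; exact hz (!o) (by simp)
        refine ⟨fun hxy => ?_, fun hxy => ?_⟩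
        · obtain ⟨h1, A', rfl, h2⟩ := ih₁ hxy
          refine ⟨fun o'' ho => ?_, A' + (if o' then 0 else 1), by omega, ?_⟩
          · simp only [List.mem_append, List.mem_cons, Prod.mk.injEq] at ho h1
            have := h1 o''
            tauto
          · have h3 := Matching.insert (P ++ M) Q' z o' A' (by simpa using h2) (fun o'' ho => by
              apply hz o''
              simp only [List.mem_append, List.mem_cons] at ho ⊢
              tauto)
            simpa using h3
        · obtain ⟨⟨o₁, h1⟩, A', rfl, h2⟩ := ih₂ hxy
          refine ⟨⟨o₁, ?_⟩, A' + (if o' then 0 else 1), by omega, ?_⟩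
          · simp only [List.mem_append, List.mem_cons] at h1 ⊢
            tauto
          · have h3 := Matching.insert ((P ++ M).map fun e => (relabel x y e.1, e.2))
              (Q'.map fun e => (relabel x y e.1, e.2)) z o' A'
              (by simpa using h2) (fun o'' ho => by
                rw [← List.map_append, List.mem_map] at ho
                obtain ⟨⟨v, o₂⟩, he, h4⟩ := ho
                simp only [Prod.mk.injEq, relabel] at h4
                split_ifs at h4 with h5
                · exact hzx h4.1.symm
                · apply hz o₂
                  rw [← h4.1]
                  simp only [List.mem_append, List.mem_cons] at he ⊢
                  tauto)
            have h4 : relabel x y z = z := if_neg hzy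
            simpa [h4] using h3
    · match M with
      | [] =>
        simp only [List.append_nil, List.nil_append, List.cons.injEq, Prod.mk.injEq] at hP hM
        obtain ⟨⟨rfl, rfl⟩, ⟨rfl, -⟩, rfl⟩ := hM
        subst hP
        exact ⟨fun _ => ⟨hz, A, rfl, h⟩, fun hne => absurd rfl hne⟩
      | [e] =>
        simp only [List.cons_append, List.nil_append, List.cons.injEq, Prod.mk.injEq] at hM
        obtain ⟨rfl, ⟨rfl, rfl⟩, rfl⟩ := hM
        subst hP
        have hne : z ≠ y := by
          rintro rfl; exact hz (!!o') (by simp)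
        refine ⟨fun h => absurd h hne, fun _ => ⟨⟨o', by simp⟩, A, by cases o' <;> simp, ?_⟩⟩
        have h2 := h.map (relabel z y) (by
          have hxl : ∀ e ∈ P' ++ (y, !!o') :: Q, e.1 ≠ z := by
            rintro ⟨_, o₁⟩ he rfl; exact hz o₁ he
          intro e he e' he' hee
          have h1 := hxl e he
          have h2 := hxl e' he'
          simp only [relabel] at hee
          split_ifs at hee with h3 h4 h4
          · rw [h3, h4]
          · exact absurd hee.symm h2
          · exact absurd hee h1
          · exact hee)
        simpa [relabel, hne] using h2
      | e :: e' :: M =>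
        simp only [List.cons_append, List.cons.injEq] at hM
        obtain ⟨rfl, rfl, rfl⟩ := hM
        subst hP
        obtain ⟨ih₁, ih₂⟩ := ih (P := P' ++ M) (Q := Q) (by simp)
        have hzx : z ≠ x := by rintro rfl; exact hz o (by simp)
        have hzy : z ≠ y := by rintro rfl; exact hz (!o) (by simp)
        refine ⟨fun hxy => ?_, fun hxy => ?_⟩
        · obtain ⟨h1, A', rfl, h2⟩ := ih₁ hxy
          refine ⟨fun o'' ho => ?_, A' + (if o' then 0 else 1), by omega, ?_⟩
          · simp only [List.mem_append, List.mem_cons, Prod.mk.injEq] at ho h1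
            have := h1 o''
            tauto
          · have h3 := Matching.insert P' (M ++ Q) z o' A' (by simpa using h2) (fun o'' ho => by
              apply hz o''
              simp only [List.mem_append, List.mem_cons] at ho ⊢
              tauto)
            simpa using h3
        · obtain ⟨⟨o₁, h1⟩, A', rfl, h2⟩ := ih₂ hxy
          refine ⟨⟨o₁, ?_⟩, A' + (if o' then 0 else 1), by omega, ?_⟩
          · simp only [List.mem_append, List.mem_cons] at h1 ⊢
            tauto
          · have h3 := Matching.insert (P'.map fun e => (relabel x y e.1, e.2))
              ((M ++ Q).map fun e => (relabel x y e.1, e.2)) z o' A'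
              (by simpa using h2) (fun o'' ho => by
                rw [← List.map_append, List.mem_map] at ho
                obtain ⟨⟨v, o₂⟩, he, h4⟩ := ho
                simp only [Prod.mk.injEq, relabel] at h4
                split_ifs at h4 with h5
                · exact hzx h4.1.symm
                · apply hz o₂
                  rw [← h4.1]
                  simp only [List.mem_append, List.mem_cons] at he ⊢
                  tauto)
            have h4 : relabel x y z = z := if_neg hzy
            simpa [h4] using h3

end Matching

end

noncomputable section

/-! ### Counting closed curves from below -/

/-- The point `z` lies on a maximum whose left half has the direction `b`. -/
def IsTop (w : List Layer) (z : ℕ × ℕ) (b : Bool) : Prop :=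
  ∃ (k : Fin w.length) (s : Strand) (q : ℕ), w[k].piece = .cap s ∧ s.up = b ∧
    q < 2 * s.color ∧ z = (k.val, width w[k].left + q)

/-- The components of the part of the resolved curves that consists of the points `Z` and the
steps `E`, and whose open ends are `Γ`, from left to right, with their directions. Every component
is labelled by one of its points; `Cl` are the labels of the closed curves, whose highest points and
orientations are given by `hi` and `ori`, and `A` counts the open arcs whose left end is directed
downwards. -/
structure IsSweptCurves (w : List Layer) (E : ℕ × ℕ → ℕ × ℕ → Prop) (Z : Set (ℕ × ℕ))
    (Γ : List ((ℕ × ℕ) × Bool)) (lab : ℕ × ℕ → ℕ × ℕ) (Cl : Finset (ℕ × ℕ))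
    (ori : ℕ × ℕ → Bool) (hi : ℕ × ℕ → ℕ × ℕ) (A : ℕ) : Prop where
  edge : ∀ y y', E y y' → y ∈ Z ∧ y' ∈ Z ∧ lab y = lab y'
  rep : ∀ z ∈ Z, lab z ∈ Z ∧ Relation.EqvGen (CurveStep w) z (lab z) ∧ lab (lab z) = lab z
  nc : Matching (Γ.map fun e => (lab e.1, e.2)) A
  mem : ∀ e ∈ Γ, e.1 ∈ Z
  cover : ∀ z ∈ Z, lab z ∈ Cl ∨ ∃ e ∈ Γ, lab e.1 = lab z
  disj : ∀ e ∈ Γ, lab e.1 ∉ Cl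
  top : ∀ x ∈ Cl, hi x ∈ Z ∧ lab (hi x) = x ∧ IsTop w (hi x) (ori x) ∧
    ∀ z ∈ Z, lab z = x → z.1 ≤ (hi x).1

/-- The part `Z`, `E` of the resolved curves, with open ends `Γ`, has `r` more clockwise
than counterclockwise closed curves, up to the number of open arcs whose left end is directed
downwards. -/
def SweptCurves (w : List Layer) (E : ℕ × ℕ → ℕ × ℕ → Prop) (Z : Set (ℕ × ℕ))
    (Γ : List ((ℕ × ℕ) × Bool)) (r : ℤ) : Prop :=
  ∃ lab Cl ori hi A, IsSweptCurves w E Z Γ lab Cl ori hi A ∧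
    r = ∑ x ∈ Cl, (if ori x then (1 : ℤ) else -1) - A

variable {w : List Layer} {E : ℕ × ℕ → ℕ × ℕ → Prop} {Z : Set (ℕ × ℕ)}
  {Γ P Q : List ((ℕ × ℕ) × Bool)} {r : ℤ}

theorem SweptCurves.mono {E' : ℕ × ℕ → ℕ × ℕ → Prop} (h : SweptCurves w E Z Γ r)
    (hE : ∀ y y', E' y y' → E y y') : SweptCurves w E' Z Γ r := by
  obtain ⟨lab, Cl, ori, hi, A, h, hr⟩ := h
  exact ⟨lab, Cl, ori, hi, A, { h with edge := fun y y' hy => h.edge y y' (hE y y' hy) }, hr⟩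

/-- Prolong all open ends at once: `φ` maps an end to its new position, and `ψ` is the inverse of
`φ`. -/
theorem SweptCurves.extend (h : SweptCurves w E Z Γ r) (φ ψ : ℕ × ℕ → ℕ × ℕ)
    (hZ : ∀ e ∈ Γ, φ e.1 ∉ Z) (hψ : ∀ e ∈ Γ, ψ (φ e.1) = e.1)
    (hφ : ∀ e ∈ Γ, Relation.EqvGen (CurveStep w) e.1 (φ e.1)) :
    SweptCurves w (fun y y' => E y y' ∨ ∃ e ∈ Γ, y = e.1 ∧ y' = φ e.1)
      (Z ∪ {z | ∃ e ∈ Γ, z = φ e.1}) (Γ.map fun e => (φ e.1, e.2)) r := by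
  classical
  obtain ⟨lab, Cl, ori, hi, A, h, hr⟩ := h
  let lab' : ℕ × ℕ → ℕ × ℕ := fun z => if z ∈ Z then lab z else lab (ψ z)
  have h1 : ∀ z ∈ Z, lab' z = lab z := fun z hz => if_pos hz
  have h2 : ∀ e ∈ Γ, lab' (φ e.1) = lab e.1 := fun e he => by
    simp only [lab', if_neg (hZ e he), hψ e he]
  refine ⟨lab', Cl, ori, hi, A, ⟨?_, ?_, ?_, ?_, ?_, ?_, ?_⟩, hr⟩
  · rintro y y' (hE | ⟨e, he, rfl, rfl⟩)
    · obtain ⟨ha, hb, hc⟩ := h.edge y y' hE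
      exact ⟨.inl ha, .inl hb, by rw [h1 _ ha, h1 _ hb, hc]⟩
    · exact ⟨.inl (h.mem e he), .inr ⟨e, he, rfl⟩, by rw [h1 _ (h.mem e he), h2 e he]⟩
  · rintro z (hz | ⟨e, he, rfl⟩)
    · obtain ⟨ha, hb, hc⟩ := h.rep z hz
      rw [h1 z hz, h1 _ ha]
      exact ⟨.inl ha, hb, hc⟩
    · obtain ⟨ha, hb, hc⟩ := h.rep _ (h.mem e he)
      rw [h2 e he, h1 _ ha]
      exact ⟨.inl ha, (hφ e he).symm.trans _ _ _ hb, hc⟩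
  · rw [List.map_map]
    convert h.nc using 1
    apply List.map_congr_left
    intro e he
    simp only [Function.comp, h2 e he]
  · intro e he
    obtain ⟨e', he', rfl⟩ := List.mem_map.1 he
    exact .inr ⟨e', he', rfl⟩
  · have key : ∀ z ∈ Z, lab z ∈ Cl ∨
        ∃ e ∈ Γ.map fun e => (φ e.1, e.2), lab' e.1 = lab z := by
      intro z hz
      rcases h.cover z hz with hc | ⟨e, he, hc⟩
      · exact .inl hc
      · exact .inr ⟨_, List.mem_map_of_mem he, by rw [h2 e he, hc]⟩
    rintro z (hz | ⟨e, he, rfl⟩)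
    · rw [h1 z hz]; exact key z hz
    · rw [h2 e he]; exact key _ (h.mem e he)
  · intro e he
    obtain ⟨e', he', rfl⟩ := List.mem_map.1 he
    rw [h2 e' he']; exact h.disj e' he'
  · intro x hx
    obtain ⟨ha, hb, hc, hd⟩ := h.top x hx
    refine ⟨.inl ha, by rw [h1 _ ha, hb], hc, ?_⟩
    rintro z (hz | ⟨e, he, rfl⟩) hzx
    · rw [h1 z hz] at hzx; exact hd z hz hzx
    · rw [h2 e he] at hzx
      exact absurd (hzx ▸ hx) (h.disj e he)

/-- A new minimum adds an open arc. -/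
theorem SweptCurves.cup (h : SweptCurves w E Z (P ++ Q) r) (z z' : ℕ × ℕ) (o : Bool)
    (hz : z ∉ Z) (hz' : z' ∉ Z) (hzz : Relation.EqvGen (CurveStep w) z z') :
    SweptCurves w (fun y y' => E y y' ∨ (y = z ∧ y' = z') ∨ (y = z' ∧ y' = z)) (Z ∪ {z, z'})
      (P ++ (z, o) :: (z', !o) :: Q) (r - if o then 0 else 1) := by
  classical
  obtain ⟨lab, Cl, ori, hi, A, h, hr⟩ := h
  let lab' : ℕ × ℕ → ℕ × ℕ := fun v => if v = z ∨ v = z' then z else lab v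
  have h1 : ∀ v ∈ Z, lab' v = lab v := fun v hv => if_neg (by rintro (rfl | rfl) <;> contradiction)
  have h2 : lab' z = z := if_pos (.inl rfl)
  have h3 : lab' z' = z := if_pos (.inr rfl)
  have hCl : z ∉ Cl := fun hc => by
    obtain ⟨ha, hb, -⟩ := h.top z hc
    exact hz (hb ▸ (h.rep _ ha).1)
  refine ⟨lab', Cl, ori, hi, A + if o then 0 else 1, ⟨?_, ?_, ?_, ?_, ?_, ?_, ?_⟩, ?_⟩
  · rintro y y' (hE | ⟨rfl, rfl⟩ | ⟨rfl, rfl⟩)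
    · obtain ⟨ha, hb, hc⟩ := h.edge y y' hE
      exact ⟨.inl ha, .inl hb, by rw [h1 _ ha, h1 _ hb, hc]⟩
    · exact ⟨by simp, by simp, by rw [h2, h3]⟩
    · exact ⟨by simp, by simp, by rw [h2, h3]⟩
  · rintro v (hv | rfl | rfl)
    · obtain ⟨ha, hb, hc⟩ := h.rep v hv
      rw [h1 v hv, h1 _ ha]
      exact ⟨.inl ha, hb, hc⟩
    · rw [h2]; exact ⟨by simp, .refl _, h2⟩
    · rw [h3]; exact ⟨by simp, hzz.symm, h2⟩
  · rw [List.map_append, List.map_cons, List.map_cons, h2, h3]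
    have h4 : ∀ L : List ((ℕ × ℕ) × Bool), (∀ e ∈ L, e ∈ P ++ Q) →
        L.map (fun e => (lab' e.1, e.2)) = L.map fun e => (lab e.1, e.2) := fun L hL =>
      List.map_congr_left fun e he => by rw [h1 _ (h.mem e (hL e he))]
    rw [h4 P (by simp +contextual), h4 Q (by simp +contextual)]
    refine .insert _ _ _ _ _ (by simpa using h.nc) ?_
    intro o' ho
    rw [← List.map_append, List.mem_map] at ho
    obtain ⟨e, he, h5⟩ := ho
    simp only [Prod.mk.injEq] at h5
    exact hz (h5.1 ▸ (h.rep _ (h.mem e he)).1)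
  · intro e he
    simp only [List.mem_append, List.mem_cons] at he
    rcases he with he | rfl | rfl | he
    · exact .inl (h.mem e (by simp [he]))
    · simp
    · simp
    · exact .inl (h.mem e (by simp [he]))
  · rintro v (hv | rfl | rfl)
    · rw [h1 v hv]
      rcases h.cover v hv with hc | ⟨e, he, hc⟩
      · exact .inl hc
      · refine .inr ⟨e, ?_, by rw [h1 _ (h.mem e he), hc]⟩
        simp only [List.mem_append, List.mem_cons] at he ⊢
        tauto
    · exact .inr ⟨(v, o), by simp, rfl⟩
    · exact .inr ⟨(v, !o), by simp, rfl⟩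
  · intro e he
    simp only [List.mem_append, List.mem_cons] at he
    rcases he with he | rfl | rfl | he
    · rw [h1 _ (h.mem e (by simp [he]))]; exact h.disj e (by simp [he])
    · rw [h2]; exact hCl
    · rw [h3]; exact hCl
    · rw [h1 _ (h.mem e (by simp [he]))]; exact h.disj e (by simp [he])
  · intro x hx
    obtain ⟨ha, hb, hc, hd⟩ := h.top x hx
    refine ⟨.inl ha, by rw [h1 _ ha, hb], hc, ?_⟩
    rintro v (hv | rfl | rfl) hvx
    · rw [h1 v hv] at hvx; exact hd v hv hvx
    · rw [h2] at hvx; exact absurd (hvx ▸ hx) hCl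
    · rw [h3] at hvx; exact absurd (hvx ▸ hx) hCl
  · rw [hr]; push_cast; split_ifs <;> ring

/-- A new maximum closes an arc or joins two arcs. In both cases the difference increases by one if
its left half is directed upwards, and it does not change otherwise. -/
theorem SweptCurves.cap {z z' : ℕ × ℕ} {o : Bool}
    (h : SweptCurves w E Z (P ++ (z, o) :: (z', !o) :: Q) r)
    (hzz : Relation.EqvGen (CurveStep w) z z') (hle : ∀ v ∈ Z, v.1 ≤ z.1) (ht : IsTop w z o) :
    SweptCurves w (fun y y' => E y y' ∨ (y = z ∧ y' = z') ∨ (y = z' ∧ y' = z)) Z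
      (P ++ Q) (r + if o then 1 else 0) := by
  classical
  obtain ⟨lab, Cl, ori, hi, A, h, hr⟩ := h
  have hz : z ∈ Z := h.mem (z, o) (by simp)
  have hz' : z' ∈ Z := h.mem (z', !o) (by simp)
  have hzC : lab z ∉ Cl := h.disj (z, o) (by simp)
  have hzC' : lab z' ∉ Cl := h.disj (z', !o) (by simp)
  have hsub : ∀ e ∈ P ++ Q, e ∈ P ++ (z, o) :: (z', !o) :: Q := by
    intro e he
    simp only [List.mem_append, List.mem_cons] at he ⊢
    tauto
  have hnc := h.nc
  rw [List.map_append, List.map_cons, List.map_cons] at hnc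
  obtain ⟨hc₁, hc₂⟩ := hnc.cap
  rw [← List.map_append] at hc₁ hc₂
  by_cases hl : lab z = lab z'
  · obtain ⟨hx, A', hA, hm⟩ := hc₁ hl
    refine ⟨lab, insert (lab z) Cl, Function.update ori (lab z) o, Function.update hi (lab z) z,
      A', ⟨?_, h.rep, hm, fun e he => h.mem e (hsub e he), ?_, ?_, ?_⟩, ?_⟩
    · rintro y y' (hE | ⟨rfl, rfl⟩ | ⟨rfl, rfl⟩)
      · exact h.edge y y' hE
      · exact ⟨hz, hz', hl⟩
      · exact ⟨hz', hz, hl.symm⟩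
    · intro v hv
      rcases h.cover v hv with hc | ⟨e, he, hc⟩
      · exact .inl (by simp [hc])
      · simp only [List.mem_append, List.mem_cons] at he
        rcases he with he | rfl | rfl | he
        · exact .inr ⟨e, by simp [he], hc⟩
        · exact .inl (by rw [← hc]; simp)
        · exact .inl (by rw [← hc, ← hl]; simp)
        · exact .inr ⟨e, by simp [he], hc⟩
    · intro e he
      rw [Finset.mem_insert]
      rintro (h1 | h1)
      · exact hx e.2 (List.mem_map.2 ⟨e, he, by rw [h1]⟩)
      · exact h.disj e (hsub e he) h1
    · intro x hx
      rcases Finset.mem_insert.1 hx with rfl | hx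
      · simp only [Function.update_self]
        exact ⟨hz, trivial, ht, fun v hv _ => hle v hv⟩
      · have hne : x ≠ lab z := by rintro rfl; exact hzC hx
        rw [Function.update_of_ne hne, Function.update_of_ne hne]
        exact h.top x hx
    · have h1 : ∑ x ∈ Cl, (if Function.update ori (lab z) o x then (1 : ℤ) else -1) =
          ∑ x ∈ Cl, (if ori x then (1 : ℤ) else -1) := Finset.sum_congr rfl fun x hx => by
        rw [Function.update_of_ne (show x ≠ lab z by rintro rfl; exact hzC hx)]
      rw [Finset.sum_insert hzC, Function.update_self, hr, hA, h1]
      push_cast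
      split_ifs <;> ring
  · obtain ⟨⟨o', hx⟩, A', hA, hm⟩ := hc₂ hl
    have hrel : ∀ v, relabel (lab z) (lab z') v = v ∨
        (v = lab z' ∧ relabel (lab z) (lab z') v = lab z) := by
      intro v
      unfold relabel
      split_ifs <;> tauto
    have hrel' : ∀ v ∈ Cl, relabel (lab z) (lab z') v = v := fun v hv =>
      if_neg (by rintro rfl; exact hzC' hv)
    have hrz : relabel (lab z) (lab z') (lab z) = lab z := if_neg hl
    refine ⟨fun v => relabel (lab z) (lab z') (lab v), Cl, ori, hi, A',
      ⟨?_, ?_, ?_, fun e he => h.mem e (hsub e he), ?_, ?_, ?_⟩, ?_⟩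
    · rintro y y' (hE | ⟨rfl, rfl⟩ | ⟨rfl, rfl⟩)
      · obtain ⟨ha, hb, hc⟩ := h.edge y y' hE
        exact ⟨ha, hb, by rw [hc]⟩
      · exact ⟨hz, hz', by simp [relabel]⟩
      · exact ⟨hz', hz, by simp [relabel]⟩
    · intro v hv
      obtain ⟨ha, hb, hc⟩ := h.rep v hv
      rcases hrel (lab v) with h1 | ⟨h1, h2⟩
      · rw [h1, hc]; exact ⟨ha, hb, h1⟩
      · rw [h2, (h.rep z hz).2.2]
        refine ⟨(h.rep z hz).1, ?_, hrz⟩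
        rw [h1] at hb
        exact (hb.trans _ _ _ (h.rep z' hz').2.1.symm).trans _ _ _
          (hzz.symm.trans _ _ _ (h.rep z hz).2.1)
    · simpa [List.map_map, Function.comp_def] using hm
    · intro v hv
      obtain ⟨e₀, he₀, h₀⟩ := List.mem_map.1 hx
      simp only [Prod.mk.injEq] at h₀
      rcases h.cover v hv with hc | ⟨e, he, hc⟩
      · exact .inl (by rw [hrel' _ hc]; exact hc)
      · right
        simp only [List.mem_append, List.mem_cons] at he
        rcases he with he | rfl | rfl | he
        · exact ⟨e, by simp [he], by rw [hc]⟩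
        · exact ⟨e₀, he₀, by rw [← hc, h₀.1]⟩
        · exact ⟨e₀, he₀, by rw [← hc, h₀.1, hrz]; simp [relabel]⟩
        · exact ⟨e, by simp [he], by rw [hc]⟩
    · intro e he
      rcases hrel (lab e.1) with h1 | ⟨h1, h2⟩
      · rw [h1]; exact h.disj e (hsub e he)
      · rw [h2]; exact hzC
    · intro x hx
      obtain ⟨ha, hb, hc, hd⟩ := h.top x hx
      refine ⟨ha, by rw [hb, hrel' x hx], hc, fun v hv hvx => ?_⟩
      rcases hrel (lab v) with h1 | ⟨h1, h2⟩
      · exact hd v hv (h1 ▸ hvx)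
      · rw [h2] at hvx
        exact absurd (hvx ▸ hx) hzC
    · rw [hr, hA]; push_cast; split_ifs <;> ring

/-! ### Open ends on a horizontal line -/

/-- Consecutive points on the line `k`, starting with number `q`, with the directions `D`. -/
def linePoints (k : ℕ) : ℕ → List Bool → List ((ℕ × ℕ) × Bool)
  | _, [] => []
  | q, b :: D => ((k, q), b) :: linePoints k (q + 1) D

theorem linePoints_append (k q : ℕ) (D D' : List Bool) :
    linePoints k q (D ++ D') = linePoints k q D ++ linePoints k (q + D.length) D' := by
  induction D generalizing q with
  | nil => rfl
  | cons b D ih =>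
    simp only [List.cons_append, linePoints, ih, List.length_cons]
    congr 3; omega

theorem mem_linePoints {k q : ℕ} {D : List Bool} {z : ℕ × ℕ} :
    (∃ e ∈ linePoints k q D, z = e.1) ↔ z.1 = k ∧ q ≤ z.2 ∧ z.2 < q + D.length := by
  induction D generalizing q with
  | nil => simp [linePoints]
  | cons b D ih =>
    simp only [linePoints, List.mem_cons, exists_eq_or_imp, ih, List.length_cons]
    obtain ⟨a, b⟩ := z
    simp only [Prod.mk.injEq]
    omega

theorem linePoints_map (k k' q q' : ℕ) (D : List Bool) (φ : ℕ × ℕ → ℕ × ℕ)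
    (hφ : ∀ j < D.length, φ (k, q + j) = (k', q' + j)) :
    ((linePoints k q D).map fun e => (φ e.1, e.2)) = linePoints k' q' D := by
  induction D generalizing q q' with
  | nil => rfl
  | cons b D ih =>
    simp only [linePoints, List.map_cons]
    rw [ih (q + 1) (q' + 1)]
    · have := hφ 0 (by simp)
      simp only [Nat.add_zero] at this
      rw [this]
    · intro j hj
      have := hφ (j + 1) (by simpa using hj)
      rw [Nat.add_assoc, Nat.add_comm 1 j, this]; congr 1; omega

/-- The directions of `i` nested arcs. -/
def nestDirs (i : ℕ) (o : Bool) : List Bool := List.replicate i o ++ List.replicate i (!o)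

theorem nestDirs_succ (i : ℕ) (o : Bool) :
    nestDirs (i + 1) o = [o] ++ nestDirs i o ++ [!o] := by
  have h : List.replicate (i + 1) (!o) = List.replicate i (!o) ++ [!o] := List.replicate_succ'
  rw [nestDirs, nestDirs, h, List.replicate_succ]
  simp

theorem length_nestDirs (i : ℕ) (o : Bool) : (nestDirs i o).length = 2 * i := by
  simp [nestDirs]; omega

theorem linePoints_nestDirs (k a i : ℕ) (o : Bool) :
    linePoints k a (nestDirs (i + 1) o) =
      ((k, a), o) :: (linePoints k (a + 1) (nestDirs i o) ++ [((k, a + 2 * i + 1), !o)]) := by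
  rw [nestDirs_succ, linePoints_append, linePoints_append]
  have h : a + ([o] ++ nestDirs i o).length = a + 2 * i + 1 := by
    rw [List.length_append, length_nestDirs, List.length_singleton]; omega
  rw [h]
  rfl

/-- Steps between the ends of `i` nested arcs. -/
def NestStep (k a i : ℕ) (y y' : ℕ × ℕ) : Prop :=
  ∃ q < 2 * i, y = (k, a + q) ∧ y' = (k, a + (2 * i - 1 - q))

theorem NestStep.succ {k a i : ℕ} {y y' : ℕ × ℕ} (h : NestStep k a (i + 1) y y') :
    (y = (k, a) ∧ y' = (k, a + 2 * i + 1)) ∨ (y = (k, a + 2 * i + 1) ∧ y' = (k, a)) ∨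
      NestStep k (a + 1) i y y' := by
  obtain ⟨q, hq, rfl, rfl⟩ := h
  simp only [Prod.mk.injEq, true_and, NestStep]
  by_cases h1 : q = 0
  · left; omega
  by_cases h2 : q = 2 * i + 1
  · right; left; omega
  · right; right
    exact ⟨q - 1, by omega, by omega, by omega⟩

theorem NestStep.of_succ {k a i : ℕ} {y y' : ℕ × ℕ} (h : NestStep k (a + 1) i y y') :
    NestStep k a (i + 1) y y' := by
  obtain ⟨q, hq, rfl, rfl⟩ := h
  refine ⟨q + 1, by omega, ?_, ?_⟩ <;> (congr 1; omega)

/-- The minima of `i` nested arcs, from the outermost to the innermost one. -/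
theorem SweptCurves.cups (k a i : ℕ) (o : Bool) (h : SweptCurves w E Z (P ++ Q) r)
    (hZ : ∀ q < 2 * i, (k, a + q) ∉ Z)
    (hs : ∀ y y', NestStep k a i y y' → Relation.EqvGen (CurveStep w) y y') :
    SweptCurves w (fun y y' => E y y' ∨ NestStep k a i y y')
      (Z ∪ {z | ∃ q < 2 * i, z = (k, a + q)})
      (P ++ linePoints k a (nestDirs i o) ++ Q) (r - if o then 0 else (i : ℤ)) := by
  induction i generalizing a E Z P Q r with
  | zero => simpa [nestDirs, linePoints, NestStep] using h
  | succ i ih =>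
    have h1 := h.cup (k, a) (k, a + 2 * i + 1) o (hZ 0 (by omega)) (hZ (2 * i + 1) (by omega))
      (hs _ _ ⟨0, by omega, rfl, by congr 1⟩)
    have h2 : P ++ ((k, a), o) :: ((k, a + 2 * i + 1), !o) :: Q =
      (P ++ [((k, a), o)]) ++ (((k, a + 2 * i + 1), !o) :: Q) := by simp
    rw [h2] at h1
    have h3 := ih (a + 1) h1 (by
      intro q hq hz
      rcases hz with hz | hz | hz
      · exact hZ (q + 1) (by omega) (by rw [← Nat.add_assoc, Nat.add_right_comm]; exact hz)
      · simp only [Prod.mk.injEq] at hz; omega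
      · simp only [Set.mem_singleton_iff, Prod.mk.injEq] at hz; omega)
      (fun y y' hy => hs y y' hy.of_succ)
    convert h3.mono ?_ using 1
    · ext ⟨u, v⟩
      simp only [Set.mem_union, Set.mem_ofPred_eq, Set.mem_insert_iff, Set.mem_singleton_iff,
        Prod.mk.injEq]
      constructor
      · rintro (h | ⟨q, hq, rfl, rfl⟩)
        · tauto
        · by_cases h1 : q = 0
          · simp [h1]
          by_cases h2 : q = 2 * i + 1
          · left; right; right; exact ⟨rfl, by omega⟩
          · right; exact ⟨q - 1, by omega, rfl, by omega⟩
      · rintro ((h | ⟨rfl, rfl⟩ | ⟨rfl, rfl⟩) | ⟨q, hq, rfl, rfl⟩)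
        · exact .inl h
        · exact .inr ⟨0, by omega, rfl, rfl⟩
        · exact .inr ⟨2 * i + 1, by omega, rfl, rfl⟩
        · exact .inr ⟨q + 1, by omega, rfl, by omega⟩
    · rw [linePoints_nestDirs]; simp
    · cases o <;> simp; ring
    · rintro y y' (h | h)
      · tauto
      · rcases h.succ with h | h | h <;> tauto

/-- The maxima of `i` nested arcs, from the innermost to the outermost one. -/
theorem SweptCurves.caps (k a i : ℕ) (o : Bool)
    (h : SweptCurves w E Z (P ++ linePoints k a (nestDirs i o) ++ Q) r)
    (hle : ∀ v ∈ Z, v.1 ≤ k) (ht : ∀ q < 2 * i, IsTop w (k, a + q) o)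
    (hs : ∀ y y', NestStep k a i y y' → Relation.EqvGen (CurveStep w) y y') :
    SweptCurves w (fun y y' => E y y' ∨ NestStep k a i y y') Z
      (P ++ Q) (r + if o then (i : ℤ) else 0) := by
  induction i generalizing a P Q with
  | zero => simpa [nestDirs, linePoints, NestStep] using h
  | succ i ih =>
    rw [linePoints_nestDirs] at h
    have h1 := ih (a + 1) (P := P ++ [((k, a), o)]) (Q := ((k, a + 2 * i + 1), !o) :: Q)
      (by simpa using h)
      (fun q hq => by
        have := ht (q + 1) (by omega)
        rwa [← Nat.add_assoc, Nat.add_right_comm] at this)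
      (fun y y' hy => hs y y' hy.of_succ)
    rw [List.append_assoc, List.singleton_append] at h1
    have h2 := h1.cap (hs _ _ ⟨0, by omega, rfl, by congr 1⟩) hle (ht 0 (by omega))
    convert h2.mono ?_ using 1
    · cases o <;> simp; ring
    · rintro y y' (h | h)
      · tauto
      · rcases h.succ with h | h | h <;> tauto

end

noncomputable section

/-! ### The colored curliness as a sum over the layers -/

/-- The directions of the resolved strands on a horizontal line. -/
def dirs (S : List Strand) : List Bool := S.flatMap fun s => List.replicate s.color s.up

theorem length_dirs (S : List Strand) : (dirs S).length = width S := by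
  simp [dirs, width, List.length_flatMap]

theorem dirs_append (S T : List Strand) : dirs (S ++ T) = dirs S ++ dirs T := by simp [dirs]

theorem width_append (S T : List Strand) : width (S ++ T) = width S + width T := by simp [width]

theorem dirs_pair (s : Strand) : dirs [s, s.rev] = nestDirs s.color s.up := by
  simp [dirs, nestDirs, Strand.rev]

theorem width_pair (s : Strand) : width [s, s.rev] = 2 * s.color := by
  simp [width, Strand.rev]; omega

/-- The contribution of a piece to the difference of the numbers of clockwise and counterclockwise
curves. A clockwise curve with a single maximum goes up on its left-hand side, and a
counterclockwise one goes down there. -/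
def Piece.rot : Piece → ℤ
  | cup s => if s.up then 0 else -s.color
  | cap s => if s.up then s.color else 0
  | _ => 0

/-- The sum of the rotation numbers of the pieces. -/
def rot (w : List Layer) : ℤ := (w.map fun l => l.piece.rot).sum

theorem rot_append (w w' : List Layer) : rot (w ++ w') = rot w + rot w' := by simp [rot]

/-- The steps of `CurveStep` within the layer `l` of number `k`. -/
def LayerStep (l : Layer) (k : ℕ) (y y' : ℕ × ℕ) : Prop :=
  (∃ q < width l.left, y = (k, q) ∧ y' = (k + 1, q)) ∨
  (∃ r < width l.right, y = (k, width l.left + width l.piece.dom + r) ∧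
    y' = (k + 1, width l.left + width l.piece.cod + r)) ∨
  (∃ q, q < width l.piece.dom ∧ q < width l.piece.cod ∧ y = (k, width l.left + q) ∧
    y' = (k + 1, width l.left + q)) ∨
  (∃ s, l.piece = .cup s ∧ NestStep (k + 1) (width l.left) s.color y y') ∨
  (∃ s, l.piece = .cap s ∧ NestStep k (width l.left) s.color y y')

theorem curveStep_iff {w : List Layer} {y y' : ℕ × ℕ} :
    CurveStep w y y' ↔ ∃ (k : ℕ) (hk : k < w.length), LayerStep w[k] k y y' := by
  constructor
  · rintro (⟨k, q, hq⟩ | ⟨k, q, hq⟩ | ⟨k, q, hq, hq'⟩ | ⟨k, s, hs, q, hq⟩ | ⟨k, s, hs, q, hq⟩)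
    · exact ⟨k, k.2, .inl ⟨q, hq, rfl, rfl⟩⟩
    · exact ⟨k, k.2, .inr (.inl ⟨q, hq, rfl, rfl⟩)⟩
    · exact ⟨k, k.2, .inr (.inr (.inl ⟨q, hq, hq', rfl, rfl⟩))⟩
    · exact ⟨k, k.2, .inr (.inr (.inr (.inl ⟨s, hs, q, hq, rfl, rfl⟩)))⟩
    · exact ⟨k, k.2, .inr (.inr (.inr (.inr ⟨s, hs, q, hq, rfl, rfl⟩)))⟩
  · rintro ⟨k, hk, ⟨q, hq, rfl, rfl⟩ | ⟨q, hq, rfl, rfl⟩ | ⟨q, hq, hq', rfl, rfl⟩ |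
      ⟨s, hs, q, hq, rfl, rfl⟩ | ⟨s, hs, q, hq, rfl, rfl⟩⟩
    · exact .left ⟨k, hk⟩ q hq
    · exact .right ⟨k, hk⟩ q hq
    · exact .through ⟨k, hk⟩ q hq hq'
    · exact .cup ⟨k, hk⟩ s hs q hq
    · exact .cap ⟨k, hk⟩ s hs q hq

variable {w : List Layer} {E : ℕ × ℕ → ℕ × ℕ → Prop} {Z : Set (ℕ × ℕ)} {r : ℤ}

/-- Vertical strands to the left and to the right of a piece with `m` ends at the bottom and `n`
ends at the top. -/
theorem SweptCurves.layer (k a m n : ℕ) (L R : List Bool) (ha : L.length = a)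
    (h : SweptCurves w E Z (linePoints k 0 L ++ linePoints k (a + m) R) r)
    (hZ : ∀ q, (k + 1, q) ∉ Z)
    (hl : ∀ q < a, Relation.EqvGen (CurveStep w) (k, q) (k + 1, q))
    (hr : ∀ q < R.length, Relation.EqvGen (CurveStep w) (k, a + m + q) (k + 1, a + n + q)) :
    SweptCurves w (fun y y' => E y y' ∨ (∃ q < a, y = (k, q) ∧ y' = (k + 1, q)) ∨
        ∃ q < R.length, y = (k, a + m + q) ∧ y' = (k + 1, a + n + q))
      (Z ∪ {z | z.1 = k + 1 ∧ (z.2 < a ∨ a + n ≤ z.2 ∧ z.2 < a + n + R.length)})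
      (linePoints (k + 1) 0 L ++ linePoints (k + 1) (a + n) R) r := by
  let φ : ℕ × ℕ → ℕ × ℕ := fun z => (k + 1, if z.2 < a then z.2 else z.2 - m + n)
  let ψ : ℕ × ℕ → ℕ × ℕ := fun z => (k, if z.2 < a then z.2 else z.2 - n + m)
  have hmem : ∀ z : ℕ × ℕ, (∃ e ∈ linePoints k 0 L ++ linePoints k (a + m) R, z = e.1) ↔
      z.1 = k ∧ (z.2 < a ∨ a + m ≤ z.2 ∧ z.2 < a + m + R.length) := by
    intro z
    simp only [List.mem_append, or_and_right, exists_or, mem_linePoints, ha]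
    omega
  have hmem' : ∀ e ∈ linePoints k 0 L ++ linePoints k (a + m) R,
      e.1.1 = k ∧ (e.1.2 < a ∨ a + m ≤ e.1.2 ∧ e.1.2 < a + m + R.length) := fun e he =>
    (hmem e.1).1 ⟨e, he, rfl⟩
  have hφl : ∀ q < a, φ (k, q) = (k + 1, q) := fun q hq => by simp [φ, hq]
  have hφr : ∀ q, φ (k, a + m + q) = (k + 1, a + n + q) := fun q => by
    simp only [φ]; rw [if_neg (by omega)]; congr 1; omega
  have h1 := h.extend φ ψ (fun e he => hZ _) (fun e he => by
      obtain ⟨h1, h2⟩ := hmem' e he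
      obtain ⟨⟨a', b'⟩, o⟩ := e
      simp only at h1 h2
      subst h1
      simp only [φ, ψ, Prod.mk.injEq, true_and]
      split_ifs <;> omega)
    (fun e he => by
      obtain ⟨h1, h2⟩ := hmem' e he
      obtain ⟨⟨a', b'⟩, o⟩ := e
      simp only at h1 h2
      subst h1
      rcases h2 with h2 | ⟨h2, h3⟩
      · rw [hφl _ h2]; exact hl _ h2
      · obtain ⟨q, rfl⟩ := Nat.exists_eq_add_of_le h2
        rw [hφr]; exact hr q (by omega))
  convert h1.mono ?_ using 1
  · congr 1
    ext ⟨u, v⟩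
    simp only [Set.mem_ofPred_eq]
    constructor
    · rintro ⟨rfl, hv⟩
      rcases hv with hv | ⟨hv, hv'⟩
      · obtain ⟨e, he, h2⟩ := (hmem (k, v)).2 ⟨rfl, .inl hv⟩
        exact ⟨e, he, by rw [← h2, hφl v hv]⟩
      · obtain ⟨q, rfl⟩ := Nat.exists_eq_add_of_le hv
        obtain ⟨e, he, h2⟩ := (hmem (k, a + m + q)).2 ⟨rfl, .inr (by simp; omega)⟩
        exact ⟨e, he, by rw [← h2, hφr q]⟩
    · rintro ⟨e, he, h2⟩
      obtain ⟨h3, h4⟩ := hmem' e he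
      simp only [φ, Prod.mk.injEq] at h2
      obtain ⟨rfl, rfl⟩ := h2
      refine ⟨rfl, ?_⟩
      split_ifs <;> omega
  · rw [List.map_append]
    rw [linePoints_map k (k + 1) 0 0 L φ (fun j hj => by
        simpa using hφl j (ha ▸ hj)),
      linePoints_map k (k + 1) (a + m) (a + n) R φ (fun j _ => hφr j)]
  · rintro y y' (h | ⟨q, hq, rfl, rfl⟩ | ⟨q, hq, rfl, rfl⟩)
    · exact .inl h
    · obtain ⟨e, he, h2⟩ := (hmem (k, q)).2 ⟨rfl, .inl hq⟩
      exact .inr ⟨e, he, h2, by rw [← h2, hφl q hq]⟩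
    · obtain ⟨e, he, h2⟩ := (hmem (k, a + m + q)).2 ⟨rfl, .inr (by simp; omega)⟩
      exact .inr ⟨e, he, h2, by rw [← h2, hφr q]⟩

/-- The resolved strands on the lines up to number `k`. -/
def pointsBelow (w : List Layer) (k : ℕ) : Set (ℕ × ℕ) :=
  {z | z.1 ≤ k ∧ z.2 < width (strandsAt w z.1)}

/-- Pass from the line number `k` to the next one. -/
theorem sweptCurves_succ {k : ℕ} (hk : k < w.length) (hs : w[k].source = strandsAt w k)
    (ht : w[k].target = strandsAt w (k + 1))
    (h : SweptCurves w E (pointsBelow w k) (linePoints k 0 (dirs (strandsAt w k))) r) :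
    SweptCurves w (fun y y' => E y y' ∨ LayerStep w[k] k y y') (pointsBelow w (k + 1))
      (linePoints (k + 1) 0 (dirs (strandsAt w (k + 1)))) (r + w[k].piece.rot) := by
  have hcs : ∀ y y', LayerStep w[k] k y y' → Relation.EqvGen (CurveStep w) y y' := fun y y' hy =>
    .rel _ _ (curveStep_iff.2 ⟨k, hk, hy⟩)
  have hZ : ∀ q, (k + 1, q) ∉ pointsBelow w k := fun q hq => by
    have := hq.1; simp at this
  have hZ' : pointsBelow w (k + 1) =
      pointsBelow w k ∪ {z | z.1 = k + 1 ∧ z.2 < width w[k].target} := by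
    ext ⟨u, v⟩
    simp only [pointsBelow, Set.mem_union, Set.mem_ofPred_eq, Nat.le_succ_iff, or_and_right]
    apply or_congr_right
    apply and_congr_right
    rintro rfl
    rw [ht]
  have htop : ∀ s q, w[k].piece = .cap s → q < 2 * s.color →
      IsTop w (k, width w[k].left + q) s.up := fun s q h hq =>
    ⟨⟨k, hk⟩, s, q, h, rfl, hq, rfl⟩
  rw [hZ', ← ht]
  rw [← hs] at h
  generalize w[k] = l at *
  obtain ⟨L, p, R⟩ := l
  simp only [Layer.source, Layer.target, dirs_append, width_append] at h ⊢
  -- a piece through which the resolved strands run in parallel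
  have key : dirs p.dom = dirs p.cod → p.rot = 0 → (∀ s, p ≠ .cup s) → (∀ s, p ≠ .cap s) →
      SweptCurves w (fun y y' => E y y' ∨ LayerStep ⟨L, p, R⟩ k y y')
      (pointsBelow w k ∪ {z | z.1 = k + 1 ∧ z.2 < width L + width p.cod + width R})
      (linePoints (k + 1) 0 (dirs L ++ dirs p.cod ++ dirs R)) (r + p.rot) := by
    intro hd hrot h1 h2
    have hw : width p.dom = width p.cod := by rw [← length_dirs, hd, length_dirs]
    have ha : (dirs L ++ dirs p.dom).length = width L + width p.dom := by
      rw [List.length_append, length_dirs, length_dirs]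
    rw [linePoints_append, ha, Nat.zero_add] at h
    have h3 := SweptCurves.layer k (width L + width p.dom) 0 0 (dirs L ++ dirs p.dom) (dirs R) ha
      h hZ
      (fun q hq => by
        by_cases hq' : q < width L
        · exact hcs _ _ (.inl ⟨q, hq', rfl, rfl⟩)
        · obtain ⟨q', rfl⟩ := Nat.exists_eq_add_of_le (not_lt.1 hq')
          exact hcs _ _ (.inr (.inr (.inl ⟨q', by simp only; omega, by simp only; omega, rfl,
            rfl⟩))))
      (fun q hq => hcs _ _ (.inr (.inl ⟨q, by simpa [length_dirs] using hq, rfl, by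
        simp [hw]⟩)))
    rw [hrot, add_zero]
    convert h3.mono ?_ using 1
    · congr 1
      ext ⟨u, v⟩
      simp only [Set.mem_ofPred_eq, length_dirs, hw]
      omega
    · rw [linePoints_append, ← hd, ha]; simp
    · rintro y y' (h | h)
      · exact .inl h
      rcases h with ⟨q, hq, rfl, rfl⟩ | ⟨q, hq, rfl, rfl⟩ | ⟨q, hq, hq', rfl, rfl⟩ |
        ⟨s, hs, -⟩ | ⟨s, hs, -⟩
      · exact .inr (.inl ⟨q, by simp only at hq; omega, rfl, rfl⟩)
      · exact .inr (.inr ⟨q, by simpa [length_dirs] using hq, rfl, by simp [hw]⟩)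
      · exact .inr (.inl ⟨_, by simp only at hq ⊢; omega, rfl, rfl⟩)
      · exact absurd hs (h1 s)
      · exact absurd hs (h2 s)
  cases p with
  | pos i j =>
    exact key (by simp [dirs, Piece.dom, Piece.cod, up, Nat.add_comm]) rfl (by simp) (by simp)
  | neg i j =>
    exact key (by simp [dirs, Piece.dom, Piece.cod, up, Nat.add_comm]) rfl (by simp) (by simp)
  | merge i j => exact key (by simp [dirs, Piece.dom, Piece.cod, up]) rfl (by simp) (by simp)
  | split i j => exact key (by simp [dirs, Piece.dom, Piece.cod, up]) rfl (by simp) (by simp)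
  | twist s b => exact key rfl rfl (by simp) (by simp)
  | cup s =>
    clear key
    simp only [Piece.dom, Piece.cod, dirs_pair, width_pair] at h ⊢
    have h0 : dirs [] = [] := rfl
    rw [h0, List.append_nil, linePoints_append, length_dirs, Nat.zero_add] at h
    have h3 := SweptCurves.layer k (width L) 0 (2 * s.color) (dirs L) (dirs R) (length_dirs L)
      h hZ (fun q hq => hcs _ _ (.inl ⟨q, hq, rfl, rfl⟩))
      (fun q hq => hcs _ _ (.inr (.inl ⟨q, by simpa [length_dirs] using hq, rfl, by
        simp [Piece.cod, width_pair]⟩)))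
    have h4 := h3.cups (k + 1) (width L) s.color s.up (by
        rintro q hq (hz | hz)
        · exact hZ _ hz
        · simp only [Set.mem_ofPred_eq] at hz; omega)
      (fun y y' hy => hcs _ _ (.inr (.inr (.inr (.inl ⟨s, rfl, hy⟩)))))
    convert h4.mono ?_ using 1
    · rw [Set.union_assoc]
      congr 1
      ext ⟨u, v⟩
      simp only [Set.mem_ofPred_eq, Set.mem_union, length_dirs, Prod.mk.injEq]
      constructor
      · rintro ⟨rfl, hv⟩
        by_cases h5 : width L ≤ v ∧ v < width L + 2 * s.color
        · exact .inr ⟨v - width L, by omega, rfl, by omega⟩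
        · left; omega
      · rintro (h | ⟨q, h⟩) <;> omega
    · rw [linePoints_append, linePoints_append]
      simp [length_dirs, length_nestDirs]
    · simp only [Piece.rot]; split_ifs <;> ring
    · rintro y y' (h | h)
      · exact .inl (.inl h)
      rcases h with ⟨q, hq, rfl, rfl⟩ | ⟨q, hq, rfl, rfl⟩ | ⟨q, hq, hq', rfl, rfl⟩ |
        ⟨s', hs', hn⟩ | ⟨s', hs', -⟩
      · exact .inl (.inr (.inl ⟨q, hq, rfl, rfl⟩))
      · exact .inl (.inr (.inr ⟨q, by simpa [length_dirs] using hq, rfl, by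
          simp [Piece.cod, width_pair]⟩))
      · simp [Piece.dom, width] at hq
      · cases hs'; exact .inr hn
      · cases hs'
  | cap s =>
    clear key
    simp only [Piece.dom, Piece.cod, dirs_pair] at h ⊢
    have h0 : dirs [] = [] := rfl
    have h0' : width [] = 0 := rfl
    rw [h0, h0', List.append_nil]
    rw [linePoints_append, linePoints_append, List.length_append, length_dirs, length_nestDirs,
      Nat.zero_add, Nat.zero_add] at h
    have h1 := h.caps k (width L) s.color s.up (fun v hv => hv.1)
      (fun q hq => htop s q rfl hq)
      (fun y y' hy => hcs _ _ (.inr (.inr (.inr (.inr ⟨s, rfl, hy⟩)))))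
    have h3 := SweptCurves.layer k (width L) (2 * s.color) 0 (dirs L) (dirs R) (length_dirs L)
      h1 hZ (fun q hq => hcs _ _ (.inl ⟨q, hq, rfl, rfl⟩))
      (fun q hq => hcs _ _ (.inr (.inl ⟨q, by simpa [length_dirs] using hq, by
        simp [Piece.dom, width_pair], rfl⟩)))
    convert h3.mono ?_ using 1
    · congr 1
      ext ⟨u, v⟩
      simp only [Set.mem_ofPred_eq, length_dirs]
      omega
    · rw [linePoints_append]
      simp [length_dirs]
    · rfl
    · rintro y y' (h | h)
      · exact .inl (.inl h)
      rcases h with ⟨q, hq, rfl, rfl⟩ | ⟨q, hq, rfl, rfl⟩ | ⟨q, hq, hq', rfl, rfl⟩ |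
        ⟨s', hs', -⟩ | ⟨s', hs', hn⟩
      · exact .inr (.inl ⟨q, hq, rfl, rfl⟩)
      · exact .inr (.inr ⟨q, by simpa [length_dirs] using hq, by
          simp [Piece.dom, width_pair], rfl⟩)
      · simp [Piece.cod, width] at hq'
      · cases hs'
      · cases hs'; exact .inl (.inr hn)

/-- The part of the resolved curves below the line number `k`. -/
theorem sweptCurves_stage (hw : IsTangle [] w []) {k : ℕ} (hk : k ≤ w.length) :
    SweptCurves w (fun y y' => ∃ j < k, ∃ hj : j < w.length, LayerStep w[j] j y y')
      (pointsBelow w k) (linePoints k 0 (dirs (strandsAt w k))) (rot (w.take k)) := by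
  induction k with
  | zero =>
    have h0 : pointsBelow w 0 = ∅ := by
      ext ⟨u, v⟩
      simp only [pointsBelow, Set.mem_ofPred_eq, Set.mem_empty_iff_false, iff_false, not_and]
      intro hu hv
      obtain rfl : u = 0 := by omega
      simp [strandsAt, width] at hv
    have h1 : strandsAt w 0 = [] := by simp [strandsAt]
    rw [h0, h1]
    exact ⟨id, ∅, fun _ => true, id, 0, ⟨by simp, by simp, .nil, by simp [dirs, linePoints],
      by simp, by simp [dirs, linePoints], by simp⟩, by simp [rot]⟩
  | succ k ih =>
    have h := sweptCurves_succ hk (source_eq_strandsAt hw hk) (target_eq_strandsAt w hk)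
      (ih (by omega))
    convert h.mono ?_ using 1
    · rw [List.take_succ_eq_append_getElem hk, rot_append]
      simp only [rot, List.map_cons, List.map_nil, List.sum_singleton]
    · rintro y y' ⟨j, hj, hj', hs⟩
      rcases Nat.lt_succ_iff_lt_or_eq.1 hj with h1 | rfl
      · exact .inl ⟨j, h1, hj', hs⟩
      · exact .inr hs

/-- The colored curliness is a product of local contributions. At the top of the diagram no open
arcs are left, and the labels of the closed curves enumerate them all. -/
theorem curliness_eq (hw : IsTangle [] w []) : curliness w = tq (2 * rot w) := by
  classical
  have h := sweptCurves_stage hw le_rfl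
  have hn : strandsAt w w.length = [] := by
    have := strandsAt_length hw
    simpa using this
  rw [hn, List.take_length] at h
  obtain ⟨lab, Cl, ori, hi, A, h, hr⟩ := h
  have hA : A = 0 := by
    have := h.nc
    simp only [dirs, List.flatMap_nil, linePoints, List.map_nil] at this
    generalize hl : ([] : List ((ℕ × ℕ) × Bool)) = l at this
    cases this with
    | nil => rfl
    | insert => simp at hl
  have hlab : ∀ y y', Quot.mk (CurveStep w) y = Quot.mk _ y' → lab y = lab y' := by
    intro y y' hy
    have := Quot.eqvGen_exact hy
    induction this with
    | rel a b hab =>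
      obtain ⟨j, hj, hs⟩ := curveStep_iff.1 hab
      exact (h.edge a b ⟨j, hj, hj, hs⟩).2.2
    | refl => rfl
    | symm a b _ ih => exact (ih (Quot.eqvGen_sound ‹_›)).symm
    | trans a b c _ _ ih ih' =>
      exact (ih (Quot.eqvGen_sound ‹_›)).trans (ih' (Quot.eqvGen_sound ‹_›))
  have hpt : ∀ (k : Fin w.length) (s : Strand) (q : ℕ), w[k].piece = .cap s → q < 2 * s.color →
      (k.val, width w[k].left + q) ∈ pointsBelow w w.length := by
    intro k s q hs hq
    refine ⟨k.2.le, ?_⟩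
    have h1 : w[k].source = strandsAt w k := source_eq_strandsAt hw k.2
    simp only
    rw [← h1, Layer.source, hs, width_append, width_append, Piece.dom, width_pair]
    omega
  have hpt' : ∀ ℓ q', q' < width (strandsAt w ℓ) → (ℓ, q') ∈ pointsBelow w w.length := by
    intro ℓ q' hq
    refine ⟨?_, hq⟩
    by_contra hl
    rw [strandsAt, List.getD_eq_default _ _ (by simp at hl ⊢; omega)] at hq
    simp [width] at hq
  have hcard : ∀ b, (orientedCurves w b).ncard = (Cl.filter fun x => ori x = b).card := by
    intro b
    have himg : orientedCurves w b =
        Quot.mk (CurveStep w) '' (Cl.filter fun x => ori x = b : Finset (ℕ × ℕ)) := by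
      ext γ
      constructor
      · rintro ⟨k, s, q, hs, hb, hq, rfl, hmax⟩
        set z : ℕ × ℕ := (k.val, width w[k].left + q) with hz
        have hzZ := hpt k s q hs hq
        rcases h.cover z hzZ with hc | ⟨e, he, -⟩
        · obtain ⟨ha', hb', ⟨k', s', q', hs', ho', hq', hh⟩, hd'⟩ := h.top _ hc
          have h1 : Quot.mk (CurveStep w) z = Quot.mk _ (lab z) :=
            Quot.eqvGen_sound (h.rep z hzZ).2.1
          have h2 : Quot.mk (CurveStep w) (hi (lab z)) = Quot.mk _ (lab z) := by
            have := Quot.eqvGen_sound (h.rep _ ha').2.1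
            rw [hb'] at this; exact this
          have h3 := hd' z hzZ rfl
          have h4 := hmax (hi (lab z)).1 (hi (lab z)).2 ha'.2 (h1.trans h2.symm)
          have h5 : k = k' := by
            apply Fin.ext
            rw [hh] at h3 h4
            simp only [hz] at h3 h4
            omega
          subst h5
          rw [hs] at hs'
          cases hs'
          refine ⟨lab z, ?_, h1.symm⟩
          simp only [Finset.coe_filter, Set.mem_ofPred_eq]
          exact ⟨hc, ho'.symm.trans hb⟩
        · simp [dirs, linePoints] at he
      · rintro ⟨x, hx, rfl⟩
        simp only [Finset.coe_filter, Set.mem_ofPred_eq] at hx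
        obtain ⟨hx, rfl⟩ := hx
        obtain ⟨ha', hb', ⟨k', s', q', hs', ho', hq', hh⟩, hd'⟩ := h.top x hx
        have h2 : Quot.mk (CurveStep w) x = Quot.mk _ (hi x) := by
          have := Quot.eqvGen_sound (h.rep _ ha').2.1
          rw [hb'] at this; exact this.symm
        refine ⟨k', s', q', hs', ho', hq', by rw [h2, hh], ?_⟩
        intro ℓ q'' hq'' hγ
        have h3 := hd' (ℓ, q'') (hpt' ℓ q'' hq'') (by
          rw [← hlab _ _ (h2.symm.trans hγ), hb'])
        rw [hh] at h3
        exact h3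
    rw [himg, Set.InjOn.ncard_image, Set.ncard_coe_finset]
    intro x hx y hy hxy
    simp only [Finset.coe_filter, Set.mem_ofPred_eq] at hx hy
    have h1 : ∀ x ∈ Cl, lab x = x := fun x hx => by
      obtain ⟨ha', hb', -⟩ := h.top x hx
      have := (h.rep _ ha').2.2
      rwa [hb'] at this
    rw [← h1 x hx.1, ← h1 y hy.1]
    exact hlab _ _ hxy
  rw [curliness, hcard, hcard, hr, hA]
  congr 2
  rw [Finset.card_filter, Finset.card_filter]
  push_cast
  rw [← Finset.sum_sub_distrib, sub_zero]
  apply Finset.sum_congr rfl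
  intro x _
  cases ori x <;> simp

end

noncomputable section

/-! ### Local relations -/

theorem IsBasepoint.isPoint {D : Diagram} {x : ℕ × ℕ} (hx : IsBasepoint D x) :
    IsPoint D.layers x :=
  (List.getElem?_eq_some_iff.1 hx.choose_spec.1).1

/-- The normalized Alexander polynomial does not depend on the initial point. -/
theorem alexander_eq_alexanderAt {D : Diagram} {x : ℕ × ℕ} (hx : IsBasepoint D x) :
    alexander D = alexanderAt D x := by
  have h : ∃ x, IsBasepoint D x := ⟨x, hx⟩
  rw [alexander, dif_pos h]
  have hy := h.choose_spec
  generalize h.choose = y at hy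
  have h1 := amp_mul_basepointFactor D.isTangle hx.isPoint hy.isPoint
  have hx0 := basepointFactor_ne_zero hx
  have hy0 := basepointFactor_ne_zero hy
  have h2 : amp D.layers y / basepointFactor D.layers y =
      amp D.layers x / basepointFactor D.layers x := by
    rw [div_eq_div_iff hy0 hx0]; linear_combination h1
  have h3 : ∀ a b c d : RatFunc ℚ, a / (b * c) * d = a / c * (d / b) := fun a b c d => by
    rw [div_mul_div_comm, div_mul_eq_mul_div, mul_comm b c]
  rw [alexanderAt, alexanderAt, stateSum_eq_amp hx, stateSum_eq_amp hy, h3, h3, h2]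

theorem alexander_of_not_isConnected {D : Diagram} (h : ¬ MOY.IsConnected D.layers) :
    alexander D = 0 := by
  unfold alexander
  split_ifs
  · simp [alexanderAt, stateSum, h]
  · rfl

/-- The factor of the normalized Alexander polynomial that belongs to a piece. -/
def Piece.normalization : Piece → RatFunc ℚ
  | .cup s => if s.up then 1 else tq (-(2 * s.color))
  | .cap s => if s.up then tq (2 * s.color) else 1
  | .pos _ _ => 1
  | .neg _ _ => 1
  | .merge _ _ => (brace 1)⁻¹
  | .split _ _ => (brace 1)⁻¹
  | .twist s b => if b then tq s.color else tq (-s.color)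

/-- The product of the factors of the pieces, which comprises the framing factor, the colored
curliness, and the power of `t ^ (1 / 2) - t ^ (-1 / 2)`. -/
def normalization (w : List Layer) : RatFunc ℚ := (w.map fun l => l.piece.normalization).prod

theorem normalization_nil : normalization [] = 1 := rfl

theorem normalization_cons (l : Layer) (w : List Layer) :
    normalization (l :: w) = l.piece.normalization * normalization w := by simp [normalization]

theorem normalization_append (w w' : List Layer) :
    normalization (w ++ w') = normalization w * normalization w' := by simp [normalization]

theorem normalization_whisker (m n : List Strand) (w : List Layer) :
    normalization (whisker m w n) = normalization w := by
  simp [normalization, whisker, List.map_map, Function.comp_def]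

theorem brace_ne_zero {a : ℤ} (ha : a ≠ 0) : brace a ≠ 0 := by
  rw [brace, sub_ne_zero]
  intro h
  have := tq_injective h
  omega

theorem normalization_eq (w : List Layer) :
    normalization w = framing w * tq (2 * rot w) / brace 1 ^ numVertices w := by
  induction w with
  | nil => simp [normalization, framing, rot, numVertices, tq_zero]
  | cons l w ih =>
    have h1 := brace_ne_zero one_ne_zero
    have h2 : framing (l :: w) = l.piece.framing * framing w := by simp [framing]
    have h3 : rot (l :: w) = l.piece.rot + rot w := by simp [rot]
    have h4 : numVertices (l :: w) = numVertices w + if l.piece.isVertex then 1 else 0 := by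
      simp [numVertices, List.countP_cons]
    have h5 : l.piece.normalization = l.piece.framing * tq (2 * l.piece.rot) /
        brace 1 ^ (if l.piece.isVertex then 1 else 0) := by
      cases hl : l.piece with
      | cup s => cases hs : s.up <;> simp [hs, Piece.normalization, Piece.framing, Piece.rot,
          Piece.isVertex, tq_zero]
      | cap s => cases hs : s.up <;> simp [hs, Piece.normalization, Piece.framing, Piece.rot,
          Piece.isVertex, tq_zero]
      | twist s b => cases b <;> simp [Piece.normalization, Piece.framing, Piece.rot,
          Piece.isVertex, tq_zero]
      | _ => simp [Piece.normalization, Piece.framing, Piece.rot, Piece.isVertex, tq_zero]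
    rw [normalization_cons, ih, h2, h3, h4, h5, mul_add, tq_add, pow_add]
    field_simp

/-- The normalized Alexander polynomial as a product of local factors and the transfer amplitude.
The remaining factor `brace 1` turns the exponent `|V| - 1` into `|V|`. -/
theorem alexander_eq_amp {D : Diagram} {x : ℕ × ℕ} (hx : IsBasepoint D x) :
    alexander D =
      brace 1 / basepointFactor D.layers x * normalization D.layers * amp D.layers x := by
  have h1 := brace_ne_zero one_ne_zero
  rw [alexander_eq_alexanderAt hx, alexanderAt, stateSum_eq_amp hx, curliness_eq D.isTangle,
    normalization_eq, zpow_sub_one₀ h1, zpow_natCast]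
  have hx0 := basepointFactor_ne_zero hx
  field_simp

/-- After `mark`, a linear relation is only needed for lists of bits in which the two marked gaps
are covered. -/
theorem mark_comb {G G₁ G₂ : Cov} {c₀ c₁ c₂ : RatFunc ℚ} {p n : ℕ}
    (H : ∀ A m : List Bool, A.length = p → m.length = n →
      c₀ * G (A ++ true :: true :: m) =
        c₁ * G₁ (A ++ true :: true :: m) + c₂ * G₂ (A ++ true :: true :: m))
    {I : List Bool} (hI : I.length = p + n + 2) :
    c₀ * mark p G I = c₁ * mark p G₁ I + c₂ * mark p G₂ I := by
  induction p generalizing G G₁ G₂ I with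
  | zero =>
    match I with
    | false :: false :: I => exact H [] I rfl (by simpa using hI)
    | false :: true :: I => simp [mark]
    | true :: b :: I => simp [mark]
    | [b] => simp at hI
    | [] => simp at hI
  | succ p ih =>
    match I with
    | b :: I =>
      exact ih (G := fun J => G (b :: J)) (G₁ := fun J => G₁ (b :: J)) (G₂ := fun J => G₂ (b :: J))
        (fun A m hA hm => H (b :: A) m (by simp [hA]) hm) (by simp at hI; omega)
    | [] => simp at hI

/-- Vertical strands next to a tangle do not affect its transfer operator. -/
theorem sweep_whisker {S T : List Strand} {w : List Layer} (hw : IsTangle S w T)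
    (L R : List Strand) (h : Cov) {A m C : List Bool} (hA : A.length = L.length)
    (hm : m.length = S.length + 1) :
    sweep (whisker L w R) h (A ++ m ++ C) = sweep w (fun m' => h (A ++ m' ++ C)) m := by
  induction w generalizing S m with
  | nil => rfl
  | cons l w ih =>
    obtain ⟨rfl, hw⟩ := hw
    obtain ⟨A', m', C', rfl, hA', hm', hC'⟩ := exists_split l hm
    have h1 : A ++ (A' ++ m' ++ C') ++ C = (A ++ A') ++ m' ++ (C' ++ C) := by simp
    have h2 : whisker L (l :: w) R = ⟨L ++ l.left, l.piece, l.right ++ R⟩ :: whisker L w R := rfl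
    rw [h1, h2, sweep_cons, sweep_cons, step_append l _ hA' hm',
      step_append ⟨L ++ l.left, l.piece, l.right ++ R⟩ _ (by simp [hA, hA']) hm']
    apply act_congr
    intro m'' hm''
    have hm'' : m''.length = l.piece.cod.length + 1 := hm''
    have h3 : (A ++ A') ++ m'' ++ (C' ++ C) = A ++ (A' ++ m'' ++ C') ++ C := by simp
    rw [h3]
    apply ih hw
    rw [l.length_target]
    simp; omega

theorem IsTangle.ne_nil {S T : List Strand} {w : List Layer} (hw : IsTangle S w T)
    (h : S ≠ T) : w ≠ [] := by
  rintro rfl; exact h hw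

/-- A linear relation between the transfer operators of tangles on the lists of bits in which the
two leftmost gaps are covered gives the same relation between the Alexander polynomials: choose the
initial point on the leftmost strand below the tangles. All diagrams agree up to the line of this
point, so they share the factor `|δ|`. -/
theorem local_relation {s : Strand} {S T : List Strand} (hs : 0 < s.color) (hT : T ≠ [])
    (E : Outside (s :: S) T) (X Y Z : Tangle (s :: S) T) (c₁ c₂ : RatFunc ℚ)
    (H : ∀ (h : Cov) (m : List Bool), m.length = S.length →
      normalization X.layers * sweep X.layers h (true :: true :: m) =
        c₁ * (normalization Y.layers * sweep Y.layers h (true :: true :: m)) +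
        c₂ * (normalization Z.layers * sweep Z.layers h (true :: true :: m))) :
    alexander (E.fill X) = c₁ * alexander (E.fill Y) + c₂ * alexander (E.fill Z) := by
  set x : ℕ × ℕ := (E.below.layers.length, E.left.length) with hx
  set u := E.below.layers with hu
  set v := E.above.layers with hv
  have hv0 : v ≠ [] := E.above.isTangle.ne_nil (by simp [hT])
  have hlayers : ∀ X, (E.fill X).layers = u ++ (whisker E.left X.layers E.right ++ v) := fun X => by
    simp [Outside.fill, hu, hv]
  have htake : ∀ X, (E.fill X).layers.take x.1 = u := fun X => by rw [hlayers, List.take_left]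
  have hdrop : ∀ X, (E.fill X).layers.drop x.1 = whisker E.left X.layers E.right ++ v := fun X => by
    rw [hlayers, List.drop_left]
  have hat : ∀ X, strandsAt (E.fill X).layers x.1 = E.left ++ (s :: S) ++ E.right := fun X => by
    have h1 := isTangle_take (E.fill X).isTangle (k := x.1) (by rw [hlayers]; simp [hx])
    rw [htake] at h1
    have h2 := E.below.isTangle
    rw [← hu] at h2
    have h3 := strandsAt_length h1
    rw [← h3, strandsAt_length h2]
  have hbp : ∀ X, IsBasepoint (E.fill X) x := fun X => ⟨s, by rw [hat X]; simp [hx], hs⟩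
  set I₀ := E.left ++ (s :: S) ++ E.right with hI₀
  have hbf : ∀ X, basepointFactor (E.fill X).layers x = basepointFactor (E.fill Y).layers x :=
    fun X => by simp only [basepointFactor, index, hat]
  let G : Tangle (s :: S) T → Cov := fun X =>
    sweep (whisker E.left X.layers E.right) (upper v)
  have hamp : ∀ X, amp (E.fill X).layers x = sweep u (mark E.left.length (G X)) [false] := fun X => by
    rw [amp, htake, hdrop, upper_append _ _ hv0]
  have hal : ∀ X, alexander (E.fill X) = brace 1 / basepointFactor (E.fill Y).layers x *
      normalization u * normalization v * (normalization X.layers * sweep u (mark E.left.length (G X)) [false]) :=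
    fun X => by
      rw [alexander_eq_amp (hbp X), hbf, hamp, hlayers X, normalization_append, normalization_append,
        normalization_whisker]
      ring
  have key : normalization X.layers * sweep u (mark E.left.length (G X)) [false] =
      c₁ * (normalization Y.layers * sweep u (mark E.left.length (G Y)) [false]) +
      c₂ * (normalization Z.layers * sweep u (mark E.left.length (G Z)) [false]) := by
    rw [← mul_assoc, ← mul_assoc, ← sweep_smul, ← sweep_smul, ← sweep_smul, ← sweep_add]
    apply sweep_congr E.below.isTangle _ rfl
    intro I hI
    refine mark_comb (n := S.length + E.right.length) ?_ (by rw [hI]; simp; omega)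
    intro A m' hA hm'
    obtain ⟨m, C, rfl, hm⟩ : ∃ m C, m' = m ++ C ∧ m.length = S.length :=
      ⟨m'.take S.length, m'.drop S.length, by simp, by simp; omega⟩
    have h1 : A ++ true :: true :: (m ++ C) = A ++ (true :: true :: m) ++ C := by simp
    have h2 : ∀ X, G X (A ++ true :: true :: (m ++ C)) =
        sweep X.layers (fun m' => upper v (A ++ m' ++ C)) (true :: true :: m) := fun X => by
      rw [h1]; exact sweep_whisker X.isTangle _ _ _ hA (by simp [hm])
    rw [h2, h2, h2, H _ m hm]
    ring
  rw [hal X, hal Y, hal Z, key]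
  ring

/-- The case of two diagrams of `local_relation`. -/
theorem local_relation_single {s : Strand} {S T : List Strand} (hs : 0 < s.color) (hT : T ≠ [])
    (E : Outside (s :: S) T) (X Y : Tangle (s :: S) T) (c : RatFunc ℚ)
    (H : ∀ (h : Cov) (m : List Bool), m.length = S.length →
      normalization X.layers * sweep X.layers h (true :: true :: m) =
        c * (normalization Y.layers * sweep Y.layers h (true :: true :: m))) :
    alexander (E.fill X) = c * alexander (E.fill Y) := by
  have := local_relation hs hT E X Y Y c 0 fun h m hm => by rw [H h m hm]; ring
  rw [this]; ring

end

noncomputable section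

/-! ### Values of the transfer operators -/

section Values

variable (L R : List Strand) (p : Piece) (h : Cov) (s : Strand) (i j : ℕ) (b x z : Bool)
  (I : List Bool)

@[simp] theorem step_left : step ⟨s :: L, p, R⟩ h (b :: I) = step ⟨L, p,
    R⟩ (fun J => h (b :: J)) I := by
  have h1 : L.length + 1 + p.dom.length + 1 = L.length + p.dom.length + 1 + 1 := by omega
  simp [step, h1]

@[simp] theorem step_cup_true : step ⟨[], .cup s,
    R⟩ h (true :: I) = h (true :: false :: true :: I) := by
  simp [step, act, moves, Piece.dom]

@[simp] theorem step_cup_false : step ⟨[], .cup s, R⟩ h (false :: I) =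
    h (true :: false :: false :: I) + h (false :: false :: true :: I) := by
  simp [step, act, moves, Piece.dom]

@[simp] theorem step_cap_true_true : step ⟨[], .cap s, R⟩ h (true :: true :: true :: I) = 0 := by
  simp [step, act, moves, Piece.dom]

@[simp] theorem step_cap_true_false :
    step ⟨[], .cap s, R⟩ h (true :: true :: false :: I) = h (true :: I) := by
  simp [step, act, moves, Piece.dom]

@[simp] theorem step_cap_false : step ⟨[], .cap s, R⟩ h (false :: true :: z :: I) = h (z :: I) := by
  cases z <;> simp [step, act, moves, Piece.dom]

@[simp] theorem step_cap_zero : step ⟨[], .cap s, R⟩ h (x :: false :: z :: I) = 0 := by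
  simp [step, act, moves, Piece.dom]

@[simp] theorem step_twist : step ⟨[], .twist s b, R⟩ h (x :: z :: I) = h (x :: z :: I) := by
  simp [step, act, moves, Piece.dom]

@[simp] theorem step_split : step ⟨[], .split i j, R⟩ h (x :: z :: I) =
    brace (i + j) * h (x :: false :: z :: I) := by
  simp [step, act, moves, Piece.dom]

@[simp] theorem step_merge_zero : step ⟨[], .merge i j, R⟩ h (x :: false :: z :: I) =
    brace (i + j) * h (x :: z :: I) := by
  simp [step, act, moves, Piece.dom]

@[simp] theorem step_merge_true_true :
    step ⟨[], .merge i j, R⟩ h (true :: true :: true :: I) = 0 := by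
  simp [step, act, moves, Piece.dom]

@[simp] theorem step_merge_true_false : step ⟨[], .merge i j, R⟩ h (true :: true :: false :: I) =
    brace i * tq (-(2 * j)) * h (true :: true :: I) := by
  simp [step, act, moves, Piece.dom]

@[simp] theorem step_merge_false_true : step ⟨[], .merge i j, R⟩ h (false :: true :: true :: I) =
    tq (2 * i) * brace j * h (true :: true :: I) := by
  simp [step, act, moves, Piece.dom]

@[simp] theorem step_merge_false_false : step ⟨[], .merge i j, R⟩ h (false :: true :: false :: I) =
    tq (2 * i) * brace j * h (true :: false :: I) +
      brace i * tq (-(2 * j)) * h (false :: true :: I) := by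
  simp [step, act, moves, Piece.dom]

@[simp] theorem step_pos_true_true : step ⟨[], .pos i j, R⟩ h (true :: true :: true :: I) =
    -tq (4 * i) * h (true :: true :: true :: I) := by
  simp [step, act, moves, crossingMoves, Piece.dom]

@[simp] theorem step_pos_true_false : step ⟨[], .pos i j, R⟩ h (true :: true :: false :: I) =
    -tq (4 * i) * h (true :: true :: false :: I) + h (true :: false :: true :: I) := by
  simp [step, act, moves, crossingMoves, Piece.dom]

@[simp] theorem step_neg_true_true : step ⟨[], .neg i j, R⟩ h (true :: true :: true :: I) =
    -tq (-(4 * j)) * h (true :: true :: true :: I) := by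
  simp [step, act, moves, crossingMoves, Piece.dom]

@[simp] theorem step_neg_true_false : step ⟨[], .neg i j, R⟩ h (true :: true :: false :: I) =
    -tq (-(4 * j)) * h (true :: true :: false :: I) +
      tq (-(4 * j)) * h (true :: false :: true :: I) := by
  simp [step, act, moves, crossingMoves, Piece.dom]

end Values

attribute [simp] sweep_cons sweep_nil normalization_cons normalization_nil tq_zero

end

noncomputable section

/-! ### The relations -/

/-- The addition formula for `t ^ (k / 2) - t ^ (-k / 2)`. -/
theorem brace_add (a b : ℤ) : brace (a + b) = tq (2 * a) * brace b + (tq (2 * b))⁻¹ * brace a := by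
  have h1 := tq_ne_zero (2 * a)
  have h2 := tq_ne_zero (2 * b)
  simp only [brace, mul_add, neg_add, tq_add, tq_neg]
  field_simp
  ring

/-- The addition formula with the roles of the two summands exchanged. -/
theorem brace_add' (a b : ℤ) :
    brace (a + b) = (tq (2 * a))⁻¹ * brace b + tq (2 * b) * brace a := by
  rw [add_comm a b, brace_add, add_comm]

theorem alexander_pos_of_le {i j : ℕ} (h : i ≤ j) (hi : 0 < i)
    (E : Outside [up i, up j] [up j, up i]) :
    alexander (E.fill (Piece.pos i j).toTangle) =
      -tq (2 * (i + j)) / (qint i * qint j) * alexander (E.fill (bridgeLeft i j h)) +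
        tq (2 * j) / (qint i * qint (i + j)) * alexander (E.fill (wideEdge i j)) := by
  obtain ⟨d, rfl⟩ := Nat.exists_eq_add_of_le h
  refine local_relation (by exact hi) (by simp) E _ _ _ _ _ fun h m hm => ?_
  obtain ⟨z, rfl⟩ := List.length_eq_one_iff.1 hm
  have h1 := brace_ne_zero one_ne_zero
  have hb1 : brace (i) ≠ 0 := brace_ne_zero (by omega)
  have hb2 : brace (i + d) ≠ 0 := brace_ne_zero (by omega)
  have hb3 : brace (i + (i + d)) ≠ 0 := brace_ne_zero (by omega)
  have ht1 := tq_ne_zero (2 * i)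
  have ht2 := tq_ne_zero (2 * d)
  cases z <;>
    simp [Piece.toTangle, bridgeLeft, wideEdge, Piece.normalization, up, qint] <;>
    simp only [mul_add, neg_add, tq_add, tq_neg, tq_four_mul, add_comm] at hb1 hb2 hb3 ⊢ <;>
    field_simp

theorem alexander_neg_of_le {i j : ℕ} (h : i ≤ j) (hi : 0 < i)
    (E : Outside [up i, up j] [up j, up i]) :
    alexander (E.fill (Piece.neg i j).toTangle) =
      -tq (-(2 * (i + j))) / (qint i * qint j) * alexander (E.fill (bridgeLeft i j h)) +
        tq (-(2 * j)) / (qint i * qint (i + j)) * alexander (E.fill (wideEdge i j)) := by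
  obtain ⟨d, rfl⟩ := Nat.exists_eq_add_of_le h
  refine local_relation (by exact hi) (by simp) E _ _ _ _ _ fun h m hm => ?_
  obtain ⟨z, rfl⟩ := List.length_eq_one_iff.1 hm
  have h1 := brace_ne_zero one_ne_zero
  have hb1 : brace (i) ≠ 0 := brace_ne_zero (by omega)
  have hb2 : brace (i + d) ≠ 0 := brace_ne_zero (by omega)
  have hb3 : brace (i + (i + d)) ≠ 0 := brace_ne_zero (by omega)
  have ht1 := tq_ne_zero (2 * i)
  have ht2 := tq_ne_zero (2 * d)
  cases z <;>
    simp [Piece.toTangle, bridgeLeft, wideEdge, Piece.normalization, up, qint] <;>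
    simp only [mul_add, neg_add, tq_add, tq_neg, tq_four_mul, add_comm] at hb1 hb2 hb3 ⊢ <;>
    field_simp

theorem alexander_pos_of_ge {i j : ℕ} (h : j ≤ i) (hj : 0 < j)
    (E : Outside [up i, up j] [up j, up i]) :
    alexander (E.fill (Piece.pos i j).toTangle) =
      -tq (2 * (i + j)) / (qint i * qint j) * alexander (E.fill (bridgeRight i j h)) +
        tq (2 * i) / (qint j * qint (i + j)) * alexander (E.fill (wideEdge i j)) := by
  obtain ⟨d, rfl⟩ := Nat.exists_eq_add_of_le h
  refine local_relation (by exact Nat.add_pos_left hj d) (by simp) E _ _ _ _ _ fun h m hm => ?_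
  obtain ⟨z, rfl⟩ := List.length_eq_one_iff.1 hm
  have h1 := brace_ne_zero one_ne_zero
  have hb1 : brace (j) ≠ 0 := brace_ne_zero (by omega)
  have hb2 : brace (j + d) ≠ 0 := brace_ne_zero (by omega)
  have hb3 : brace (j + (j + d)) ≠ 0 := brace_ne_zero (by omega)
  have ht1 := tq_ne_zero (2 * j)
  have ht2 := tq_ne_zero (2 * d)
  cases z <;>
    simp [Piece.toTangle, bridgeRight, wideEdge, Piece.normalization, up, qint] <;>
    simp only [mul_add, tq_add, tq_neg, tq_four_mul, add_comm] at hb1 hb2 hb3 ⊢ <;>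
    first
      | (field_simp; done)
      | (field_simp; rw [brace_add j d]; field_simp; ring)

theorem alexander_neg_of_ge {i j : ℕ} (h : j ≤ i) (hj : 0 < j)
    (E : Outside [up i, up j] [up j, up i]) :
    alexander (E.fill (Piece.neg i j).toTangle) =
      -tq (-(2 * (i + j))) / (qint i * qint j) * alexander (E.fill (bridgeRight i j h)) +
        tq (-(2 * i)) / (qint j * qint (i + j)) * alexander (E.fill (wideEdge i j)) := by
  obtain ⟨d, rfl⟩ := Nat.exists_eq_add_of_le h
  refine local_relation (by exact Nat.add_pos_left hj d) (by simp) E _ _ _ _ _ fun h m hm => ?_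
  obtain ⟨z, rfl⟩ := List.length_eq_one_iff.1 hm
  have h1 := brace_ne_zero one_ne_zero
  have hb1 : brace (j) ≠ 0 := brace_ne_zero (by omega)
  have hb2 : brace (j + d) ≠ 0 := brace_ne_zero (by omega)
  have hb3 : brace (j + (j + d)) ≠ 0 := brace_ne_zero (by omega)
  have ht1 := tq_ne_zero (2 * j)
  have ht2 := tq_ne_zero (2 * d)
  cases z <;>
    simp [Piece.toTangle, bridgeRight, wideEdge, Piece.normalization, up, qint] <;>
    simp only [mul_add, neg_add, tq_add, tq_neg, tq_four_mul, add_comm] at hb1 hb2 hb3 ⊢ <;>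
    first
      | (field_simp; done)
      | (field_simp; rw [brace_add' j d]; field_simp; ring)

theorem alexander_loopRight {i j : ℕ} (hj : 0 < j)
    (E : Outside [up j] [up j]) :
    alexander (E.fill (loopRight i j)) =
      qint j * qint (i + j) * alexander (E.fill (idTangle [up j])) := by
  refine local_relation_single (by exact hj) (by simp) E _ _ _ fun h m hm => ?_
  obtain rfl := List.length_eq_zero_iff.1 hm
  have h1 := brace_ne_zero one_ne_zero
  have ht1 := tq_ne_zero (2 * i)
  simp [loopRight, idTangle, Piece.normalization, up, dn, qint]
  simp only [tq_neg, add_comm]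
  field_simp

theorem alexander_loopLeft {i j : ℕ} (hj : 0 < j)
    (E : Outside [up j] [up j]) :
    alexander (E.fill (loopLeft i j)) =
      qint j * qint (i + j) * alexander (E.fill (idTangle [up j])) := by
  refine local_relation_single (by exact hj) (by simp) E _ _ _ fun h m hm => ?_
  obtain rfl := List.length_eq_zero_iff.1 hm
  have h1 := brace_ne_zero one_ne_zero
  have ht1 := tq_ne_zero (2 * i)
  simp [loopLeft, idTangle, Piece.normalization, up, dn, qint]
  simp only [tq_neg]
  field_simp

theorem alexander_bigon {i j : ℕ} (h : j ≤ i) (hj : 0 < j)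
    (E : Outside [up i] [up i]) :
    alexander (E.fill (bigon i j h)) = qint i ^ 2 * alexander (E.fill (idTangle [up i])) := by
  obtain ⟨d, rfl⟩ := Nat.exists_eq_add_of_le h
  refine local_relation_single (by exact Nat.add_pos_left hj d) (by simp) E _ _ _ fun h m hm => ?_
  obtain rfl := List.length_eq_zero_iff.1 hm
  have h1 := brace_ne_zero one_ne_zero
  have ht1 := tq_ne_zero (2 * j)
  have ht2 := tq_ne_zero (2 * d)
  simp [bigon, idTangle, Piece.normalization, up, qint]
  simp only [add_comm]
  field_simp

theorem alexander_antiSquare {i j : ℕ} (h : j ≤ i) (hj : 0 < j)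
    (E : Outside [up j, dn i] [up j, dn i]) :
    alexander (E.fill (antiSquare i j)) =
      qint (i + j) ^ 3 / qint i * alexander (E.fill (antiEdge i j h)) +
        qint j ^ 2 * qint (i + j) ^ 2 * alexander (E.fill (idTangle [up j, dn i])) := by
  obtain ⟨d, rfl⟩ := Nat.exists_eq_add_of_le h
  refine local_relation (by exact hj) (by simp) E _ _ _ _ _ fun h m hm => ?_
  obtain ⟨z, rfl⟩ := List.length_eq_one_iff.1 hm
  have h1 := brace_ne_zero one_ne_zero
  have hb1 : brace (j + d) ≠ 0 := brace_ne_zero (by omega)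
  have ht1 := tq_ne_zero (2 * j)
  have ht2 := tq_ne_zero (2 * d)
  cases z <;>
    simp [antiSquare, antiEdge, idTangle, Piece.normalization, up, dn, qint] <;>
    simp only [mul_add, neg_add, tq_add, tq_neg, add_comm] at hb1 ⊢ <;>
    first
      | (field_simp; done)
      | (field_simp; ring)

theorem alexander_splitLeft {i j k : ℕ} (hi : 0 < i) (hj : 0 < j)
    (E : Outside [up (i + j + k)] [up i, up j, up k]) :
    alexander (E.fill (splitLeft i j k)) =
      qint (i + j) / qint (j + k) * alexander (E.fill (splitRight i j k)) := by
  refine local_relation_single (by exact Nat.add_pos_left (Nat.add_pos_left hi j) k) (by simp) E _ _ _ fun h m hm => ?_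
  obtain rfl := List.length_eq_zero_iff.1 hm
  have h1 := brace_ne_zero one_ne_zero
  have hb1 : brace ((j : ℤ) + k) ≠ 0 := brace_ne_zero (by omega)
  simp [splitLeft, splitRight, Piece.normalization, up, qint]
  simp only [add_assoc] at hb1 ⊢
  field_simp

theorem alexander_mergeLeft {i j k : ℕ} (hi : 0 < i) (hj : 0 < j)
    (E : Outside [up i, up j, up k] [up (i + j + k)]) :
    alexander (E.fill (mergeLeft i j k)) =
      qint (i + j) / qint (j + k) * alexander (E.fill (mergeRight i j k)) := by
  refine local_relation_single (by exact hi) (by simp) E _ _ _ fun h m hm => ?_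
  obtain ⟨z, z', rfl⟩ := List.length_eq_two.1 hm
  have h1 := brace_ne_zero one_ne_zero
  have hb1 : brace (j + k) ≠ 0 := brace_ne_zero (by omega)
  have ht1 := tq_ne_zero (2 * i)
  have ht2 := tq_ne_zero (2 * j)
  have ht3 := tq_ne_zero (2 * k)
  cases z <;> cases z' <;>
    simp [mergeLeft, mergeRight, Piece.normalization, up, qint]
  simp only [mul_add, neg_add, tq_add, tq_neg]
  field_simp

theorem alexander_ladder {i j k l : ℕ} (hk : k ≤ j) (hl : l ≤ k) (hi : 0 < i)
    (E : Outside [up i, up j] [up (i + k - l), up (j + l - k)]) :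
    alexander (E.fill (ladder i j k l hk hl)) =
      qint j * qint l * qint (i + k) / qint (i + j) *
          alexander (E.fill (ladderWide i j k l hk hl)) +
        qint (i + k) * qint (j - k) * alexander (E.fill (ladderBridge i j k l hk hl)) := by
  obtain ⟨d, rfl⟩ := Nat.exists_eq_add_of_le hl
  obtain ⟨e, rfl⟩ := Nat.exists_eq_add_of_le hk
  have f1 : i + (l + d) - l = i + d := by omega
  have f2 : l + d + e + l - (l + d) = e + l := by omega
  have f3 : l + d - l = d := by omega
  have f4 : l + d + e - (l + d) = e := by omega
  refine local_relation (by exact hi) (by simp) E _ _ _ _ _ fun h m hm => ?_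
  obtain ⟨z, rfl⟩ := List.length_eq_one_iff.1 hm
  have h1 := brace_ne_zero one_ne_zero
  have hb1 : brace (i + (l + d + e)) ≠ 0 := brace_ne_zero (by omega)
  have ht1 := tq_ne_zero (2 * i)
  have ht2 := tq_ne_zero (2 * l)
  have ht3 := tq_ne_zero (2 * d)
  have ht4 := tq_ne_zero (2 * e)
  cases z <;>
    simp [ladder, ladderWide, ladderBridge, f1, f2, f3, f4, Piece.normalization, up, qint] <;>
    simp only [mul_add, neg_add, tq_add, tq_neg, add_comm, add_left_comm, add_assoc] at hb1 ⊢ <;>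
    field_simp

theorem alexander_zeroEdgeRight {s s' : Strand} (hs : 0 < s.color)
    (E : Outside [s, s'] [s, s']) :
    alexander (E.fill (zeroEdgeRight s s')) =
      qint s.color * qint s'.color * alexander (E.fill (idTangle [s, s'])) := by
  refine local_relation_single hs (by simp) E _ _ _ fun h m hm => ?_
  obtain ⟨z, rfl⟩ := List.length_eq_one_iff.1 hm
  have h1 := brace_ne_zero one_ne_zero
  have ht1 := tq_ne_zero (2 * s.color)
  have ht2 := tq_ne_zero (2 * s'.color)
  obtain ⟨i, o⟩ := s
  obtain ⟨j, o'⟩ := s'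
  cases o <;> cases o' <;>
  cases z <;>
    simp [zeroEdgeRight, idTangle, emitRight, absorbLeft, whisker, Piece.normalization, up, dn,
      qint, tq_neg, brace_zero] <;>
    field_simp

theorem alexander_zeroEdgeLeft {s s' : Strand} (hs : 0 < s.color)
    (E : Outside [s, s'] [s, s']) :
    alexander (E.fill (zeroEdgeLeft s s')) =
      qint s.color * qint s'.color * alexander (E.fill (idTangle [s, s'])) := by
  refine local_relation_single hs (by simp) E _ _ _ fun h m hm => ?_
  obtain ⟨z, rfl⟩ := List.length_eq_one_iff.1 hm
  have h1 := brace_ne_zero one_ne_zero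
  have ht1 := tq_ne_zero (2 * s.color)
  have ht2 := tq_ne_zero (2 * s'.color)
  obtain ⟨i, o⟩ := s
  obtain ⟨j, o'⟩ := s'
  cases o <;> cases o' <;>
  cases z <;>
    simp [zeroEdgeLeft, idTangle, emitLeft, absorbRight, whisker, Piece.normalization, up, dn,
      qint, tq_neg, brace_zero] <;>
    field_simp

theorem alexander_twist {s : Strand} (hs : 0 < s.color) (b : Bool) (E : Outside [s] [s]) :
    alexander (E.fill (Piece.twist s b).toTangle) =
      tq (if b then s.color else -s.color) * alexander (E.fill (idTangle [s])) := by
  refine local_relation_single hs (by simp) E _ _ _ fun h m hm => ?_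
  obtain rfl := List.length_eq_zero_iff.1 hm
  cases b <;> simp [Piece.toTangle, idTangle, Piece.normalization]

theorem alexander_circle {i : ℕ} (hi : 0 < i) (o : Bool) :
    alexander (circle ⟨i, o⟩) = 1 / qint i := by
  have hb : IsBasepoint (circle ⟨i, o⟩) (1, 0) :=
    ⟨⟨i, o⟩, by simp [circle, strandsAt, Layer.target, Piece.cod], hi⟩
  have h1 := brace_ne_zero one_ne_zero
  have h2 : brace i ≠ 0 := brace_ne_zero (by omega)
  have h3 := tq_ne_zero (2 * i)
  have h4 := basepointFactor_ne_zero hb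
  rw [alexander_eq_amp hb]
  have ha : amp (circle ⟨i, o⟩).layers (1, 0) = 1 := by
    simp [amp, circle, mark, upper, sweep_nil, fin]
  have hf : basepointFactor (circle ⟨i, o⟩).layers (1, 0) * tq (if o then -(2 * i) else 2 * i) =
      brace i := by
    cases o <;> simp [basepointFactor, index, circle, strandsAt, Layer.target, Piece.cod,
      Strand.flow, brace, tq_neg, tq_four_mul] <;> field_simp
  have hn : normalization (circle ⟨i, o⟩).layers = (tq (if o then -(2 * i) else 2 * i))⁻¹ := by
    cases o <;> simp [circle, Piece.normalization, tq_neg]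
  rw [ha, hn, qint, ← hf]
  field_simp

end

end MOY

theorem theorem4p1 :
    -- the value does not depend on the initial point
    (∀ (D : Diagram) (x : ℕ × ℕ), IsBasepoint D x → alexander D = alexanderAt D x) ∧
    -- (i)
    (∀ i : ℕ, 0 < i →
      alexander (circle (up i)) = 1 / qint i ∧ alexander (circle (dn i)) = 1 / qint i) ∧
    -- (ii)
    (∀ D : Diagram, ¬ MOY.IsConnected D.layers → alexander D = 0) ∧
    -- (iii)
    (∀ s : Strand, 0 < s.color → ∀ E : Outside [s] [s],
      alexander (E.fill (Piece.twist s true).toTangle)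
        = tq s.color * alexander (E.fill (idTangle [s])) ∧
      alexander (E.fill (Piece.twist s false).toTangle)
        = tq (-s.color) * alexander (E.fill (idTangle [s]))) ∧
    -- (iv), first case
    (∀ (i j : ℕ) (h : i ≤ j), 0 < i → 0 < j → ∀ E : Outside [up i, up j] [up j, up i],
      alexander (E.fill (Piece.pos i j).toTangle)
        = -tq (2 * (i + j)) / (qint i * qint j) * alexander (E.fill (bridgeLeft i j h))
          + tq (2 * j) / (qint i * qint (i + j)) * alexander (E.fill (wideEdge i j)) ∧
      alexander (E.fill (Piece.neg i j).toTangle)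
        = -tq (-(2 * (i + j))) / (qint i * qint j) * alexander (E.fill (bridgeLeft i j h))
          + tq (-(2 * j)) / (qint i * qint (i + j)) * alexander (E.fill (wideEdge i j))) ∧
    -- (iv), second case
    (∀ (i j : ℕ) (h : j ≤ i), 0 < i → 0 < j → ∀ E : Outside [up i, up j] [up j, up i],
      alexander (E.fill (Piece.pos i j).toTangle)
        = -tq (2 * (i + j)) / (qint i * qint j) * alexander (E.fill (bridgeRight i j h))
          + tq (2 * i) / (qint j * qint (i + j)) * alexander (E.fill (wideEdge i j)) ∧
      alexander (E.fill (Piece.neg i j).toTangle)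
        = -tq (-(2 * (i + j))) / (qint i * qint j) * alexander (E.fill (bridgeRight i j h))
          + tq (-(2 * i)) / (qint j * qint (i + j)) * alexander (E.fill (wideEdge i j))) ∧
    -- (v)
    (∀ i j : ℕ, 0 < i → 0 < j → ∀ E : Outside [up j] [up j],
      alexander (E.fill (loopRight i j))
        = qint j * qint (i + j) * alexander (E.fill (idTangle [up j])) ∧
      alexander (E.fill (loopLeft i j))
        = qint j * qint (i + j) * alexander (E.fill (idTangle [up j]))) ∧
    -- (vi)
    (∀ (i j : ℕ) (h : j ≤ i), 0 < j → ∀ E : Outside [up i] [up i],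
      alexander (E.fill (bigon i j h)) = qint i ^ 2 * alexander (E.fill (idTangle [up i]))) ∧
    -- (vii)
    (∀ (i j : ℕ) (h : j ≤ i), 0 < j → ∀ E : Outside [up j, dn i] [up j, dn i],
      alexander (E.fill (antiSquare i j))
        = qint (i + j) ^ 3 / qint i * alexander (E.fill (antiEdge i j h))
          + qint j ^ 2 * qint (i + j) ^ 2 * alexander (E.fill (idTangle [up j, dn i]))) ∧
    -- (viii)
    (∀ i j k : ℕ, 0 < i → 0 < j → 0 < k →
      (∀ E : Outside [up (i + j + k)] [up i, up j, up k],
        alexander (E.fill (splitLeft i j k))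
          = qint (i + j) / qint (j + k) * alexander (E.fill (splitRight i j k))) ∧
      (∀ E : Outside [up i, up j, up k] [up (i + j + k)],
        alexander (E.fill (mergeLeft i j k))
          = qint (i + j) / qint (j + k) * alexander (E.fill (mergeRight i j k)))) ∧
    -- (ix)
    (∀ (i j k l : ℕ) (hk : k ≤ j) (hl : l ≤ k), 0 < i → 0 < l →
      ∀ E : Outside [up i, up j] [up (i + k - l), up (j + l - k)],
        alexander (E.fill (ladder i j k l hk hl))
          = qint j * qint l * qint (i + k) / qint (i + j)
              * alexander (E.fill (ladderWide i j k l hk hl))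
            + qint (i + k) * qint (j - k) * alexander (E.fill (ladderBridge i j k l hk hl))) ∧
    -- (x)
    (∀ s s' : Strand, 0 < s.color → 0 < s'.color → ∀ E : Outside [s, s'] [s, s'],
      alexander (E.fill (zeroEdgeRight s s'))
        = qint s.color * qint s'.color * alexander (E.fill (idTangle [s, s'])) ∧
      alexander (E.fill (zeroEdgeLeft s s'))
        = qint s.color * qint s'.color * alexander (E.fill (idTangle [s, s']))) := by
  refine ⟨fun D x hx => alexander_eq_alexanderAt hx,
    fun i hi => ⟨alexander_circle hi true, alexander_circle hi false⟩,
    fun D hD => alexander_of_not_isConnected hD,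
    fun s hs E => ⟨alexander_twist hs true E, alexander_twist hs false E⟩,
    fun i j h hi _ E => ⟨alexander_pos_of_le h hi E, alexander_neg_of_le h hi E⟩,
    fun i j h _ hj E => ⟨alexander_pos_of_ge h hj E, alexander_neg_of_ge h hj E⟩,
    fun i j _ hj E => ⟨alexander_loopRight hj E, alexander_loopLeft hj E⟩,
    fun i j h hj E => alexander_bigon h hj E,
    fun i j h hj E => alexander_antiSquare h hj E,
    fun i j k hi hj _ => ⟨alexander_splitLeft hi hj, alexander_mergeLeft hi hj⟩,
    fun i j k l hk hl hi _ E => alexander_ladder hk hl hi E,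
    fun s s' hs _ E => ⟨alexander_zeroEdgeRight hs E, alexander_zeroEdgeLeft hs E⟩⟩
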